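/- Let $G$ be a (real, finite-dimensional) Lie group with Lie algebra $\mathfrak g$, $H$ a closed subgroup with Lie algebra $\mathfrak h$, $\mathfrak m$ a linear subspace of $\mathfrak g$ complementary to $\mathfrak h$, and $\chi\colon H\to\mathbb C\setminus\{0\}$ a continuous homomorphism; write $\chi$ also for its differential. Let $S(\mathfrak m)$ be the complexified symmetric algebra of $\mathfrak m$. Let $\mathbb D(G)$ be the algebra of left invariant differential operators on $G$ with complex coefficients. Let $\mathfrak g$ be embedded in $\mathbb D(G)$ by sending $X$ to the left invariant vector field $\tilde X$, where $(\tilde Xf)(g)=\frac{d}{dt}f(g\exp tX)\big|_{t=0}$, and let $\lambda\colon S(\mathfrak m)\to\mathbb D(G)$ be the symmetrization map $$\lambda(Y_1\cdots Y_k)=\frac1{k!}\sum_{\sigma\in S_k}\tilde Y_{\sigma(1)}\cdots\tilde Y_{\sigma(k)}\qquad(Y_1,\dots,Y_k\in\mathfrak m).$$ For $g\in G$ let $\mathrm{Ad}(g)$ also denote the extension of $\mathrm{Ad}(g)\colon\mathfrak g\to\mathfrak g$ to an automorphism of the symmetric algebra $S(\mathfrak g)$ and of $\mathbb D(G)$.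 Put $$C^\infty_{H,\chi}(G)=\{f\in C^\infty(G)\mid f(gh)=f(g)\chi(h^{-1})\ \text{for all } g\in G,\ h\in H\},$$ $$\mathfrak h^\chi=\{X+\chi(X)\mid X\in\mathfrak h^{\mathbb C}\}\subset\mathbb D(G),$$ $$\mathbb D_{H,\chi,\mathrm{mod}}(G)=\{D\in\mathbb D(G)\mid \mathrm{Ad}(h)D-D\in\mathbb D(G)\mathfrak h^\chi\ \text{for all } h\in H\},$$ where $\mathbb D(G)\mathfrak h^\chi$ is the linear span of all products $vw$ with $v\in\mathbb D(G)$ and $w\in\mathfrak h^\chi$. Each $D\in\mathbb D_{H,\chi,\mathrm{mod}}(G)$ maps $C^\infty_{H,\chi}(G)$ into itself. Let $\sigma\colon\mathfrak g\to\mathfrak m$ be the projection along $\mathfrak h$, extended to an algebra homomorphism $S(\mathfrak g)\to S(\mathfrak m)$, and let $$I_{\mathrm{mod}}(\mathfrak m)=\{P\in S(\mathfrak m)\mid\sigma(\mathrm{Ad}(h)P)=P\ \text{for all } h\in H\}.$$ Suppose that the algebra $I_{\mathrm{mod}}(\mathfrak m)$ is generated by homogeneous elements $P_1,\dots,P_l$,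 and that there are $Q_1,\dots,Q_l\in S(\mathfrak m)$ with $\deg(P_i-Q_i)<\deg P_i$ and $\lambda(Q_i)\in\mathbb D_{H,\chi,\mathrm{mod}}(G)$ for all $i$ (where $\deg 0=-\infty$). Then the algebra $$\mathbb D_{H,\chi,\mathrm{mod}}(G)\big|_{C^\infty_{H,\chi}(G)}=\{D|_{C^\infty_{H,\chi}(G)}\mid D\in\mathbb D_{H,\chi,\mathrm{mod}}(G)\}$$ of operators on $C^\infty_{H,\chi}(G)$ is generated, as a complex unital algebra, by the restrictions $\lambda(Q_1)|_{C^\infty_{H,\chi}(G)},\dots,\lambda(Q_l)|_{C^\infty_{H,\chi}(G)}$. -/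

import Mathlib

open scoped Manifold ContDiff Topology

noncomputable section

namespace InvDiffOp

variable {E : Type*} [NormedAddCommGroup E] [NormedSpace ℝ E]
  {G : Type*} [TopologicalSpace G] [ChartedSpace E G] [Group G]

/-! ### Smooth complex-valued functions and translations -/

variable (E G) in
/-- `C^∞(G)`: the complex vector space of smooth complex-valued functions on `G`. -/
def SmoothFun : Submodule ℂ (G → ℂ) where
  carrier := {f | ContMDiff 𝓘(ℝ, E) 𝓘(ℝ, ℂ) ∞ f}
  add_mem' hf hg := ContMDiff.add hf hg
  zero_mem' := contMDiff_const
  smul_mem' c _ hf := (ContinuousLinearMap.mul ℝ ℂ c).contMDiff.comp hf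

variable (E G) in
/-- The algebra of all complex-linear operators on `C^∞(G)`. -/
abbrev Op : Type _ := Module.End ℂ (SmoothFun E G)

/-- `(L(g) f)(x) = f(g x)`. -/
def leftTranslate [LieGroup 𝓘(ℝ, E) ∞ G] (g : G) : Op E G where
  toFun f := ⟨fun x => f.1 (g * x), ContMDiff.comp f.2 (contMDiff_mul_left (I := 𝓘(ℝ, E)))⟩
  map_add' _ _ := rfl
  map_smul' _ _ := rfl

/-- `(R(g) f)(x) = f(x g)`. -/
def rightTranslate [LieGroup 𝓘(ℝ, E) ∞ G] (g : G) : Op E G where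
  toFun f := ⟨fun x => f.1 (x * g), ContMDiff.comp f.2 (contMDiff_mul_right (I := 𝓘(ℝ, E)))⟩
  map_add' _ _ := rfl
  map_smul' _ _ := rfl

/-! ### Left invariant differential operators -/

/-- A linear operator on `C^∞(G)` is a differential operator if near every point `x₀` it is, in the
coordinates `φ` given by the chart at `x₀` and a basis `e₁, …, eₙ` of the model space, a finite sum
`(D f)(x) = ∑ₖ ∑_w a_{k,w}(x) (∂_{w(1)} ⋯ ∂_{w(k)} (f ∘ φ⁻¹))(φ x)`
with smooth complex coefficients `a_{k,w}`, where `w` runs over the words of length `k ≤ N` in the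
coordinate indices. -/
def IsDifferentialOperator [FiniteDimensional ℝ E] (D : Op E G) : Prop :=
  ∀ x₀ : G, ∃ N : ℕ, ∃ a : ∀ k : ℕ, (Fin k → Fin (Module.finrank ℝ E)) → G → ℂ,
    ∃ U ∈ 𝓝 x₀, U ⊆ (chartAt E x₀).source ∧
      (∀ k w, ContMDiffOn 𝓘(ℝ, E) 𝓘(ℝ, ℂ) ∞ (a k w) U) ∧
      ∀ f : SmoothFun E G, ∀ x ∈ U, (D f).1 x =
        ∑ k ∈ Finset.range (N + 1), ∑ w : Fin k → Fin (Module.finrank ℝ E),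
          a k w x * iteratedFDeriv ℝ k (f.1 ∘ (chartAt E x₀).symm) (chartAt E x₀ x)
            (fun i => Module.finBasis ℝ E (w i))

variable (E G) in
/-- `𝔻(G)`: the left invariant differential operators on `G` with complex coefficients. -/
def invDiffOps [FiniteDimensional ℝ E] [LieGroup 𝓘(ℝ, E) ∞ G] : Set (Op E G) :=
  {D | IsDifferentialOperator D ∧ ∀ g, D * leftTranslate g = leftTranslate g * D}

theorem SmoothFun.mdifferentiableAt (f : SmoothFun E G) (g : G) :
    MDifferentiableAt 𝓘(ℝ, E) 𝓘(ℝ, ℂ) f.1 g :=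
  (f.2 : ContMDiff 𝓘(ℝ, E) 𝓘(ℝ, ℂ) ∞ f.1).mdifferentiableAt (by simp)

theorem mfderiv_mulInvariantVectorField [LieGroup 𝓘(ℝ, E) ∞ G] (f : SmoothFun E G)
    (X : GroupLieAlgebra 𝓘(ℝ, E) G) (g : G) :
    mfderiv 𝓘(ℝ, E) 𝓘(ℝ, ℂ) f.1 g (mulInvariantVectorField X g) =
      mfderiv 𝓘(ℝ, E) 𝓘(ℝ, ℂ) (fun x => f.1 (g * x)) 1 X := by
  have h₁ : HasMFDerivAt 𝓘(ℝ, E) 𝓘(ℝ, E) (fun x : G => g * x) 1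
      (mfderiv 𝓘(ℝ, E) 𝓘(ℝ, E) (fun x : G => g * x) 1) :=
    ((contMDiff_mul_left (I := 𝓘(ℝ, E)) (n := ∞) (a := g)).mdifferentiableAt
      (by simp)).hasMFDerivAt
  have h₂ := (SmoothFun.mdifferentiableAt f (g * 1)).hasMFDerivAt
  have h := (h₂.comp (1 : G) h₁).mfderiv
  have h' := congrArg (fun A : E →L[ℝ] ℂ => A X) h
  refine Eq.trans ?_ h'.symm
  simp only [mulInvariantVectorField]
  change _ = (mfderiv 𝓘(ℝ, E) 𝓘(ℝ, ℂ) f.1 (g * 1) : E →L[ℝ] ℂ) _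
  rw [mul_one]
  rfl

theorem contMDiff_leftVF [LieGroup 𝓘(ℝ, E) ∞ G] {f : G → ℂ}
    (hf : ContMDiff 𝓘(ℝ, E) 𝓘(ℝ, ℂ) ∞ f) (X : GroupLieAlgebra 𝓘(ℝ, E) G) :
    ContMDiff 𝓘(ℝ, E) 𝓘(ℝ, ℂ) ∞
      fun g => (mfderiv 𝓘(ℝ, E) 𝓘(ℝ, ℂ) f g (mulInvariantVectorField X g) : ℂ) := by
  have e : (fun g => (mfderiv 𝓘(ℝ, E) 𝓘(ℝ, ℂ) f g (mulInvariantVectorField X g) : ℂ)) =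
      fun g => (mfderiv 𝓘(ℝ, E) 𝓘(ℝ, ℂ) (fun x => f (g * x)) 1 X : ℂ) :=
    funext fun g => mfderiv_mulInvariantVectorField ⟨f, hf⟩ X g
  rw [e]
  intro g₀
  have h := ContMDiffAt.mfderiv_apply (I := 𝓘(ℝ, E)) (I' := 𝓘(ℝ, ℂ)) (J := 𝓘(ℝ, E))
    (J' := 𝓘(ℝ, E)) (m := ∞) (n := ∞) (x₀ := g₀)
    (fun g x : G => f (g * x)) (fun _ => (1 : G)) (fun g : G => g) (fun _ => (X : E))
    ((hf.comp (contMDiff_mul 𝓘(ℝ, E) ∞)).contMDiffAt) contMDiffAt_const contMDiffAt_id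
    contMDiffAt_const (by simp)
  refine h.congr_of_eventuallyEq (Filter.Eventually.of_forall fun g => ?_)
  have h₁ := (tangentBundleCore 𝓘(ℝ, E) G).coordChange_self (achart E (1 : G)) 1
    (mem_chart_source E _) X
  have h₂ := inTangentCoordinates_eq (I := 𝓘(ℝ, E)) (I' := 𝓘(ℝ, ℂ)) (fun _ : G => (1 : G))
    (fun x => f (x * 1)) (fun g => (mfderiv 𝓘(ℝ, E) 𝓘(ℝ, ℂ) (fun x => f (g * x)) 1 : E →L[ℝ] ℂ))
    (x₀ := g₀) (x := g) (mem_chart_source E _) (Set.mem_univ _)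
  refine Eq.trans ?_ (congrArg (fun A : E →L[ℝ] ℂ => A X) h₂).symm
  rw [tangentBundleCore_coordChange_model_space]
  exact (congrArg (mfderiv 𝓘(ℝ, E) 𝓘(ℝ, ℂ) (fun x => f (g * x)) 1 : E →L[ℝ] ℂ) h₁).symm

/-- For `X` in the Lie algebra, the left invariant vector field `X̃` as an operator on `C^∞(G)`:
`(X̃ f)(g)` is the derivative of `f` at `g` in the direction `(dL_g)_e X`, which is the derivative
of `t ↦ f (g exp(tX))` at `t = 0`. -/
def leftVF [LieGroup 𝓘(ℝ, E) ∞ G] (X : GroupLieAlgebra 𝓘(ℝ, E) G) : Op E G where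
  toFun f := ⟨fun g => mfderiv 𝓘(ℝ, E) 𝓘(ℝ, ℂ) f.1 g (mulInvariantVectorField X g),
    contMDiff_leftVF f.2 X⟩
  map_add' f₁ f₂ := by
    ext g
    have h₁ := (SmoothFun.mdifferentiableAt f₁ g).hasMFDerivAt
    have h₂ := (SmoothFun.mdifferentiableAt f₂ g).hasMFDerivAt
    have h := (h₁.add h₂).mfderiv
    exact congrArg (fun A : E →L[ℝ] ℂ => A (mulInvariantVectorField X g)) h
  map_smul' c f := by
    ext g
    have h₁ := (SmoothFun.mdifferentiableAt f g).hasMFDerivAt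
    have h₂ : HasMFDerivAt 𝓘(ℝ, ℂ) 𝓘(ℝ, ℂ) (fun z : ℂ => c * z) (f.1 g)
        (ContinuousLinearMap.mul ℝ ℂ c) :=
      (ContinuousLinearMap.mul ℝ ℂ c).hasMFDerivAt
    have h := (h₂.comp g h₁).mfderiv
    exact congrArg (fun A : E →L[ℝ] ℂ => A (mulInvariantVectorField X g)) h

/-! ### The adjoint action -/

/-- `Ad(g)` on the Lie algebra: the differential at the identity of `x ↦ g x g⁻¹`. -/
def Ad (g : G) : GroupLieAlgebra 𝓘(ℝ, E) G →ₗ[ℝ] GroupLieAlgebra 𝓘(ℝ, E) G where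
  toFun X := mfderiv 𝓘(ℝ, E) 𝓘(ℝ, E) (fun x : G => g * x * g⁻¹) 1 X
  map_add' := map_add _
  map_smul' := map_smul _

/-- `Ad(g)` on operators: `(Ad(g) D) f = (D f^{R(g⁻¹)})^{R(g)}`. -/
def opAd [LieGroup 𝓘(ℝ, E) ∞ G] (g : G) (D : Op E G) : Op E G :=
  rightTranslate g * D * rightTranslate g⁻¹

/-- The operation `opAd g`, obviously multiplicative, extends `Ad(g)` on the Lie algebra. -/
theorem opAd_leftVF [LieGroup 𝓘(ℝ, E) ∞ G] (g : G) (X : GroupLieAlgebra 𝓘(ℝ, E) G) :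
    opAd g (leftVF X) = leftVF (Ad g X) := by
  ext f x
  have hc : HasMFDerivAt 𝓘(ℝ, E) 𝓘(ℝ, E) (fun x : G => g * x * g⁻¹) 1
      (mfderiv 𝓘(ℝ, E) 𝓘(ℝ, E) (fun x : G => g * x * g⁻¹) 1) :=
    (((contMDiff_mul_right (I := 𝓘(ℝ, E)) (n := ∞) (a := g⁻¹)).comp
      (contMDiff_mul_left (I := 𝓘(ℝ, E)) (n := ∞) (a := g))).mdifferentiableAt
      (by simp)).hasMFDerivAt
  have hx := (SmoothFun.mdifferentiableAt (leftTranslate x f) (g * 1 * g⁻¹)).hasMFDerivAt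
  have h := (hx.comp (1 : G) hc).mfderiv
  have h' := congrArg (fun A : E →L[ℝ] ℂ => A X) h
  have h₁ := mfderiv_mulInvariantVectorField (rightTranslate g⁻¹ f) X (x * g)
  have h₂ := mfderiv_mulInvariantVectorField f (Ad g X) x
  refine h₁.trans (Eq.trans ?_ h₂.symm)
  have e : (fun y => (rightTranslate (E := E) g⁻¹ f).1 (x * g * y)) =
      (leftTranslate (E := E) x f).1 ∘ fun y => g * y * g⁻¹ := by
    ext y
    simp [rightTranslate, leftTranslate, mul_assoc]
  rw [e]
  refine h'.trans ?_
  have e1 : g * 1 * g⁻¹ = 1 := by simp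
  change (mfderiv 𝓘(ℝ, E) 𝓘(ℝ, ℂ) (leftTranslate x f).1 (g * 1 * g⁻¹) : E →L[ℝ] ℂ) _ = _
  rw [e1]
  rfl

/-! ### Symmetrization -/

/-- The symmetrized product `(1/m!) ∑_σ Ỹ_{σ(1)} ⋯ Ỹ_{σ(m)}`. -/
def symProd [LieGroup 𝓘(ℝ, E) ∞ G] {m : ℕ} (Y : Fin m → GroupLieAlgebra 𝓘(ℝ, E) G) : Op E G :=
  ((m.factorial : ℂ)⁻¹) • ∑ σ : Equiv.Perm (Fin m), (List.ofFn fun i => leftVF (Y (σ i))).prod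

/-- The symmetrization `λ`. For linearly independent `X₁, …, X_r` in the Lie algebra spanning `𝔪`,
the complexified symmetric algebra `S(𝔪)` is the polynomial algebra `ℂ[X₁, …, X_r]`, and `λ` is the
linear map sending a monomial `X_{i₁} ⋯ X_{i_m}` to the symmetrized product of
`X̃_{i₁}, …, X̃_{i_m}`. -/
def symmetrization [LieGroup 𝓘(ℝ, E) ∞ G] {r : ℕ} (X : Fin r → GroupLieAlgebra 𝓘(ℝ, E) G) :
    MvPolynomial (Fin r) ℂ →ₗ[ℂ] Op E G :=
  (MvPolynomial.basisMonomials (Fin r) ℂ).constr ℂ fun s =>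
    symProd fun i : Fin s.toMultiset.toList.length => X (s.toMultiset.toList.get i)

/-! ### The subgroup `H`, its Lie algebra and its character -/

/-- `γ` is the one-parameter subgroup `t ↦ exp(tX)`: the integral curve of the left invariant vector
field of `X` starting at the identity. -/
def IsExpCurve (γ : ℝ → G) (X : GroupLieAlgebra 𝓘(ℝ, E) G) : Prop :=
  γ 0 = 1 ∧ IsMIntegralCurve (I := 𝓘(ℝ, E)) γ (mulInvariantVectorField X)

variable (E) in
/-- The Lie algebra `𝔥` of a closed subgroup `H`, consisting of the `X` with `exp(tX) ∈ H` for all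
real `t`. For closed `H` these `X` form a subspace, so that taking the span adds nothing. -/
def lieSub (H : Subgroup G) : Submodule ℝ (GroupLieAlgebra 𝓘(ℝ, E) G) :=
  Submodule.span ℝ {X | ∃ γ : ℝ → G, IsExpCurve γ X ∧ ∀ t, γ t ∈ H}

variable (E) in
/-- `C^∞_{H,χ}(G)`: the smooth `f` with `f(gh) = f(g) χ(h⁻¹)` for `g ∈ G`, `h ∈ H`. -/
def equivariantFun (H : Subgroup G) (χ : H →ₜ* ℂˣ) : Submodule ℂ (SmoothFun E G) where
  carrier := {f | ∀ (g : G) (h : H), f.1 (g * h) = f.1 g * (χ h⁻¹ : ℂˣ)}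
  add_mem' {f₁ f₂} h₁ h₂ g h := by
    have e₁ := h₁ g h
    have e₂ := h₂ g h
    simp only [Submodule.coe_add, Pi.add_apply, e₁, e₂, add_mul]
  zero_mem' g h := by simp
  smul_mem' c f hf g h := by
    have e := hf g h
    simp only [Submodule.coe_smul, Pi.smul_apply, smul_eq_mul, e, mul_assoc]

variable (E) in
/-- `𝔥^χ`: the complex span of the operators `X̃ + dχ(X)` with `X ∈ 𝔥`, where
`dχ(X) = (d/dt) χ(exp tX)` at `t = 0`. This is the set of the `X̃ + dχ(X)` with `X` in the
complexification of `𝔥`. -/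
def hChi [LieGroup 𝓘(ℝ, E) ∞ G] (H : Subgroup G) (χ : H →ₜ* ℂˣ) : Submodule ℂ (Op E G) :=
  Submodule.span ℂ {D | ∃ (X : GroupLieAlgebra 𝓘(ℝ, E) G) (γ : ℝ → G) (hγ : ∀ t, γ t ∈ H),
    IsExpCurve γ X ∧
      D = leftVF X + (deriv (fun t : ℝ => ((χ ⟨γ t, hγ t⟩ : ℂˣ) : ℂ)) 0) • (1 : Op E G)}

variable (E) in
/-- `𝔻(G)𝔥^χ`: the linear span of all products `v w` with `v ∈ 𝔻(G)` and `w ∈ 𝔥^χ`. -/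
def leftIdeal [FiniteDimensional ℝ E] [LieGroup 𝓘(ℝ, E) ∞ G] (H : Subgroup G) (χ : H →ₜ* ℂˣ) :
    Submodule ℂ (Op E G) :=
  Submodule.span ℂ {D | ∃ v ∈ invDiffOps E G, ∃ w ∈ hChi E H χ, D = v * w}

variable (E) in
/-- `𝔻_{H,χ,mod}(G)`: the `D ∈ 𝔻(G)` with `Ad(h) D - D ∈ 𝔻(G)𝔥^χ` for all `h ∈ H`. -/
def modOps [FiniteDimensional ℝ E] [LieGroup 𝓘(ℝ, E) ∞ G] (H : Subgroup G) (χ : H →ₜ* ℂˣ) :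
    Set (Op E G) :=
  {D | D ∈ invDiffOps E G ∧ ∀ h ∈ H, opAd h D - D ∈ leftIdeal E H χ}

theorem hasDerivAt_of_smulRight {V : Type*} [NormedAddCommGroup V] [NormedSpace ℝ V] {u : ℝ → ℂ}
    {A : V →L[ℝ] ℂ} {v : V} {t : ℝ}
    (h : HasFDerivAt u (A ∘L (1 : ℝ →L[ℝ] ℝ).smulRight v) t) : HasDerivAt u (A v) t := by
  simpa using h.hasDerivAt

theorem leftIdeal_apply [FiniteDimensional ℝ E] [LieGroup 𝓘(ℝ, E) ∞ G] {H : Subgroup G}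
    {χ : H →ₜ* ℂˣ} {D : Op E G} (hD : D ∈ leftIdeal E H χ) {f : SmoothFun E G}
    (hf : f ∈ equivariantFun E H χ) : D f = 0 := by
  have key : ∀ w ∈ hChi E H χ, w f = 0 := by
    intro w hw
    refine Submodule.span_induction ?_ (by simp) (fun a b _ _ ha hb => by simp [ha, hb])
      (fun c a _ ha => by simp [ha]) hw
    rintro _ ⟨X, γ, hγ, ⟨h0, hγX⟩, rfl⟩
    ext g
    have hu : HasDerivAt (fun t => f.1 (g * γ t)) ((leftVF X f).1 g) 0 := by
      have h₁ := (SmoothFun.mdifferentiableAt (leftTranslate g f) (γ 0)).hasMFDerivAt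
      have h₂ := hasMFDerivAt_iff_hasFDerivAt.1 (h₁.comp (0 : ℝ) (hγX 0))
      have h₃ := mfderiv_mulInvariantVectorField (leftTranslate g f) X (γ 0)
      have h₄ := mfderiv_mulInvariantVectorField f X g
      have h₅ : HasDerivAt (fun t => f.1 (g * γ t)) (mfderiv 𝓘(ℝ, E) 𝓘(ℝ, ℂ)
        (leftTranslate g f).1 (γ 0) (mulInvariantVectorField X (γ 0)) : ℂ) 0 :=
        hasDerivAt_of_smulRight (V := E) h₂
      refine h₅.congr_deriv (h₃.trans (Eq.trans ?_ h₄.symm))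
      have e : (fun x => (leftTranslate (E := E) g f).1 (γ 0 * x)) = fun x => f.1 (g * x) := by
        funext x
        rw [h0, one_mul]
        rfl
      rw [e]
      rfl
    have hχ : ∀ t, f.1 g = f.1 (g * γ t) * ((χ ⟨γ t, hγ t⟩ : ℂˣ) : ℂ) := by
      intro t
      have := hf g ⟨γ t, hγ t⟩
      simp only at this
      rw [this, map_inv, mul_assoc, Units.inv_mul, mul_one]
    have hu0 : f.1 (g * γ 0) = f.1 g := by rw [h0, mul_one]
    change (leftVF X f).1 g + _ * f.1 g = 0
    by_cases hz : f.1 g = 0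
    · have hconst : (fun t => f.1 (g * γ t)) = fun _ => 0 := by
        funext t
        have := hχ t
        rw [hz] at this
        exact (mul_eq_zero.1 this.symm).resolve_right (Units.ne_zero _)
      rw [hconst] at hu
      rw [hu.unique (hasDerivAt_const _ _), hz]
      simp
    · have hne : ∀ t, f.1 (g * γ t) ≠ 0 := fun t h => hz (by rw [hχ t, h, zero_mul])
      have e : (fun t : ℝ => ((χ ⟨γ t, hγ t⟩ : ℂˣ) : ℂ)) =
          fun t => f.1 g * (f.1 (g * γ t))⁻¹ := by
        funext t
        rw [hχ t]
        field_simp [hne t]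
      have hd := (hu.fun_inv (hne 0)).const_mul (f.1 g)
      have hd' := hd.deriv
      rw [e, hd', hu0]
      field_simp
      ring
  refine Submodule.span_induction ?_ (by simp) (fun a b _ _ ha hb => by simp [ha, hb])
    (fun c a _ ha => by simp [ha]) hD
  rintro _ ⟨v, _, w, hw, rfl⟩
  simp [key w hw]

theorem modOps_apply_mem [FiniteDimensional ℝ E] [LieGroup 𝓘(ℝ, E) ∞ G] {H : Subgroup G}
    {χ : H →ₜ* ℂˣ} {D : Op E G} (hD : D ∈ modOps E H χ) {f : SmoothFun E G}
    (hf : f ∈ equivariantFun E H χ) : D f ∈ equivariantFun E H χ := by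
  intro g h
  have h₁ := leftIdeal_apply (hD.2 h.1 h.2) hf
  have h₂ : rightTranslate (E := E) (h : G)⁻¹ f = ((χ h : ℂˣ) : ℂ) • f := by
    ext x
    have := hf x h⁻¹
    simp only [inv_inv] at this
    simpa [rightTranslate, mul_comm] using this
  have h₃ : rightTranslate (E := E) (h : G) (D (((χ h : ℂˣ) : ℂ) • f)) = D f := by
    rw [← h₂]
    exact sub_eq_zero.1 h₁
  rw [map_smul, map_smul] at h₃
  have h₄ := congrArg (fun F : SmoothFun E G => F.1 g) h₃
  have h₅ : ((χ h : ℂˣ) : ℂ) * (D f).1 (g * h) = (D f).1 g := h₄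
  rw [← h₅, map_inv]
  have : ((χ h : ℂˣ) : ℂ) ≠ 0 := Units.ne_zero _
  rw [Units.val_inv_eq_inv_val]
  field_simp

/-- The restriction of `D ∈ 𝔻_{H,χ,mod}(G)` to `C^∞_{H,χ}(G)`. -/
def restrictOp [FiniteDimensional ℝ E] [LieGroup 𝓘(ℝ, E) ∞ G] {H : Subgroup G} {χ : H →ₜ* ℂˣ}
    (D : modOps E H χ) : Module.End ℂ (equivariantFun E H χ) :=
  D.1.restrict fun _ hf => modOps_apply_mem D.2 hf

/-! ### Invariants modulo `𝔥` -/

/-- The linear map `σ ∘ Ad(h)` from `𝔪` to `𝔪`, where `σ` is the projection of the Lie algebra onto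
`𝔪` along `𝔥`. -/
def sigmaAd {𝔪 𝔥 : Submodule ℝ (GroupLieAlgebra 𝓘(ℝ, E) G)} (hc : IsCompl 𝔪 𝔥) (h : G) :
    𝔪 →ₗ[ℝ] 𝔪 :=
  (𝔪.projectionOnto 𝔥 hc) ∘ₗ (Ad h) ∘ₗ 𝔪.subtype

/-- The algebra endomorphism of the complexified symmetric algebra `S(V) = ℂ[X₁, …, X_r]` induced by
a linear endomorphism of the real vector space `V` with basis `X₁, …, X_r`. -/
def symMap {V : Type*} [AddCommGroup V] [Module ℝ V] {r : ℕ} (b : Module.Basis (Fin r) ℝ V)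
    (T : V →ₗ[ℝ] V) : MvPolynomial (Fin r) ℂ →ₐ[ℂ] MvPolynomial (Fin r) ℂ :=
  MvPolynomial.aeval fun i =>
    ∑ j, MvPolynomial.C ((b.repr (T (b i)) j : ℝ) : ℂ) * MvPolynomial.X j

/-- `I_mod(𝔪)`: the algebra of the `P ∈ S(𝔪)` with `(σ ∘ Ad(h)) P = P` for all `h ∈ H`. -/
def modInvariants {H : Subgroup G} {𝔪 : Submodule ℝ (GroupLieAlgebra 𝓘(ℝ, E) G)}
    (hc : IsCompl 𝔪 (lieSub E H)) {r : ℕ} (b : Module.Basis (Fin r) ℝ 𝔪) :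
    Subalgebra ℂ (MvPolynomial (Fin r) ℂ) :=
  ⨅ h : H, AlgHom.equalizer (symMap b (sigmaAd hc (h : G))) (AlgHom.id ℂ _)

/-- The degree of a polynomial, with the convention that the zero polynomial has degree `-∞`. -/
def polyDegree {r : ℕ} (P : MvPolynomial (Fin r) ℂ) : WithBot ℕ :=
  P.support.sup fun s => ((s.degree : ℕ) : WithBot ℕ)

end InvDiffOp

end

open InvDiffOp

open scoped Manifold ContDiff Topology

noncomputable section
set_option linter.unusedSectionVars false

/-! ### Left invariant vector fields as operators, and localization. -/

namespace InvDiffOp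

variable {E : Type*} [NormedAddCommGroup E] [NormedSpace ℝ E]
  {G : Type*} [TopologicalSpace G] [ChartedSpace E G] [Group G]

/-! The proof compares operators with their leading symbols. Take as letters the left invariant
fields of a basis of `𝔪` (first kind) and the operators `X̃ + dχ(X)` for a basis of `𝔥` (second
kind). By `mem_invDiffOps_iff` the algebra `𝔻(G)` is generated by left invariant fields, hence
spanned by words in these letters, and it is filtered by word length. A commutator of two letters
has order at most one, so reordering a word only changes lower order terms. Words are sorted with
the letters of the second kind on the right. Since `𝔥^χ` is closed under commutators, the left ideal
`𝔻(G)𝔥^χ` is spanned by sorted words with at least one letter of the second kind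
(`wordIdeal_le_span_normalWord`, `leftIdeal_eq_wordIdeal`). Sorted words are linearly independent,
as in the Poincaré–Birkhoff–Witt theorem; this is seen by applying them at the identity to monomials
in coordinate functions (`exists_separating_functional`).

Consequently, modulo the ideal and lower order, an operator of order `k` equals `λ(p)` for exactly
one homogeneous `p ∈ S(𝔪)` of degree `k`, its symbol (`IsQuantization.exists_sub_mem`,
`IsQuantization.eq_zero_of_mem`), and `λ(P)λ(Q)` agrees with `λ(PQ)` up to lower order. For `h ∈ H`
the action `Ad(h)` preserves the filtration and the ideal and acts on symbols by `σ ∘ Ad(h)`. Hence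
the symbol of an element of `𝔻_{H,χ,mod}(G)` lies in `I_mod(𝔪)` and is a polynomial in the `P i`;
the corresponding polynomial in the `λ(Q i)` has the same symbol. Subtracting it lowers the order,
and in the end an element of the ideal remains, which annihilates `C^∞_{H,χ}(G)`
(`adjoin_eq_range_of_symbols`).

Two facts from Lie theory support this. First, the differential of `χ` is linear and
`Ad(H)`-invariant on `𝔥`. Linearity comes from a product formula: a product of one-parameter
subgroups whose velocities add up to zero satisfies `β(s/n)ⁿ → 1` (`HasVelocity.tendsto_pow`,
`sum_exponent_eq_zero`). Invariance makes the differential vanish on brackets, so that `𝔥^χ` is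
closed under commutators. Second, `𝔻_{H,χ,mod}(G)` is an algebra: the commutator of `X̃` with `D` is
the derivative of `Ad(exp tX) D` at `0`, hence lies in the ideal, and the ideal is stable under
right multiplication by `D` (`leftIdeal_mul_mem`). -/

/-- The differential at `x` of a complex-valued function on `G`. -/
def diffAt (h : G → ℂ) (x : G) : E →L[ℝ] ℂ := mfderiv 𝓘(ℝ, E) 𝓘(ℝ, ℂ) h x

/-- The value at `x` of the left invariant vector field of `Y`, as a vector of the model space. -/
def leftField (Y : GroupLieAlgebra 𝓘(ℝ, E) G) (x : G) : E := mulInvariantVectorField Y x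

theorem leftField_add (X Y : GroupLieAlgebra 𝓘(ℝ, E) G) (x : G) :
    leftField (X + Y) x = leftField X x + leftField Y x :=
  congrFun (mulInvariantVectorField_add X Y) x

theorem leftField_smul (c : ℝ) (Y : GroupLieAlgebra 𝓘(ℝ, E) G) (x : G) :
    leftField (c • Y) x = c • leftField Y x :=
  congrFun (mulInvariantVectorField_smul c Y) x

/-- The derivative of a complex-valued function at `x` along the left invariant vector field
of `Y`. -/
def leftDeriv (Y : GroupLieAlgebra 𝓘(ℝ, E) G) (h : G → ℂ) (x : G) : ℂ :=
  diffAt (E := E) h x (leftField Y x)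

theorem leftVF_apply [LieGroup 𝓘(ℝ, E) ∞ G] (Y : GroupLieAlgebra 𝓘(ℝ, E) G)
    (f : SmoothFun E G) (x : G) : (leftVF Y f).1 x = leftDeriv Y f.1 x := rfl

theorem diffAt_add {h k : G → ℂ} {x : G} (hh : MDifferentiableAt 𝓘(ℝ, E) 𝓘(ℝ, ℂ) h x)
    (hk : MDifferentiableAt 𝓘(ℝ, E) 𝓘(ℝ, ℂ) k x) :
    diffAt (E := E) (h + k) x = diffAt h x + diffAt k x :=
  (hh.hasMFDerivAt.add hk.hasMFDerivAt).mfderiv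

theorem diffAt_mul {h k : G → ℂ} {x : G} (hh : MDifferentiableAt 𝓘(ℝ, E) 𝓘(ℝ, ℂ) h x)
    (hk : MDifferentiableAt 𝓘(ℝ, E) 𝓘(ℝ, ℂ) k x) :
    diffAt (E := E) (h * k) x = h x • diffAt (E := E) k x + k x • diffAt (E := E) h x :=
  (hh.hasMFDerivAt.mul hk.hasMFDerivAt).mfderiv

theorem diffAt_congr {h k : G → ℂ} {x : G} (e : h =ᶠ[𝓝 x] k) :
    diffAt (E := E) h x = diffAt k x :=
  e.mfderiv_eq

theorem leftDeriv_add_left (X Y : GroupLieAlgebra 𝓘(ℝ, E) G) (h : G → ℂ) (x : G) :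
    leftDeriv (X + Y) h x = leftDeriv X h x + leftDeriv Y h x := by
  simp [leftDeriv, leftField_add]

theorem leftDeriv_smul_left (c : ℝ) (Y : GroupLieAlgebra 𝓘(ℝ, E) G) (h : G → ℂ) (x : G) :
    leftDeriv (c • Y) h x = c * leftDeriv Y h x := by
  simp [leftDeriv, leftField_smul]

theorem leftDeriv_add (Y : GroupLieAlgebra 𝓘(ℝ, E) G) {h k : G → ℂ} {x : G}
    (hh : MDifferentiableAt 𝓘(ℝ, E) 𝓘(ℝ, ℂ) h x) (hk : MDifferentiableAt 𝓘(ℝ, E) 𝓘(ℝ, ℂ) k x) :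
    leftDeriv Y (h + k) x = leftDeriv Y h x + leftDeriv Y k x := by
  simp [leftDeriv, diffAt_add hh hk]

theorem leftDeriv_mul (Y : GroupLieAlgebra 𝓘(ℝ, E) G) {h k : G → ℂ} {x : G}
    (hh : MDifferentiableAt 𝓘(ℝ, E) 𝓘(ℝ, ℂ) h x) (hk : MDifferentiableAt 𝓘(ℝ, E) 𝓘(ℝ, ℂ) k x) :
    leftDeriv Y (h * k) x = leftDeriv Y h x * k x + h x * leftDeriv Y k x := by
  simp only [leftDeriv, diffAt_mul hh hk, add_apply,
    smul_apply, smul_eq_mul]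
  ring

theorem leftDeriv_congr (Y : GroupLieAlgebra 𝓘(ℝ, E) G) {h k : G → ℂ} {x : G}
    (e : h =ᶠ[𝓝 x] k) : leftDeriv Y h x = leftDeriv Y k x := by
  simp [leftDeriv, diffAt_congr e]

section Lie
variable [LieGroup 𝓘(ℝ, E) ∞ G]

theorem leftVF_add (X Y : GroupLieAlgebra 𝓘(ℝ, E) G) :
    leftVF (X + Y) = leftVF X + leftVF Y := by
  ext f x
  exact leftDeriv_add_left X Y f.1 x

theorem leftVF_smul (c : ℝ) (Y : GroupLieAlgebra 𝓘(ℝ, E) G) :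
    leftVF (c • Y) = (c : ℂ) • leftVF Y := by
  ext f x
  exact leftDeriv_smul_left c Y f.1 x

theorem leftVF_zero : leftVF (0 : GroupLieAlgebra 𝓘(ℝ, E) G) = 0 := by
  simpa using leftVF_smul (0 : ℝ) (0 : GroupLieAlgebra 𝓘(ℝ, E) G)

theorem leftVF_neg (Y : GroupLieAlgebra 𝓘(ℝ, E) G) : leftVF (-Y) = - leftVF Y := by
  have h := leftVF_smul (-1 : ℝ) Y
  rw [neg_one_smul] at h
  rw [h]
  ext f x
  simp

theorem leftVF_sub (X Y : GroupLieAlgebra 𝓘(ℝ, E) G) :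
    leftVF (X - Y) = leftVF X - leftVF Y := by
  rw [sub_eq_add_neg, leftVF_add, leftVF_neg]
  exact (sub_eq_add_neg (leftVF X) (leftVF Y)).symm

theorem leftVF_sum {ι : Type*} (s : Finset ι) (Y : ι → GroupLieAlgebra 𝓘(ℝ, E) G) :
    leftVF (∑ i ∈ s, Y i) = ∑ i ∈ s, leftVF (Y i) := by
  classical
  induction s using Finset.induction_on with
  | empty => simp [leftVF_zero]
  | insert a s ha ih => rw [Finset.sum_insert ha, Finset.sum_insert ha, leftVF_add, ih]

theorem leftDeriv_eq_translate (f : SmoothFun E G) (Y : GroupLieAlgebra 𝓘(ℝ, E) G) (g : G) :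
    leftDeriv Y f.1 g =
      diffAt (E := E) (fun x => f.1 (g * x)) 1 Y :=
  mfderiv_mulInvariantVectorField f Y g

theorem leftVF_mul_leftTranslate (Y : GroupLieAlgebra 𝓘(ℝ, E) G) (g : G) :
    leftVF Y * leftTranslate g = leftTranslate g * leftVF Y := by
  ext f x
  refine (leftDeriv_eq_translate (leftTranslate g f) Y x).trans
    (Eq.trans ?_ (leftDeriv_eq_translate f Y (g * x)).symm)
  have : (fun y => (leftTranslate (E := E) g f).1 (x * y)) = fun y => f.1 (g * x * y) := by
    funext y
    simp [leftTranslate, mul_assoc]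
  rw [this]

theorem leftField_one (Y : GroupLieAlgebra 𝓘(ℝ, E) G) : leftField Y (1 : G) = Y := by
  unfold leftField mulInvariantVectorField
  have : (fun x : G => 1 * x) = id := by funext x; simp
  rw [this]
  rw [mfderiv_id]
  rfl

variable (E G) in
/-- The algebra generated by the left invariant vector fields. -/
def envAlg : Subalgebra ℂ (Op E G) := Algebra.adjoin ℂ (Set.range leftVF)

theorem leftVF_mem_envAlg (Y : GroupLieAlgebra 𝓘(ℝ, E) G) : leftVF Y ∈ envAlg E G :=
  Algebra.subset_adjoin ⟨Y, rfl⟩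

theorem envAlg_commute_leftTranslate {D : Op E G} (hD : D ∈ envAlg E G) (g : G) :
    D * leftTranslate g = leftTranslate g * D := by
  induction hD using Algebra.adjoin_induction with
  | mem x hx => obtain ⟨Y, rfl⟩ := hx; exact leftVF_mul_leftTranslate Y g
  | algebraMap r => exact Algebra.commutes r _
  | add x y _ _ hx hy => rw [add_mul, mul_add, hx, hy]
  | mul x y _ _ hx hy => rw [mul_assoc, hy, ← mul_assoc, hx, mul_assoc]

/-- Left invariant operators that agree at the identity agree. -/
theorem op_ext_at_one {D D' : Op E G} (hD : ∀ g, D * leftTranslate g = leftTranslate g * D)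
    (hD' : ∀ g, D' * leftTranslate g = leftTranslate g * D')
    (h : ∀ f, (D f).1 1 = (D' f).1 1) : D = D' := by
  ext f x
  have h₁ := congrArg (fun T : Op E G => (T f).1 1) (hD x)
  have h₂ := congrArg (fun T : Op E G => (T f).1 1) (hD' x)
  have h₃ := h (leftTranslate x f)
  simp only [Module.End.mul_apply] at h₁ h₂
  have e₁ : (leftTranslate (E := E) x (D f)).1 1 = (D f).1 x := by
    simp [leftTranslate]
  have e₂ : (leftTranslate (E := E) x (D' f)).1 1 = (D' f).1 x := by
    simp [leftTranslate]
  rw [← e₁, ← e₂, ← h₁, ← h₂, h₃]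

/-- The product of smooth functions. -/
def smoothMul (f g : SmoothFun E G) : SmoothFun E G :=
  ⟨f.1 * g.1, by
    have hf : ContMDiff 𝓘(ℝ, E) 𝓘(ℝ, ℂ) ∞ f.1 := f.2
    have hg : ContMDiff 𝓘(ℝ, E) 𝓘(ℝ, ℂ) ∞ g.1 := g.2
    have hm : ContMDiff (𝓘(ℝ, ℂ).prod 𝓘(ℝ, ℂ)) 𝓘(ℝ, ℂ) ∞ fun p : ℂ × ℂ => p.1 * p.2 := by
      rw [← modelWithCornersSelf_prod, chartedSpaceSelf_prod]
      exact contDiff_mul.contMDiff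
    exact hm.comp (hf.prodMk hg)⟩

theorem leftVF_smoothMul (Y : GroupLieAlgebra 𝓘(ℝ, E) G) (f g : SmoothFun E G) :
    leftVF Y (smoothMul f g) = smoothMul (leftVF Y f) g + smoothMul f (leftVF Y g) := by
  ext x
  exact leftDeriv_mul Y (SmoothFun.mdifferentiableAt f x) (SmoothFun.mdifferentiableAt g x)

section Bump
variable [FiniteDimensional ℝ E] [T2Space G]

/-- A function smooth near a point agrees near this point with a smooth function. -/
theorem exists_smoothFun_eventuallyEq {h : G → ℂ} {V : Set G} (hV : IsOpen V) {x : G} (hx : x ∈ V)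
    (hh : ContMDiffOn 𝓘(ℝ, E) 𝓘(ℝ, ℂ) ∞ h V) : ∃ f : SmoothFun E G, f.1 =ᶠ[𝓝 x] h := by
  obtain ⟨ρ, hρ⟩ := (SmoothBumpFunction.nhds_basis_tsupport (I := 𝓘(ℝ, E)) x).mem_iff.1
    (hV.mem_nhds hx)
  have : IsManifold 𝓘(ℝ, E) ∞ G := LieGroup.toContMDiffMul.toIsManifold
  refine ⟨⟨fun y => ρ y • h y, ?_⟩, ?_⟩
  · refine contMDiff_of_tsupport fun y hy => ?_
    have hyV : y ∈ V := hρ.2 (tsupport_smul_subset_left _ _ hy)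
    exact ρ.contMDiffAt.smul ((hh y hyV).contMDiffAt (hV.mem_nhds hyV))
  · filter_upwards [ρ.eventuallyEq_one] with y hy
    simp [hy]

/-- Differentiation is local, and near each point of `V` the function agrees with a globally smooth
one, to which `leftVF` applies. -/
theorem contMDiffOn_leftDeriv (Y : GroupLieAlgebra 𝓘(ℝ, E) G) {h : G → ℂ} {V : Set G}
    (hV : IsOpen V) (hh : ContMDiffOn 𝓘(ℝ, E) 𝓘(ℝ, ℂ) ∞ h V) :
    ContMDiffOn 𝓘(ℝ, E) 𝓘(ℝ, ℂ) ∞ (leftDeriv Y h) V := by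
  intro x hx
  obtain ⟨f, hf⟩ := exists_smoothFun_eventuallyEq hV hx hh
  have hs : ContMDiff 𝓘(ℝ, E) 𝓘(ℝ, ℂ) ∞ (leftVF Y f).1 := (leftVF Y f).2
  refine (hs.contMDiffAt.congr_of_eventuallyEq ?_).contMDiffWithinAt
  filter_upwards [hf.eventually_nhds] with y hy
  exact (leftDeriv_congr Y hy).symm

/-- The tangent space at `x` is the model space read through the preferred chart at `x`, so that
chart has the identity as differential at its base point. This identifies vectors of the Lie algebra
with coordinate vectors at `1`. -/
theorem mfderiv_chartAt_self_apply (x : G) (v : E) :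
    (mfderiv 𝓘(ℝ, E) 𝓘(ℝ, E) (chartAt E x) x : E →L[ℝ] E) v = v := by
  have hM : IsManifold 𝓘(ℝ, E) ∞ G := LieGroup.toContMDiffMul.toIsManifold
  have hM1 : IsManifold 𝓘(ℝ, E) 1 G := IsManifold.of_le (n := ∞) (by simp)
  have h := mfderiv_chartAt_eq_tangentCoordChange (I := 𝓘(ℝ, E)) (mem_chart_source E x)
  refine (congrArg (fun A : E →L[ℝ] E => A v) h).trans (tangentCoordChange_self ?_)
  exact mem_extChartAt_source x

end Bump
end Lie
end InvDiffOp

namespace InvDiffOp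

variable {E : Type*} [NormedAddCommGroup E] [NormedSpace ℝ E]
  {G : Type*} [TopologicalSpace G] [ChartedSpace E G] [Group G]

/-! ### Functions smooth on an open set and their derivations -/

variable (E) in
/-- The algebra of complex-valued functions on `G` that are smooth on `V`. -/
def smoothOn (V : Set G) : Subalgebra ℂ (G → ℂ) where
  carrier := {h | ContMDiffOn 𝓘(ℝ, E) 𝓘(ℝ, ℂ) ∞ h V}
  mul_mem' {f g} hf hg := by
    have hm : ContMDiff (𝓘(ℝ, ℂ).prod 𝓘(ℝ, ℂ)) 𝓘(ℝ, ℂ) ∞ fun p : ℂ × ℂ => p.1 * p.2 := by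
      rw [← modelWithCornersSelf_prod, chartedSpaceSelf_prod]
      exact contDiff_mul.contMDiff
    exact hm.comp_contMDiffOn (ContMDiffOn.prodMk hf hg)
  add_mem' hf hg := ContMDiffOn.add hf hg
  algebraMap_mem' c := contMDiffOn_const

theorem smoothOn_congr {V : Set G} {h k : G → ℂ} (hk : k ∈ smoothOn E V) (e : Set.EqOn h k V) :
    h ∈ smoothOn E V := ContMDiffOn.congr hk e

variable (E) in
/-- An operator on functions that is local and a derivation over an open set `V`. -/
structure IsDerivOn (V : Set G) (B : (G → ℂ) → G → ℂ) : Prop where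
  mem : ∀ h ∈ smoothOn E V, B h ∈ smoothOn E V
  congr : ∀ h k, Set.EqOn h k V → Set.EqOn (B h) (B k) V
  add : ∀ h ∈ smoothOn E V, ∀ k ∈ smoothOn E V, Set.EqOn (B (h + k)) (B h + B k) V
  mul : ∀ h ∈ smoothOn E V, ∀ k ∈ smoothOn E V, Set.EqOn (B (h * k)) (B h * k + h * B k) V

theorem IsDerivOn.zero {V : Set G} {B : (G → ℂ) → G → ℂ} (hB : IsDerivOn E V B) :
    Set.EqOn (B 0) 0 V := by
  intro x hx
  have := hB.add 0 (zero_mem _) 0 (zero_mem _) hx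
  simpa using this

theorem IsDerivOn.sum {V : Set G} {B : (G → ℂ) → G → ℂ} (hB : IsDerivOn E V B) {ι : Type*}
    (s : Finset ι) (f : ι → G → ℂ) (hf : ∀ i ∈ s, f i ∈ smoothOn E V) :
    Set.EqOn (B (∑ i ∈ s, f i)) (∑ i ∈ s, B (f i)) V := by
  classical
  induction s using Finset.induction_on with
  | empty => simpa using hB.zero
  | insert a s ha ih =>
    intro x hx
    rw [Finset.sum_insert ha, Finset.sum_insert ha]
    have h₁ := hB.add (f a) (hf a (by simp)) (∑ i ∈ s, f i)
      (sum_mem fun i hi => hf i (by simp [hi])) hx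
    have h₂ := ih (fun i hi => hf i (by simp [hi])) hx
    rw [h₁, Pi.add_apply, Pi.add_apply, h₂]

/-- The composition of the operators named by a word. -/
def wordOp {ι : Type*} (A : ι → (G → ℂ) → G → ℂ) (l : List ι) (h : G → ℂ) : G → ℂ :=
  l.foldr A h

theorem wordOp_mem {V : Set G} {ι : Type*} {A : ι → (G → ℂ) → G → ℂ}
    (hA : ∀ i, ∀ h ∈ smoothOn E V, A i h ∈ smoothOn E V) (l : List ι) {h : G → ℂ}
    (hh : h ∈ smoothOn E V) : wordOp A l h ∈ smoothOn E V := by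
  induction l with
  | nil => exact hh
  | cons a l ih => exact hA a _ ih

section Words
variable {V : Set G} {ι κ : Type*} [Fintype κ] {A : ι → (G → ℂ) → G → ℂ}
  {B : κ → (G → ℂ) → G → ℂ}

/-- Prepending an operator `A = ∑ ξ_j B_j` to a combination of words in the `B_j`. -/
def prependCoeff (A : (G → ℂ) → G → ℂ) (ξ : κ → G → ℂ) (N : ℕ)
    (c : ∀ k : ℕ, (Fin k → κ) → G → ℂ) : ∀ k : ℕ, (Fin k → κ) → G → ℂ
  | 0, w => A (c 0 w)
  -- Coefficients of words longer than `N` are arbitrary and do not enter the given combination,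
  -- hence the cut-off.
  | k + 1, w => (if k + 1 ≤ N then A (c (k + 1) w) else 0) + c k (Fin.tail w) * ξ (w 0)

/-- If the operators `A_i` are combinations of derivations `B_j` with smooth coefficients then words
in the `A_i` are combinations of words in the `B_j`. -/
theorem exists_wordOp_eq_sum (hB : ∀ j, IsDerivOn E V (B j)) (ξ : ι → κ → G → ℂ)
    (hξ : ∀ i j, ξ i j ∈ smoothOn E V)
    (hAB : ∀ i, ∀ h ∈ smoothOn E V, ∀ x ∈ V, A i h x = ∑ j, ξ i j x * B j h x) (l : List ι) :
    ∃ c : ∀ k : ℕ, (Fin k → κ) → G → ℂ, (∀ k w, c k w ∈ smoothOn E V) ∧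
      ∀ h ∈ smoothOn E V, ∀ x ∈ V, wordOp A l h x =
        ∑ k ∈ Finset.range (l.length + 1), ∑ w : Fin k → κ,
          c k w x * wordOp B (List.ofFn w) h x := by
  have hA : ∀ i, ∀ h ∈ smoothOn E V, A i h ∈ smoothOn E V := fun i h hh =>
    smoothOn_congr (k := ∑ j, ξ i j * B j h)
      (sum_mem fun j _ => mul_mem (hξ i j) ((hB j).mem h hh)) fun x hx => by
        simp [hAB i h hh x hx]
  induction l with
  | nil =>
    -- Only length `0` enters the sum, so the coefficients of longer words are irrelevant.
    refine ⟨fun _ _ => 1, fun _ _ => one_mem _, fun h _ x _ => ?_⟩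
    simp [wordOp]
  | cons a l ih =>
    obtain ⟨c, hc, hcl⟩ := ih
    set N := l.length with hN
    refine ⟨prependCoeff (A a) (ξ a) N c, ?_, fun h hh x hx => ?_⟩
    · rintro (_ | k) w
      · exact hA a _ (hc 0 w)
      · refine add_mem ?_ (mul_mem (hc _ _) (hξ _ _))
        split_ifs
        · exact hA a _ (hc _ w)
        · exact zero_mem _
    have hw : ∀ l', wordOp B l' h ∈ smoothOn E V := fun l' =>
      wordOp_mem (fun j => (hB j).mem) l' hh
    have hterm : ∀ k w, c k w * wordOp B (List.ofFn w) h ∈ smoothOn E V := fun k w =>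
      mul_mem (hc k w) (hw _)
    have e₁ : Set.EqOn (wordOp A l h) (∑ k ∈ Finset.range (N + 1), ∑ w : Fin k → κ,
        c k w * wordOp B (List.ofFn w) h) V := by
      intro y hy
      rw [hcl h hh y hy]
      simp
    have e₂ : ∀ j, B j (wordOp A l h) x = ∑ k ∈ Finset.range (N + 1), ∑ w : Fin k → κ,
        (B j (c k w) x * wordOp B (List.ofFn w) h x +
          c k w x * B j (wordOp B (List.ofFn w) h) x) := by
      intro j
      rw [(hB j).congr _ _ e₁ hx, (hB j).sum _ _ (fun k _ => sum_mem fun w _ => hterm k w) hx,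
        Finset.sum_apply]
      refine Finset.sum_congr rfl fun k _ => ?_
      rw [(hB j).sum _ _ (fun w _ => hterm k w) hx, Finset.sum_apply]
      refine Finset.sum_congr rfl fun w _ => ?_
      rw [(hB j).mul _ (hc k w) _ (hw _) hx]
      rfl
    -- By Leibniz, `B j` either differentiates a coefficient or prepends a letter; summed over `j`,
    -- the first kind of terms recombines to `A a (c k w)`.
    have e₃ : A a (wordOp A l h) x = ∑ k ∈ Finset.range (N + 1), ∑ w : Fin k → κ,
        (A a (c k w) x * wordOp B (List.ofFn w) h x +
          ∑ j, c k w x * ξ a j x * wordOp B (j :: List.ofFn w) h x) := by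
      rw [hAB a _ (wordOp_mem hA l hh) x hx]
      simp only [e₂, Finset.mul_sum]
      rw [Finset.sum_comm]
      refine Finset.sum_congr rfl fun k _ => ?_
      rw [Finset.sum_comm]
      refine Finset.sum_congr rfl fun w _ => ?_
      rw [hAB a _ (hc k w) x hx, Finset.sum_mul, ← Finset.sum_add_distrib]
      refine Finset.sum_congr rfl fun j _ => ?_
      simp only [wordOp, List.foldr_cons]
      ring
    change A a (wordOp A l h) x = _
    rw [e₃, List.length_cons, Finset.sum_range_succ' _ (l.length + 1)]
    simp only [Finset.sum_add_distrib]
    have e₄ : ∀ k, ∑ w : Fin (k + 1) → κ, prependCoeff (A a) (ξ a) N c (k + 1) w x *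
          wordOp B (List.ofFn w) h x =
        (if k + 1 ≤ N then ∑ w : Fin (k + 1) → κ, A a (c (k + 1) w) x *
          wordOp B (List.ofFn w) h x else 0) +
        ∑ w : Fin k → κ, ∑ j, c k w x * ξ a j x * wordOp B (j :: List.ofFn w) h x := by
      intro k
      have : ∑ w : Fin k → κ, ∑ j, c k w x * ξ a j x * wordOp B (j :: List.ofFn w) h x =
          ∑ w : Fin (k + 1) → κ, c k (Fin.tail w) x * ξ a (w 0) x *
            wordOp B (List.ofFn w) h x := by
        rw [← (Fin.consEquiv fun _ : Fin (k + 1) => κ).sum_comp, Fintype.sum_prod_type,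
          Finset.sum_comm]
        simp [Fin.consEquiv, List.ofFn_succ]
      rw [this]
      split_ifs with hk <;> simp [prependCoeff, hk, add_mul, Finset.sum_add_distrib]
    simp only [e₄, Finset.sum_add_distrib]
    rw [add_right_comm]
    congr 1
    -- On one side the empty word is split off, on the other the top index `N`, where the cut-off
    -- gives zero.
    rw [Finset.sum_range_succ' _ N, ← hN, Finset.sum_range_succ _ N]
    simp only [prependCoeff]
    have : ∑ k ∈ Finset.range N, (if k + 1 ≤ N then ∑ w : Fin (k + 1) → κ, A a (c (k + 1) w) x *
          wordOp B (List.ofFn w) h x else 0) = ∑ k ∈ Finset.range N, ∑ w : Fin (k + 1) → κ,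
          A a (c (k + 1) w) x * wordOp B (List.ofFn w) h x :=
      Finset.sum_congr rfl fun k hk => if_pos (Finset.mem_range.1 hk)
    rw [this]
    simp
end Words

end InvDiffOp

namespace InvDiffOp

variable {E : Type*} [NormedAddCommGroup E] [NormedSpace ℝ E]
  {G : Type*} [TopologicalSpace G] [ChartedSpace E G] [Group G]

/-! ### Coordinate derivatives -/

/-- The derivative in the direction `v` in the chart at `x₀`. -/
def coordDeriv (x₀ : G) (v : E) (h : G → ℂ) (x : G) : ℂ :=
  fderiv ℝ (h ∘ (chartAt E x₀).symm) (chartAt E x₀ x) v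

section Chart
variable [IsManifold 𝓘(ℝ, E) ∞ G] {x₀ : G} {V : Set G}

theorem contDiffOn_comp_chart_symm {h : G → ℂ} (hh : h ∈ smoothOn E V) :
    ContDiffOn ℝ ∞ (h ∘ (chartAt E x₀).symm)
      ((chartAt E x₀).target ∩ (chartAt E x₀).symm ⁻¹' V) := by
  rw [← contMDiffOn_iff_contDiffOn]
  refine ContMDiffOn.comp (I' := 𝓘(ℝ, E)) hh ?_ fun y hy => hy.2
  exact (contMDiffOn_chart_symm (I := 𝓘(ℝ, E)) (x := x₀)).mono Set.inter_subset_left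

theorem isOpen_chart_image (hV : IsOpen V) :
    IsOpen ((chartAt E x₀).target ∩ (chartAt E x₀).symm ⁻¹' V) :=
  (chartAt E x₀).isOpen_inter_preimage_symm hV

theorem chart_mem_image (hVs : V ⊆ (chartAt E x₀).source) {x : G} (hx : x ∈ V) :
    chartAt E x₀ x ∈ (chartAt E x₀).target ∩ (chartAt E x₀).symm ⁻¹' V :=
  ⟨(chartAt E x₀).map_source (hVs hx), by simpa [(chartAt E x₀).left_inv (hVs hx)] using hx⟩

theorem isDerivOn_coordDeriv (hV : IsOpen V) (hVs : V ⊆ (chartAt E x₀).source) (v : E) :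
    IsDerivOn E V (coordDeriv x₀ v) := by
  set W := (chartAt E x₀).target ∩ (chartAt E x₀).symm ⁻¹' V with hW
  have hWo : IsOpen W := isOpen_chart_image hV
  have hd : ∀ h ∈ smoothOn E V, ∀ x ∈ V,
      DifferentiableAt ℝ (h ∘ (chartAt E x₀).symm) (chartAt E x₀ x) := fun h hh x hx =>
    ((contDiffOn_comp_chart_symm hh).contDiffAt
      (hWo.mem_nhds (chart_mem_image hVs hx))).differentiableAt (by simp)
  refine ⟨fun h hh => ?_, fun h k e x hx => ?_, fun h hh k hk x hx => ?_, fun h hh k hk x hx => ?_⟩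
  · have h₁ := contDiffOn_comp_chart_symm (x₀ := x₀) hh
    have h₂ : ContDiffOn ℝ ∞ (fun y => fderiv ℝ (h ∘ (chartAt E x₀).symm) y v) W :=
      (h₁.fderiv_of_isOpen hWo (m := ∞) (by simp)).clm_apply contDiffOn_const
    refine ContMDiffOn.comp (I' := 𝓘(ℝ, E)) h₂.contMDiffOn ?_ fun x hx => chart_mem_image hVs hx
    exact (contMDiffOn_chart (I := 𝓘(ℝ, E)) (x := x₀)).mono hVs
  · have : h ∘ (chartAt E x₀).symm =ᶠ[𝓝 (chartAt E x₀ x)] k ∘ (chartAt E x₀).symm := by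
      filter_upwards [hWo.mem_nhds (chart_mem_image hVs hx)] with y hy
      exact e hy.2
    simp [coordDeriv, this.fderiv_eq]
  · have e : (h + k) ∘ (chartAt E x₀).symm = h ∘ (chartAt E x₀).symm + k ∘ (chartAt E x₀).symm := rfl
    simp only [coordDeriv, e, Pi.add_apply]
    rw [fderiv_add (hd h hh x hx) (hd k hk x hx)]
    simp
  · have e : (h * k) ∘ (chartAt E x₀).symm = h ∘ (chartAt E x₀).symm * k ∘ (chartAt E x₀).symm := rfl
    simp only [coordDeriv, e, Pi.add_apply]
    rw [fderiv_mul (hd h hh x hx) (hd k hk x hx)]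
    simp only [coordDeriv, add_apply, smul_apply, smul_eq_mul, Pi.mul_apply, Function.comp_apply,
      (chartAt E x₀).left_inv (hVs hx)]
    ring

/-- A further letter differentiates, near the point, an iterated derivative evaluated on fixed
vectors. This links words to the form required in `IsDifferentialOperator`. -/
theorem wordOp_coordDeriv (hV : IsOpen V) (hVs : V ⊆ (chartAt E x₀).source) {κ : Type*}
    (e : κ → E) {h : G → ℂ} (hh : h ∈ smoothOn E V) (k : ℕ) (w : Fin k → κ) :
    ∀ x ∈ V, wordOp (fun i => coordDeriv x₀ (e i)) (List.ofFn w) h x =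
      iteratedFDeriv ℝ k (h ∘ (chartAt E x₀).symm) (chartAt E x₀ x) fun i => e (w i) := by
  have hWo : IsOpen ((chartAt E x₀).target ∩ (chartAt E x₀).symm ⁻¹' V) := isOpen_chart_image hV
  induction k with
  | zero =>
    intro x hx
    simp [wordOp, (chartAt E x₀).left_inv (hVs hx)]
  | succ k ih =>
    intro x hx
    rw [List.ofFn_succ]
    change coordDeriv x₀ (e (w 0)) (wordOp (fun i => coordDeriv x₀ (e i))
      (List.ofFn fun i => w i.succ) h) x = _
    have e₁ : wordOp (fun i => coordDeriv x₀ (e i)) (List.ofFn fun i => w i.succ) h ∘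
        (chartAt E x₀).symm =ᶠ[𝓝 (chartAt E x₀ x)] fun y =>
          iteratedFDeriv ℝ k (h ∘ (chartAt E x₀).symm) y fun i => e (w i.succ) := by
      filter_upwards [hWo.mem_nhds (chart_mem_image hVs hx)] with y hy
      simp only [Function.comp_apply]
      rw [ih (fun i => w i.succ) _ hy.2, (chartAt E x₀).right_inv hy.1]
    have hs : ContDiffAt ℝ ∞ (h ∘ (chartAt E x₀).symm) (chartAt E x₀ x) :=
      (contDiffOn_comp_chart_symm hh).contDiffAt (hWo.mem_nhds (chart_mem_image hVs hx))
    have hd : DifferentiableAt ℝ (iteratedFDeriv ℝ k (h ∘ (chartAt E x₀).symm))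
        (chartAt E x₀ x) := hs.differentiableAt_iteratedFDeriv (by exact_mod_cast ENat.natCast_lt_top k)
    rw [coordDeriv, e₁.fderiv_eq, iteratedFDeriv_succ_apply_left]
    rw [fderiv_continuousMultilinear_apply_const hd]
    rfl

/-- The `i`-th coordinate, as a complex-valued function. -/
def coordFun [FiniteDimensional ℝ E] (x₀ : G) (i : Fin (Module.finrank ℝ E)) (x : G) : ℂ :=
  (((Module.finBasis ℝ E).coord i (chartAt E x₀ x) : ℝ) : ℂ)

theorem coordFun_mem [FiniteDimensional ℝ E] (i : Fin (Module.finrank ℝ E))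
    (hVs : V ⊆ (chartAt E x₀).source) : coordFun (E := E) x₀ i ∈ smoothOn E V := by
  set L : E →L[ℝ] ℂ :=
    Complex.ofRealCLM ∘L LinearMap.toContinuousLinearMap ((Module.finBasis ℝ E).coord i)
  exact L.contMDiff.comp_contMDiffOn ((contMDiffOn_chart (I := 𝓘(ℝ, E)) (x := x₀)).mono hVs)

/-- The differential of the chart at `x₀`. -/
def chartDeriv (x₀ x : G) : E →L[ℝ] E := mfderiv 𝓘(ℝ, E) 𝓘(ℝ, E) (chartAt E x₀) x

theorem diffAt_comp_chart {x : G} (hx : x ∈ (chartAt E x₀).source) {F : E → ℂ}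
    (hF : DifferentiableAt ℝ F (chartAt E x₀ x)) :
    diffAt (E := E) (F ∘ chartAt E x₀) x = (fderiv ℝ F (chartAt E x₀ x)) ∘L chartDeriv x₀ x := by
  have hc : MDifferentiableAt 𝓘(ℝ, E) 𝓘(ℝ, E) (chartAt E x₀) x :=
    mdifferentiableAt_atlas (ChartedSpace.chart_mem_atlas _) hx
  have := (hF.hasFDerivAt.hasMFDerivAt.comp x hc.hasMFDerivAt).mfderiv
  exact this

theorem diffAt_eq_fderiv (hV : IsOpen V) (hVs : V ⊆ (chartAt E x₀).source) {h : G → ℂ}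
    (hh : h ∈ smoothOn E V) {x : G} (hx : x ∈ V) :
    diffAt (E := E) h x =
      (fderiv ℝ (h ∘ (chartAt E x₀).symm) (chartAt E x₀ x)) ∘L chartDeriv x₀ x := by
  have hd : DifferentiableAt ℝ (h ∘ (chartAt E x₀).symm) (chartAt E x₀ x) :=
    ((contDiffOn_comp_chart_symm hh).contDiffAt
      ((isOpen_chart_image hV).mem_nhds (chart_mem_image hVs hx))).differentiableAt (by simp)
  rw [← diffAt_comp_chart (hVs hx) hd]
  refine diffAt_congr ?_
  filter_upwards [hV.mem_nhds hx] with y hy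
  simp [(chartAt E x₀).left_inv (hVs hy)]

/-- By the chain rule, the components of the field in the chart are its derivatives of the
coordinate functions, which makes them visibly smooth. -/
theorem leftDeriv_eq_sum_coordDeriv [FiniteDimensional ℝ E] (hV : IsOpen V)
    (hVs : V ⊆ (chartAt E x₀).source) {h : G → ℂ} (hh : h ∈ smoothOn E V) {x : G} (hx : x ∈ V)
    (Y : GroupLieAlgebra 𝓘(ℝ, E) G) :
    leftDeriv Y h x = ∑ i, leftDeriv Y (coordFun (E := E) x₀ i) x *
      coordDeriv x₀ (Module.finBasis ℝ E i) h x := by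
  have e : ∀ i, leftDeriv Y (coordFun (E := E) x₀ i) x =
      (((Module.finBasis ℝ E).repr (chartDeriv x₀ x (leftField Y x)) i : ℝ) : ℂ) := by
    intro i
    set L : E →L[ℝ] ℂ :=
      Complex.ofRealCLM ∘L LinearMap.toContinuousLinearMap ((Module.finBasis ℝ E).coord i)
    have := diffAt_comp_chart (E := E) (x₀ := x₀) (hVs hx) (F := L) L.differentiableAt
    rw [L.fderiv] at this
    change diffAt (E := E) (L ∘ chartAt E x₀) x _ = _
    rw [this]
    rfl
  simp only [e]
  rw [leftDeriv, diffAt_eq_fderiv hV hVs hh hx]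
  conv_lhs => rw [ContinuousLinearMap.comp_apply,
    ← (Module.finBasis ℝ E).sum_repr (chartDeriv x₀ x (leftField Y x))]
  rw [map_sum]
  simp [coordDeriv]

end Chart

/-! ### Words in left invariant vector fields are differential operators. -/

section Lie
variable [LieGroup 𝓘(ℝ, E) ∞ G] [FiniteDimensional ℝ E] [T2Space G]

theorem isManifold_of_lieGroup : IsManifold 𝓘(ℝ, E) ∞ G := LieGroup.toContMDiffMul.toIsManifold

theorem leftDeriv_mem_smoothOn (Y : GroupLieAlgebra 𝓘(ℝ, E) G) {V : Set G} (hV : IsOpen V)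
    {h : G → ℂ} (hh : h ∈ smoothOn E V) : leftDeriv Y h ∈ smoothOn E V :=
  contMDiffOn_leftDeriv Y hV hh

theorem isDerivOn_leftDeriv (Y : GroupLieAlgebra 𝓘(ℝ, E) G) {V : Set G} (hV : IsOpen V) :
    IsDerivOn E V (leftDeriv Y) := by
  have hd : ∀ h ∈ smoothOn E V, ∀ x ∈ V, MDifferentiableAt 𝓘(ℝ, E) 𝓘(ℝ, ℂ) h x :=
    fun h hh x hx => ((hh x hx).contMDiffAt (hV.mem_nhds hx)).mdifferentiableAt (by simp)
  refine ⟨fun h hh => leftDeriv_mem_smoothOn Y hV hh, fun h k e x hx => ?_,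
    fun h hh k hk x hx => leftDeriv_add Y (hd h hh x hx) (hd k hk x hx),
    fun h hh k hk x hx => leftDeriv_mul Y (hd h hh x hx) (hd k hk x hx)⟩
  exact leftDeriv_congr Y (e.eventuallyEq_of_mem (hV.mem_nhds hx))

theorem smoothFun_mem_smoothOn (f : SmoothFun E G) (V : Set G) : f.1 ∈ smoothOn E V :=
  ContMDiff.contMDiffOn (I := 𝓘(ℝ, E)) (I' := 𝓘(ℝ, ℂ)) f.2

/-- A product of left invariant vector fields applied to a function. -/
theorem prod_leftVF_apply {ι : Type*} (Y : ι → GroupLieAlgebra 𝓘(ℝ, E) G) (l : List ι)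
    (f : SmoothFun E G) :
    ((l.map fun i => leftVF (Y i)).prod f).1 = wordOp (fun i => leftDeriv (Y i)) l f.1 := by
  induction l with
  | nil => rfl
  | cons a l ih =>
    rw [List.map_cons, List.prod_cons, Module.End.mul_apply]
    change leftDeriv (Y a) ((l.map fun i => leftVF (Y i)).prod f).1 = _
    rw [ih]
    rfl

theorem isDifferentialOperator_prod_leftVF (l : List (GroupLieAlgebra 𝓘(ℝ, E) G)) :
    IsDifferentialOperator (l.map leftVF).prod := by
  intro x₀
  have hM : IsManifold 𝓘(ℝ, E) ∞ G := isManifold_of_lieGroup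
  set V := (chartAt E x₀).source with hVdef
  have hV : IsOpen V := (chartAt E x₀).open_source
  obtain ⟨c, hc, hcl⟩ := exists_wordOp_eq_sum (V := V) (E := E)
    (A := fun Y : GroupLieAlgebra 𝓘(ℝ, E) G => leftDeriv Y)
    (B := fun i => coordDeriv x₀ (Module.finBasis ℝ E i))
    (fun j => isDerivOn_coordDeriv hV subset_rfl _)
    (fun Y i => leftDeriv Y (coordFun (E := E) x₀ i))
    (fun Y i => leftDeriv_mem_smoothOn Y hV (coordFun_mem i subset_rfl))
    (fun Y h hh x hx => leftDeriv_eq_sum_coordDeriv hV subset_rfl hh hx Y) l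
  refine ⟨l.length, c, V, hV.mem_nhds (mem_chart_source E x₀), subset_rfl, hc, fun f x hx => ?_⟩
  have h₁ := prod_leftVF_apply (fun Y : GroupLieAlgebra 𝓘(ℝ, E) G => Y) l f
  rw [h₁, hcl f.1 (smoothFun_mem_smoothOn f V) x hx]
  refine Finset.sum_congr rfl fun k _ => Finset.sum_congr rfl fun w _ => ?_
  rw [wordOp_coordDeriv hV subset_rfl _ (smoothFun_mem_smoothOn f V) k w x hx]

theorem IsDifferentialOperator.smul {D : Op E G} (hD : IsDifferentialOperator D) (z : ℂ) :
    IsDifferentialOperator (z • D) := by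
  intro x₀
  obtain ⟨N, a, U, hU, hUs, ha, h⟩ := hD x₀
  refine ⟨N, fun k w x => z * a k w x, U, hU, hUs, fun k w => ?_, fun f x hx => ?_⟩
  · exact (smoothOn E U).smul_mem (ha k w) z
  · have : ((z • D) f).1 x = z * (D f).1 x := rfl
    rw [this, h f x hx]
    simp [Finset.mul_sum, mul_assoc]

theorem IsDifferentialOperator.add {D D' : Op E G} (hD : IsDifferentialOperator D)
    (hD' : IsDifferentialOperator D') : IsDifferentialOperator (D + D') := by
  intro x₀
  obtain ⟨N, a, U, hU, hUs, ha, h⟩ := hD x₀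
  obtain ⟨N', a', U', hU', hUs', ha', h'⟩ := hD' x₀
  -- Beyond its own order each family of coefficients is unconstrained and has to be replaced by
  -- zero.
  refine ⟨max N N', fun k w => (if k ≤ N then a k w else 0) + if k ≤ N' then a' k w else 0,
    U ∩ U', Filter.inter_mem hU hU', fun x hx => hUs hx.1, fun k w => ?_, fun f x hx => ?_⟩
  · refine (smoothOn E (U ∩ U')).add_mem ?_ ?_ <;> split_ifs
    · exact (ha k w).mono Set.inter_subset_left
    · exact zero_mem _
    · exact (ha' k w).mono Set.inter_subset_right
    · exact zero_mem _
  · have : ((D + D') f).1 x = (D f).1 x + (D' f).1 x := rfl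
    rw [this, h f x hx.1, h' f x hx.2]
    simp only [Pi.add_apply, add_mul, Finset.sum_add_distrib]
    congr 1
    · rw [← Finset.sum_subset (Finset.range_mono (Nat.succ_le_succ (le_max_left N N')))]
      · refine Finset.sum_congr rfl fun k hk => ?_
        simp [Nat.lt_succ_iff.1 (Finset.mem_range.1 hk)]
      · intro k _ hk
        have : ¬ k ≤ N := fun h => hk (Finset.mem_range.2 (Nat.lt_succ_of_le h))
        simp [this]
    · rw [← Finset.sum_subset (Finset.range_mono (Nat.succ_le_succ (le_max_right N N')))]
      · refine Finset.sum_congr rfl fun k hk => ?_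
        simp [Nat.lt_succ_iff.1 (Finset.mem_range.1 hk)]
      · intro k _ hk
        have : ¬ k ≤ N' := fun h => hk (Finset.mem_range.2 (Nat.lt_succ_of_le h))
        simp [this]

theorem isDifferentialOperator_zero : IsDifferentialOperator (0 : Op E G) := by
  simpa using (isDifferentialOperator_prod_leftVF (E := E) (G := G) []).smul 0

theorem envAlg_eq_span : Subalgebra.toSubmodule (envAlg E G) =
    Submodule.span ℂ (Set.range fun l : List (GroupLieAlgebra 𝓘(ℝ, E) G) =>
      (l.map leftVF).prod) := by
  rw [envAlg, Algebra.adjoin_eq_span]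
  congr 1
  ext D
  constructor
  · intro h
    obtain ⟨l, hl, rfl⟩ := Submonoid.exists_list_of_mem_closure h
    choose! Y hY using hl
    refine ⟨l.map Y, ?_⟩
    simp only [List.map_map]
    congr 1
    refine (List.map_congr_left fun y hy => hY y hy).trans (by simp)
  · rintro ⟨l, rfl⟩
    refine list_prod_mem fun y hy => ?_
    obtain ⟨Y, -, rfl⟩ := List.mem_map.1 hy
    exact Submonoid.subset_closure ⟨Y, rfl⟩

theorem isDifferentialOperator_of_mem_envAlg {D : Op E G} (hD : D ∈ envAlg E G) :
    IsDifferentialOperator D := by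
  have : D ∈ Submodule.span ℂ (Set.range fun l : List (GroupLieAlgebra 𝓘(ℝ, E) G) =>
      (l.map leftVF).prod) := by
    rw [← envAlg_eq_span]; exact hD
  induction this using Submodule.span_induction with
  | mem x hx => obtain ⟨l, rfl⟩ := hx; exact isDifferentialOperator_prod_leftVF l
  | zero => exact isDifferentialOperator_zero
  | add x y hx hy h₁ h₂ =>
    rw [← envAlg_eq_span] at hx hy
    exact (h₁ hx).add (h₂ hy)
  | smul a x hx h =>
    rw [← envAlg_eq_span] at hx
    exact (h hx).smul a

end Lie
end InvDiffOp

/-! ### Left invariant differential operators come from the Lie algebra. -/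

namespace InvDiffOp

variable {E : Type*} [NormedAddCommGroup E] [NormedSpace ℝ E]
  {G : Type*} [TopologicalSpace G] [ChartedSpace E G] [Group G]

section Lie
variable [LieGroup 𝓘(ℝ, E) ∞ G] [FiniteDimensional ℝ E] [T2Space G]

theorem inv_mem_smoothOn {V : Set G} {h : G → ℂ} (hh : h ∈ smoothOn E V) (h0 : ∀ x ∈ V, h x ≠ 0) :
    h⁻¹ ∈ smoothOn E V := fun x hx => by
  have h₁ : ContMDiffAt 𝓘(ℝ, ℂ) 𝓘(ℝ, ℂ) ∞ (fun z : ℂ => z⁻¹) (h x) :=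
    (contDiffAt_inv ℝ (h0 x hx)).contMDiffAt
  exact h₁.comp_contMDiffWithinAt x (hh x hx)

variable (E G) in
/-- A basis of the Lie algebra. -/
def lieBasis : Module.Basis (Fin (Module.finrank ℝ E)) ℝ (GroupLieAlgebra 𝓘(ℝ, E) G) :=
  Module.finBasis ℝ E

variable (E) in
/-- The components of the basis of left invariant vector fields in the chart at the identity. -/
def frameMatrix (x : G) : Matrix (Fin (Module.finrank ℝ E)) (Fin (Module.finrank ℝ E)) ℂ :=
  fun j i => leftDeriv (lieBasis E G j) (coordFun (E := E) (1 : G) i) x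

variable (E) in
/-- `frameMatrix` as a matrix of smooth functions. -/
def smoothFrameMatrix {V : Set G} (hV : IsOpen V) (hVs : V ⊆ (chartAt E (1 : G)).source) :
    Matrix (Fin (Module.finrank ℝ E)) (Fin (Module.finrank ℝ E)) (smoothOn E V) :=
  have := isManifold_of_lieGroup (E := E) (G := G)
  fun j i => ⟨leftDeriv (lieBasis E G j) (coordFun (E := E) (1 : G) i),
    leftDeriv_mem_smoothOn _ hV (coordFun_mem i hVs)⟩

/-- Evaluation at a point. -/
def smoothOnEval (V : Set G) (x : G) : smoothOn E V →+* ℂ :=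
  (Pi.evalRingHom (fun _ : G => ℂ) x).comp (smoothOn E V).val.toRingHom

theorem smoothFrameMatrix_map {V : Set G} (hV : IsOpen V)
    (hVs : V ⊆ (chartAt E (1 : G)).source) (x : G) :
    (smoothFrameMatrix E hV hVs).map (smoothOnEval V x) = frameMatrix E x := rfl

/-- The chart at the identity has identity differential there, and `lieBasis` is the basis that
defines the coordinates. Hence the determinant is nonzero near `1`. -/
theorem frameMatrix_one : frameMatrix E (1 : G) = 1 := by
  have := isManifold_of_lieGroup (E := E) (G := G)
  ext j i
  set L : E →L[ℝ] ℂ :=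
    Complex.ofRealCLM ∘L LinearMap.toContinuousLinearMap ((Module.finBasis ℝ E).coord i) with hL
  have h := diffAt_comp_chart (E := E) (x₀ := (1 : G)) (mem_chart_source E (1 : G)) (F := L)
    L.differentiableAt
  rw [L.fderiv] at h
  change diffAt (E := E) (L ∘ chartAt E (1 : G)) 1 (leftField (lieBasis E G j) 1) = _
  rw [h, leftField_one]
  have h₂ : chartDeriv (1 : G) 1 (Module.finBasis ℝ E j) = Module.finBasis ℝ E j :=
    mfderiv_chartAt_self_apply 1 _
  change L (chartDeriv (1 : G) 1 (Module.finBasis ℝ E j)) = _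
  rw [h₂, hL]
  simp only [ContinuousLinearMap.comp_apply, LinearMap.coe_toContinuousLinearMap',
    Module.Basis.coord_apply, Module.Basis.repr_self, Finsupp.single_apply, Matrix.one_apply]
  split_ifs <;> simp

/-- Where the determinant of `frameMatrix` does not vanish, Cramer's rule inverts the passage from
coordinate derivatives to left invariant ones with smooth coefficients. -/
theorem exists_coordDeriv_eq_sum_leftDeriv : ∃ V : Set G, IsOpen V ∧ (1 : G) ∈ V ∧
    V ⊆ (chartAt E (1 : G)).source ∧
    ∃ η : Fin (Module.finrank ℝ E) → Fin (Module.finrank ℝ E) → G → ℂ,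
      (∀ i j, η i j ∈ smoothOn E V) ∧ ∀ i, ∀ h ∈ smoothOn E V, ∀ x ∈ V,
        coordDeriv 1 (Module.finBasis ℝ E i) h x =
          ∑ j, η i j x * leftDeriv (lieBasis E G j) h x := by
  have := isManifold_of_lieGroup (E := E) (G := G)
  set S := (chartAt E (1 : G)).source with hS
  have hSo : IsOpen S := (chartAt E (1 : G)).open_source
  have hdet : ∀ (V : Set G) (hV : IsOpen V) (hVs : V ⊆ S) (x : G),
      (smoothFrameMatrix E hV hVs).det.1 x = (frameMatrix E x).det := by
    intro V hV hVs x
    rw [← smoothFrameMatrix_map hV hVs x]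
    exact RingHom.map_det (smoothOnEval V x) _
  set V := S ∩ (fun x => (frameMatrix E x).det) ⁻¹' {0}ᶜ with hV
  have hVo : IsOpen V := by
    refine ContinuousOn.isOpen_inter_preimage ?_ hSo isOpen_compl_singleton
    have h₁ : ContMDiffOn 𝓘(ℝ, E) 𝓘(ℝ, ℂ) ∞ (smoothFrameMatrix E hSo subset_rfl).det.1 S :=
      (smoothFrameMatrix E hSo subset_rfl).det.2
    exact h₁.continuousOn.congr fun x _ => (hdet S hSo subset_rfl x).symm
  have hVS : V ⊆ S := Set.inter_subset_left
  set M := smoothFrameMatrix E hVo hVS with hM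
  refine ⟨V, hVo, ⟨mem_chart_source E 1, by simp [frameMatrix_one]⟩, hVS,
    fun i j => M.det.1⁻¹ * (M.adjugate i j).1, fun i j => mul_mem (inv_mem_smoothOn M.det.2 ?_)
      (M.adjugate i j).2, fun i h hh x hx => ?_⟩
  · intro x hx
    rw [hdet]
    exact hx.2
  · have hx2 : (frameMatrix E x).det ≠ 0 := hx.2
    have hadj : ∀ j, (M.adjugate i j).1 x = (frameMatrix E x).adjugate i j := by
      intro j
      rw [← smoothFrameMatrix_map hVo hVS x]
      exact congrFun (congrFun (RingHom.map_adjugate (smoothOnEval V x) M) i) j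
    have hL : (fun j => leftDeriv (lieBasis E G j) h x) =
        (frameMatrix E x).mulVec fun i => coordDeriv 1 (Module.finBasis ℝ E i) h x := by
      funext j
      exact leftDeriv_eq_sum_coordDeriv hVo hVS hh hx _
    have h₃ := congrArg ((frameMatrix E x).adjugate.mulVec) hL
    rw [Matrix.mulVec_mulVec, Matrix.adjugate_mul, Matrix.smul_mulVec, Matrix.one_mulVec] at h₃
    have h₄ := congrFun h₃ i
    simp only [Pi.mul_apply, Pi.inv_apply, hadj, mul_assoc]
    rw [← Finset.mul_sum, hdet, eq_inv_mul_iff_mul_eq₀ hx2]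
    exact h₄.symm

/-- The left invariant differential operators are generated by the left invariant vector fields. -/
theorem mem_invDiffOps_iff {D : Op E G} : D ∈ invDiffOps E G ↔ D ∈ envAlg E G := by
  have := isManifold_of_lieGroup (E := E) (G := G)
  refine ⟨fun hD => ?_, fun hD => ⟨isDifferentialOperator_of_mem_envAlg hD,
    envAlg_commute_leftTranslate hD⟩⟩
  obtain ⟨V, hV, h1V, hVs, η, hη, h⟩ := exists_coordDeriv_eq_sum_leftDeriv (E := E) (G := G)
  -- At the identity the smooth coefficients can be frozen to constants, which leaves an element of
  -- `envAlg`.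
  have key : ∀ (k : ℕ) (w : Fin k → Fin (Module.finrank ℝ E)), ∃ u ∈ envAlg E G,
      ∀ f : SmoothFun E G, iteratedFDeriv ℝ k (f.1 ∘ (chartAt E (1 : G)).symm) (chartAt E (1 : G) 1)
        (fun i => Module.finBasis ℝ E (w i)) = (u f).1 1 := by
    intro k w
    obtain ⟨c, -, hc⟩ := exists_wordOp_eq_sum (V := V) (E := E)
      (A := fun i => coordDeriv 1 (Module.finBasis ℝ E i))
      (B := fun j => leftDeriv (lieBasis E G j)) (fun j => isDerivOn_leftDeriv _ hV) η hη h
      (List.ofFn w)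
    refine ⟨∑ k ∈ Finset.range ((List.ofFn w).length + 1),
      ∑ w : Fin k → Fin (Module.finrank ℝ E),
        c k w 1 • ((List.ofFn w).map fun i => leftVF (lieBasis E G i)).prod, ?_, fun f => ?_⟩
    · refine sum_mem fun k _ => sum_mem fun w _ => Subalgebra.smul_mem _ (list_prod_mem ?_) _
      intro D hD
      obtain ⟨i, -, rfl⟩ := List.mem_map.1 hD
      exact leftVF_mem_envAlg _
    · rw [← wordOp_coordDeriv hV hVs _ (smoothFun_mem_smoothOn f V) k w 1 h1V,
        hc f.1 (smoothFun_mem_smoothOn f V) 1 h1V]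
      simp only [← prod_leftVF_apply]
      simp [LinearMap.sum_apply]
  choose u hu huf using key
  obtain ⟨N, a, U, hU, -, -, hDf⟩ := hD.1 1
  -- The local expression of `D` is needed only at `1`, since left invariant operators are
  -- determined by their values there.
  have hDu : D = ∑ k ∈ Finset.range (N + 1), ∑ w : Fin k → Fin (Module.finrank ℝ E),
      a k w 1 • u k w := by
    have hmem : (∑ k ∈ Finset.range (N + 1), ∑ w : Fin k → Fin (Module.finrank ℝ E),
      a k w 1 • u k w) ∈ envAlg E G :=
      sum_mem fun k _ => sum_mem fun w _ => Subalgebra.smul_mem _ (hu k w) _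
    refine op_ext_at_one hD.2 (envAlg_commute_leftTranslate hmem) fun f => ?_
    rw [hDf f 1 (mem_of_mem_nhds hU)]
    simp [LinearMap.sum_apply, huf]
  rw [hDu]
  exact sum_mem fun k _ => sum_mem fun w _ => Subalgebra.smul_mem _ (hu k w) _

/-- Any linear form on the Lie algebra is the differential at the identity of a smooth function
vanishing at the identity. -/
theorem exists_smoothFun_leftVF (L : GroupLieAlgebra 𝓘(ℝ, E) G →ₗ[ℝ] ℝ) : ∃ f : SmoothFun E G,
    f.1 1 = 0 ∧ ∀ Y, (leftVF Y f).1 1 = (L Y : ℂ) := by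
  have := isManifold_of_lieGroup (E := E) (G := G)
  set L' : E →L[ℝ] ℂ :=
    Complex.ofRealCLM ∘L LinearMap.toContinuousLinearMap (L : E →ₗ[ℝ] ℝ) with hL'
  set h : G → ℂ := fun x => L' (chartAt E (1 : G) x) - L' (chartAt E (1 : G) 1)
  have hh : h ∈ smoothOn E (chartAt E (1 : G)).source :=
    sub_mem (L'.contMDiff.comp_contMDiffOn (contMDiffOn_chart (I := 𝓘(ℝ, E)) (x := (1 : G))))
      ((smoothOn E _).algebraMap_mem (L' (chartAt E (1 : G) 1)))
  obtain ⟨f, hf⟩ := exists_smoothFun_eventuallyEq (E := E) (chartAt E (1 : G)).open_source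
    (mem_chart_source E (1 : G)) hh
  refine ⟨f, by simp [hf.eq_of_nhds, h], fun Y => ?_⟩
  rw [leftVF_apply, leftDeriv_congr Y hf, leftDeriv, leftField_one]
  have hd : DifferentiableAt ℝ (fun y => L' y - L' (chartAt E (1 : G) 1)) (chartAt E (1 : G) 1) :=
    L'.differentiableAt.sub_const _
  have h₁ := diffAt_comp_chart (E := E) (x₀ := (1 : G)) (mem_chart_source E (1 : G)) hd
  rw [fderiv_sub_const, L'.fderiv] at h₁
  change diffAt (E := E) ((fun y => L' y - L' (chartAt E (1 : G) 1)) ∘ chartAt E (1 : G)) 1 _ = _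
  rw [h₁]
  have h₂ : chartDeriv (E := E) (1 : G) 1 Y = Y := mfderiv_chartAt_self_apply 1 _
  exact congrArg L' h₂

/-- For every coordinate form some smooth function has it as differential at the identity. -/
theorem leftVF_injective : Function.Injective (leftVF : GroupLieAlgebra 𝓘(ℝ, E) G → Op E G) := by
  intro X Y h
  rw [← sub_eq_zero, ← (lieBasis E G).forall_coord_eq_zero_iff]
  intro i
  obtain ⟨f, -, hf⟩ := exists_smoothFun_leftVF ((lieBasis E G).coord i)
  have h₁ := hf (X - Y)
  have h₀ : leftVF (X - Y) = 0 := (leftVF_sub X Y).trans (sub_eq_zero_of_eq h)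
  rw [h₀] at h₁
  have h₂ : (0 : ℂ) = ((lieBasis E G).coord i (X - Y) : ℝ) := h₁
  exact_mod_cast h₂.symm

end Lie
end InvDiffOp

namespace InvDiffOp

variable {E : Type*} [NormedAddCommGroup E] [NormedSpace ℝ E]
  {G : Type*} [TopologicalSpace G] [ChartedSpace E G] [Group G]

/-! ### Brackets of left invariant vector fields and the derivative of the adjoint action -/

section Calculus
variable {E : Type*} [NormedAddCommGroup E] [NormedSpace ℝ E]

theorem fderiv_fderiv_comp_inr {κ : E × E → ℂ} {a b : E}
    (h : DifferentiableAt ℝ (fderiv ℝ κ) (a, b)) (u : E × E) (v : E) :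
    fderiv ℝ (fun y => fderiv ℝ κ (a, y) u) b v = fderiv ℝ (fderiv ℝ κ) (a, b) (0, v) u := by
  have h₁ := (h.hasFDerivAt.comp b (hasFDerivAt_prodMk_right a b)).clm_apply (hasFDerivAt_const u b)
  simp only [Function.comp_apply] at h₁
  rw [h₁.fderiv]
  simp

theorem fderiv_fderiv_comp_inl {κ : E × E → ℂ} {a b : E}
    (h : DifferentiableAt ℝ (fderiv ℝ κ) (a, b)) (u : E × E) (v : E) :
    fderiv ℝ (fun y => fderiv ℝ κ (y, b) u) a v = fderiv ℝ (fderiv ℝ κ) (a, b) (v, 0) u := by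
  have h₁ := (HasFDerivAt.comp (f := fun y => (y, b)) a h.hasFDerivAt
    (hasFDerivAt_prodMk_left a b)).clm_apply (hasFDerivAt_const u a)
  simp only [Function.comp_apply] at h₁
  rw [h₁.fderiv]
  simp

end Calculus

section Lie
variable [LieGroup 𝓘(ℝ, E) ∞ G]

/-- The value is the differential at the fixed point `1` of `x ↦ f (p.1 * x * p.2)`, a family smooth
in `p`. The coordinate changes that appear are trivial because the base point does not move and the
target is a vector space. -/
theorem contMDiff_leftVF_rightTranslate (f : SmoothFun E G) (Y : GroupLieAlgebra 𝓘(ℝ, E) G) :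
    ContMDiff (𝓘(ℝ, E).prod 𝓘(ℝ, E)) 𝓘(ℝ, ℂ) ∞
      fun p : G × G => (leftVF Y (rightTranslate p.2 f)).1 p.1 := by
  have e : (fun p : G × G => (leftVF Y (rightTranslate p.2 f)).1 p.1) =
      fun p : G × G => (mfderiv 𝓘(ℝ, E) 𝓘(ℝ, ℂ) (fun x => f.1 (p.1 * x * p.2)) 1 Y : ℂ) :=
    funext fun p => mfderiv_mulInvariantVectorField (rightTranslate p.2 f) Y p.1
  rw [e]
  intro p₀
  have hs : ContMDiff ((𝓘(ℝ, E).prod 𝓘(ℝ, E)).prod 𝓘(ℝ, E)) 𝓘(ℝ, ℂ) ∞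
      (Function.uncurry fun (p : G × G) (x : G) => f.1 (p.1 * x * p.2)) := by
    refine ContMDiff.comp (I' := 𝓘(ℝ, E)) f.2 ?_
    exact ((contMDiff_fst.comp contMDiff_fst).mul contMDiff_snd).mul
      (contMDiff_snd.comp contMDiff_fst)
  have h := ContMDiffAt.mfderiv_apply (I := 𝓘(ℝ, E)) (I' := 𝓘(ℝ, ℂ)) (J := 𝓘(ℝ, E).prod 𝓘(ℝ, E))
    (J' := 𝓘(ℝ, E).prod 𝓘(ℝ, E)) (m := ∞) (n := ∞) (x₀ := p₀)
    (fun (p : G × G) (x : G) => f.1 (p.1 * x * p.2)) (fun _ => (1 : G)) (fun p : G × G => p)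
    (fun _ => (Y : E)) hs.contMDiffAt contMDiffAt_const contMDiffAt_id contMDiffAt_const (by simp)
  refine h.congr_of_eventuallyEq (Filter.Eventually.of_forall fun p => ?_)
  have h₁ := (tangentBundleCore 𝓘(ℝ, E) G).coordChange_self (achart E (1 : G)) 1
    (mem_chart_source E _) Y
  have h₂ := inTangentCoordinates_eq (I := 𝓘(ℝ, E)) (I' := 𝓘(ℝ, ℂ)) (fun _ : G × G => (1 : G))
    (fun p => f.1 (p.1 * 1 * p.2))
    (fun p => (mfderiv 𝓘(ℝ, E) 𝓘(ℝ, ℂ) (fun x => f.1 (p.1 * x * p.2)) 1 : E →L[ℝ] ℂ))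
    (x₀ := p₀) (x := p) (mem_chart_source E _) (Set.mem_univ _)
  refine Eq.trans ?_ (congrArg (fun A : E →L[ℝ] ℂ => A Y) h₂).symm
  rw [tangentBundleCore_coordChange_model_space]
  exact (congrArg (mfderiv 𝓘(ℝ, E) 𝓘(ℝ, ℂ) (fun x => f.1 (p.1 * x * p.2)) 1 : E →L[ℝ] ℂ) h₁).symm

/-- A smooth function along an integral curve of a left invariant vector field. -/
theorem hasDerivAt_comp_integralCurve {γ : ℝ → G} {X : GroupLieAlgebra 𝓘(ℝ, E) G}
    (hγ : IsMIntegralCurve (I := 𝓘(ℝ, E)) γ (mulInvariantVectorField X)) (f : SmoothFun E G)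
    (t : ℝ) : HasDerivAt (fun t => f.1 (γ t)) ((leftVF X f).1 (γ t)) t := by
  have h₁ := (SmoothFun.mdifferentiableAt f (γ t)).hasMFDerivAt
  have h₂ := hasMFDerivAt_iff_hasFDerivAt.1 (h₁.comp t (hγ t))
  exact hasDerivAt_of_smulRight (V := E) h₂

theorem leftVF_Ad_apply_one (f : SmoothFun E G) (Y : GroupLieAlgebra 𝓘(ℝ, E) G) (g : G) :
    (leftVF (Ad g Y) f).1 1 = (leftVF Y (rightTranslate g⁻¹ f)).1 g := by
  rw [← opAd_leftVF]
  change (leftVF Y (rightTranslate g⁻¹ f)).1 (1 * g) = _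
  rw [one_mul]

/-- The derivative is moved from `g` to `1`, so that the dependence on `g` sits in `Ad g Y` and in
the right translate, ready for the Leibniz rule in `exists_bracket`. -/
theorem leftVF_eq_Ad (f : SmoothFun E G) (Y : GroupLieAlgebra 𝓘(ℝ, E) G) (g : G) :
    (leftVF Y f).1 g = (leftVF (Ad g Y) (rightTranslate g f)).1 1 := by
  have h : rightTranslate g⁻¹ (rightTranslate g f) = f := by
    ext x
    simp [rightTranslate]
  rw [leftVF_Ad_apply_one, h]

section FD
variable [FiniteDimensional ℝ E] [T2Space G]

theorem leftDeriv_one_eq_fderiv {V : Set G} (hV : IsOpen V) (h1 : (1 : G) ∈ V) {h : G → ℂ}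
    (hh : h ∈ smoothOn E V) (X : GroupLieAlgebra 𝓘(ℝ, E) G) :
    leftDeriv X h 1 = fderiv ℝ (h ∘ (chartAt E (1 : G)).symm) (chartAt E (1 : G) 1) (X : E) := by
  have := isManifold_of_lieGroup (E := E) (G := G)
  have hV' : IsOpen (V ∩ (chartAt E (1 : G)).source) := hV.inter (chartAt E (1 : G)).open_source
  have h' := diffAt_eq_fderiv (E := E) (x₀ := (1 : G)) hV' Set.inter_subset_right (x := 1)
    (hh.mono Set.inter_subset_left) ⟨h1, mem_chart_source E 1⟩
  rw [leftDeriv, leftField_one, h']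
  have h₂ : chartDeriv (E := E) (1 : G) 1 X = X := mfderiv_chartAt_self_apply 1 _
  exact congrArg (fderiv ℝ (h ∘ (chartAt E (1 : G)).symm) (chartAt E (1 : G) 1)) h₂

/-- In the chart both sides are mixed second derivatives of `(u, v) ↦ f (u v)`, taken in opposite
orders. -/
theorem leftDeriv_swap (f : SmoothFun E G) (X Y : GroupLieAlgebra 𝓘(ℝ, E) G) :
    leftDeriv X (fun g => (leftVF Y (rightTranslate g f)).1 1) 1 =
      (leftVF Y (leftVF X f)).1 1 := by
  have := isManifold_of_lieGroup (E := E) (G := G)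
  set φ := chartAt E (1 : G) with hφ
  set κ : E × E → ℂ := fun p => f.1 (φ.symm p.1 * φ.symm p.2) with hκ
  set q : E := φ 1 with hq
  have hqt : q ∈ φ.target := φ.map_source (mem_chart_source E 1)
  have hq1 : φ.symm q = 1 := φ.left_inv (mem_chart_source E 1)
  have hopen : IsOpen (φ.target ×ˢ φ.target) := φ.open_target.prod φ.open_target
  have hκs : ContDiffOn ℝ ∞ κ (φ.target ×ˢ φ.target) := by
    have hs := contMDiffOn_chart_symm (I := 𝓘(ℝ, E)) (n := ∞) (x := (1 : G))
    have h : ContMDiffOn (𝓘(ℝ, E).prod 𝓘(ℝ, E)) 𝓘(ℝ, ℂ) ∞ κ (φ.target ×ˢ φ.target) :=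
      ContMDiff.comp_contMDiffOn (I' := 𝓘(ℝ, E)) f.2
        ((hs.comp contMDiff_fst.contMDiffOn fun p hp => hp.1).mul
          (hs.comp contMDiff_snd.contMDiffOn fun p hp => hp.2))
    rw [← modelWithCornersSelf_prod, chartedSpaceSelf_prod] at h
    exact contMDiffOn_iff_contDiffOn.1 h
  have hκd : ∀ p ∈ φ.target ×ˢ φ.target, DifferentiableAt ℝ κ p := fun p hp =>
    (hκs.contDiffAt (hopen.mem_nhds hp)).differentiableAt (by simp)
  have hκ1 : ContDiffAt ℝ ∞ κ (q, q) := hκs.contDiffAt (hopen.mem_nhds ⟨hqt, hqt⟩)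
  have hκ2 : DifferentiableAt ℝ (fderiv ℝ κ) (q, q) :=
    (hκ1.fderiv_right (m := ∞) (by simp)).differentiableAt (by simp)
  have hsymm : IsSymmSndFDerivAt ℝ κ (q, q) := hκ1.isSymmSndFDerivAt (by simpa using (ENat.LEInfty.out : (2 : WithTop ℕ∞) ≤ ∞))
  have hpair1 : ∀ u v : E, HasFDerivAt (fun u : E => (u, v)) (ContinuousLinearMap.inl ℝ E E) u :=
    fun u v => hasFDerivAt_prodMk_left u v
  have hpair2 : ∀ u v : E, HasFDerivAt (fun v : E => (u, v)) (ContinuousLinearMap.inr ℝ E E) v :=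
    fun u v => hasFDerivAt_prodMk_right u v
  have hL : leftDeriv X (fun g => (leftVF Y (rightTranslate g f)).1 1) 1 =
      fderiv ℝ (fderiv ℝ κ) (q, q) ((0 : E), (X : E)) ((Y : E), (0 : E)) := by
    have hsm : (fun g => (leftVF Y (rightTranslate g f)).1 1) ∈ smoothOn E (Set.univ : Set G) :=
      ((contMDiff_leftVF_rightTranslate f Y).comp
        (contMDiff_const.prodMk contMDiff_id)).contMDiffOn
    rw [leftDeriv_one_eq_fderiv isOpen_univ (Set.mem_univ _) hsm]
    have e : (fun g => (leftVF Y (rightTranslate g f)).1 1) ∘ φ.symm =ᶠ[𝓝 q]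
        fun v => fderiv ℝ κ (q, v) ((Y : E), (0 : E)) := by
      filter_upwards [φ.open_target.mem_nhds hqt] with v hv
      have h₁ := leftDeriv_one_eq_fderiv isOpen_univ (Set.mem_univ _)
        (smoothFun_mem_smoothOn (rightTranslate (E := E) (φ.symm v) f) Set.univ) Y
      refine h₁.trans ?_
      have h₂ := (hκd (q, v) ⟨hqt, hv⟩).hasFDerivAt.comp q (hpair1 q v)
      exact congrArg (fun A : E →L[ℝ] ℂ => A (Y : E)) h₂.fderiv
    rw [e.fderiv_eq]
    exact fderiv_fderiv_comp_inr hκ2 (Y, 0) X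
  have hR : (leftVF Y (leftVF X f)).1 1 =
      fderiv ℝ (fderiv ℝ κ) (q, q) ((Y : E), (0 : E)) ((0 : E), (X : E)) := by
    have h₀ := leftDeriv_one_eq_fderiv isOpen_univ (Set.mem_univ _)
        (smoothFun_mem_smoothOn (leftVF X f) Set.univ) Y
    refine h₀.trans ?_
    have e : (leftVF X f).1 ∘ φ.symm =ᶠ[𝓝 q]
        fun u => fderiv ℝ κ (u, q) ((0 : E), (X : E)) := by
      filter_upwards [φ.open_target.mem_nhds hqt] with u hu
      have h₁ := leftDeriv_one_eq_fderiv isOpen_univ (Set.mem_univ _)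
        (smoothFun_mem_smoothOn (leftTranslate (E := E) (φ.symm u) f) Set.univ) X
      have h₁' : (leftVF X f).1 (φ.symm u) =
          leftDeriv X (leftTranslate (E := E) (φ.symm u) f).1 1 := by
        rw [leftVF_apply, leftDeriv_eq_translate, leftDeriv, leftField_one]
        rfl
      refine (h₁'.trans h₁).trans ?_
      have h₂ := (hκd (u, q) ⟨hu, hqt⟩).hasFDerivAt.comp q (hpair2 u q)
      exact congrArg (fun A : E →L[ℝ] ℂ => A (X : E)) h₂.fderiv
    rw [e.fderiv_eq]
    exact fderiv_fderiv_comp_inl hκ2 (0, X) Y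
  rw [hL, hR, hsymm.eq]

/-- Needed to see that the coordinates of the bracket, found as derivatives of complex-valued
functions, are real. -/
theorem leftDeriv_im_eq_zero {h : G → ℂ} {x : G} (hh : MDifferentiableAt 𝓘(ℝ, E) 𝓘(ℝ, ℂ) h x)
    (h0 : ∀ y, (h y).im = 0) (Y : GroupLieAlgebra 𝓘(ℝ, E) G) : (leftDeriv Y h x).im = 0 := by
  have h₁ := (Complex.imCLM.hasMFDerivAt (x := h x)).comp x hh.hasMFDerivAt
  have h₂ : Complex.imCLM ∘ h = fun _ => (0 : ℝ) := funext h0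
  rw [h₂] at h₁
  have h₃ := hasMFDerivAt_unique h₁ (hasMFDerivAt_const (I := 𝓘(ℝ, E)) (0 : ℝ) x)
  exact congrArg (fun A : E →L[ℝ] ℝ => A (leftField Y x)) h₃

variable (E) in
/-- The coordinate `a` of `Ad(g) Y`, as a smooth function of `g`. -/
theorem exists_smoothFun_Ad_coord (L : GroupLieAlgebra 𝓘(ℝ, E) G →ₗ[ℝ] ℝ)
    (Y : GroupLieAlgebra 𝓘(ℝ, E) G) : ∃ w : SmoothFun E G, ∀ g, w.1 g = (L (Ad g Y) : ℂ) := by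
  obtain ⟨f, -, hf⟩ := exists_smoothFun_leftVF L
  refine ⟨⟨fun g => (L (Ad g Y) : ℂ), ?_⟩, fun g => rfl⟩
  have e : (fun g => (L (Ad g Y) : ℂ)) =
      (fun p : G × G => (leftVF Y (rightTranslate p.2 f)).1 p.1) ∘ fun g => (g, g⁻¹) := by
    funext g
    rw [← hf, leftVF_Ad_apply_one]
    rfl
  rw [e]
  exact (contMDiff_leftVF_rightTranslate f Y).comp (contMDiff_id.prodMk (contMDiff_inv _ _))

theorem Ad_one (Y : GroupLieAlgebra 𝓘(ℝ, E) G) : Ad (1 : G) Y = Y := by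
  apply leftVF_injective
  rw [← opAd_leftVF]
  ext f x
  have h : rightTranslate (E := E) (1 : G)⁻¹ f = f := by
    ext y; simp [rightTranslate]
  change (leftVF Y (rightTranslate (1 : G)⁻¹ f)).1 (x * 1) = _
  rw [h, mul_one]

/-- The commutator of two left invariant vector fields is left invariant, and it comes from the
derivative of the adjoint action. -/
theorem exists_bracket (X Y : GroupLieAlgebra 𝓘(ℝ, E) G) : ∃ Z : GroupLieAlgebra 𝓘(ℝ, E) G,
    leftVF X * leftVF Y = leftVF Y * leftVF X + leftVF Z ∧
    ∀ γ : ℝ → G, IsExpCurve γ X → ∀ L : GroupLieAlgebra 𝓘(ℝ, E) G →ₗ[ℝ] ℝ,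
      HasDerivAt (fun t => L (Ad (γ t) Y)) (L Z) 0 := by
  choose w hw using fun a => exists_smoothFun_Ad_coord E ((lieBasis E G).coord a) Y
  -- The coordinates of the bracket are the derivatives, at `1` along `X`, of the coordinates of
  -- `Ad(g) Y`.
  set z : Fin (Module.finrank ℝ E) → ℝ := fun a => ((leftVF X (w a)).1 1).re with hz
  have hz' : ∀ a, (leftVF X (w a)).1 1 = (z a : ℂ) := by
    intro a
    apply Complex.ext
    · simp [hz]
    · have h := leftDeriv_im_eq_zero (SmoothFun.mdifferentiableAt (w a) 1)
        (fun y => by rw [hw]; exact Complex.ofReal_im _) X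
      rw [Complex.ofReal_im]
      exact h
  have hAd : ∀ g, Ad g Y = ∑ a, (lieBasis E G).coord a (Ad g Y) • lieBasis E G a := fun g =>
    ((lieBasis E G).sum_repr (Ad g Y)).symm
  refine ⟨∑ a, z a • lieBasis E G a, ?_, ?_⟩
  · refine op_ext_at_one
      (envAlg_commute_leftTranslate (mul_mem (leftVF_mem_envAlg X) (leftVF_mem_envAlg Y)))
      (envAlg_commute_leftTranslate (add_mem (mul_mem (leftVF_mem_envAlg Y) (leftVF_mem_envAlg X))
        (leftVF_mem_envAlg _))) fun f => ?_
    set K : Fin (Module.finrank ℝ E) → G → ℂ := fun a g =>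
      (leftVF (lieBasis E G a) (rightTranslate g f)).1 1 with hK
    have hKs : ∀ a, K a ∈ smoothOn E (Set.univ : Set G) := fun a =>
      ((contMDiff_leftVF_rightTranslate f (lieBasis E G a)).comp
        (contMDiff_const.prodMk contMDiff_id)).contMDiffOn
    have hK1 : ∀ a, K a 1 = (leftVF (lieBasis E G a) f).1 1 := by
      intro a
      have h : rightTranslate (E := E) (1 : G) f = f := by
        ext y; simp [rightTranslate]
      rw [hK]
      simp only [h]
    have e : (leftVF Y f).1 = ∑ a, (w a).1 * K a := by
      funext g
      rw [leftVF_eq_Ad, hAd g, leftVF_sum]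
      simp only [leftVF_smul, Finset.sum_apply, Pi.mul_apply, hw, hK, LinearMap.sum_apply,
        LinearMap.smul_apply, AddSubmonoidClass.coe_finsetSum, Submodule.coe_smul, Pi.smul_apply,
        smul_eq_mul]
    have hD := isDerivOn_leftDeriv X (isOpen_univ : IsOpen (Set.univ : Set G))
    -- Leibniz for the expansion `e`: differentiating `w a` produces the bracket, while by
    -- `leftDeriv_swap` differentiating `K a` produces the terms that add up to `Ỹ X̃ f` at `1`.
    have h₁ : (leftVF X (leftVF Y f)).1 1 =
        ∑ a, ((z a : ℂ) * K a 1 + (w a).1 1 * (leftVF (lieBasis E G a) (leftVF X f)).1 1) := by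
      rw [leftVF_apply, e, hD.sum _ _ (fun a _ => mul_mem (smoothFun_mem_smoothOn (w a) _) (hKs a))
        (Set.mem_univ 1), Finset.sum_apply]
      refine Finset.sum_congr rfl fun a _ => ?_
      rw [hD.mul _ (smoothFun_mem_smoothOn (w a) _) _ (hKs a) (Set.mem_univ 1), ← leftDeriv_swap,
        ← hz']
      rfl
    have h₂ : (leftVF Y (leftVF X f)).1 1 =
        ∑ a, (w a).1 1 * (leftVF (lieBasis E G a) (leftVF X f)).1 1 := by
      have h₃ := hAd 1
      rw [Ad_one] at h₃
      conv_lhs => rw [h₃, leftVF_sum]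
      simp only [leftVF_smul, LinearMap.sum_apply, LinearMap.smul_apply,
        AddSubmonoidClass.coe_finsetSum, Submodule.coe_smul, Finset.sum_apply, Pi.smul_apply,
        smul_eq_mul, hw, Ad_one]
    change (leftVF X (leftVF Y f)).1 1 = (leftVF Y (leftVF X f)).1 1 + _
    rw [h₁, h₂, Finset.sum_add_distrib, add_comm, leftVF_sum]
    congr 1
    simp only [leftVF_smul, LinearMap.sum_apply, LinearMap.smul_apply,
        AddSubmonoidClass.coe_finsetSum, Submodule.coe_smul, Finset.sum_apply, Pi.smul_apply,
        smul_eq_mul, hK1]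
  · intro γ hγ L
    have h₁ : ∀ a, HasDerivAt (fun t => (lieBasis E G).coord a (Ad (γ t) Y)) (z a) 0 := by
      intro a
      have h := (hasDerivAt_comp_integralCurve hγ.2 (w a) 0)
      rw [hγ.1, hz'] at h
      simp only [hw] at h
      have h' := Complex.reCLM.hasFDerivAt.comp_hasDerivAt (0 : ℝ) h
      simpa [Function.comp_def] using h'
    have h₂ : (fun t => L (Ad (γ t) Y)) = fun t =>
        ∑ a, (lieBasis E G).coord a (Ad (γ t) Y) * L (lieBasis E G a) := by
      funext t
      conv_lhs => rw [hAd (γ t), map_sum]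
      simp only [map_smul, smul_eq_mul]
    rw [h₂, map_sum]
    simp only [map_smul, smul_eq_mul]
    exact HasDerivAt.fun_sum fun a _ => (h₁ a).mul_const _

end FD
end Lie
end InvDiffOp

namespace InvDiffOp

variable {E : Type*} [NormedAddCommGroup E] [NormedSpace ℝ E]
  {G : Type*} [TopologicalSpace G] [ChartedSpace E G] [Group G]

/-! ### One-parameter subgroups -/

/-- The differential at `x` of a self-map of `G`. -/
def mapDeriv (c : G → G) (x : G) : E →L[ℝ] E := mfderiv 𝓘(ℝ, E) 𝓘(ℝ, E) c x

theorem mapDeriv_comp {c d : G → G} {x : G} (hc : MDifferentiableAt 𝓘(ℝ, E) 𝓘(ℝ, E) c (d x))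
    (hd : MDifferentiableAt 𝓘(ℝ, E) 𝓘(ℝ, E) d x) :
    mapDeriv (E := E) (fun y => c (d y)) x = mapDeriv (E := E) c (d x) ∘L mapDeriv d x :=
  mfderiv_comp x hc hd

theorem leftField_eq_mapDeriv (X : GroupLieAlgebra 𝓘(ℝ, E) G) (x : G) :
    leftField X x = mapDeriv (E := E) (fun y => x * y) 1 X := rfl

theorem isMIntegralCurve_leftField_iff {γ : ℝ → G} {X : GroupLieAlgebra 𝓘(ℝ, E) G} :
    IsMIntegralCurve (I := 𝓘(ℝ, E)) γ (mulInvariantVectorField X) ↔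
      ∀ t, HasMFDerivAt 𝓘(ℝ, ℝ) 𝓘(ℝ, E) γ t
        ((1 : ℝ →L[ℝ] ℝ).smulRight (leftField X (γ t)) : ℝ →L[ℝ] E) := Iff.rfl

section Lie
variable [LieGroup 𝓘(ℝ, E) ∞ G]

theorem mdifferentiableAt_mul_left (g x : G) :
    MDifferentiableAt 𝓘(ℝ, E) 𝓘(ℝ, E) (fun y => g * y) x :=
  (contMDiff_mul_left (I := 𝓘(ℝ, E)) (n := ∞) (a := g)).mdifferentiableAt (by simp)

theorem mdifferentiableAt_conj (g x : G) :
    MDifferentiableAt 𝓘(ℝ, E) 𝓘(ℝ, E) (fun y => g * y * g⁻¹) x :=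
  ((contMDiff_mul_right (I := 𝓘(ℝ, E)) (n := ∞) (a := g⁻¹)).comp
      (contMDiff_mul_left (I := 𝓘(ℝ, E)) (n := ∞) (a := g))).mdifferentiableAt (by simp)

theorem mapDeriv_mul_left_leftField (X : GroupLieAlgebra 𝓘(ℝ, E) G) (g x : G) :
    mapDeriv (E := E) (fun y => g * y) x (leftField X x) = leftField X (g * x) := by
  have h := mapDeriv_comp (E := E) (c := fun y => g * y) (d := fun y => x * y) (x := 1)
    (mdifferentiableAt_mul_left g _) (mdifferentiableAt_mul_left x _)
  simp only [← mul_assoc, mul_one] at h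
  rw [leftField_eq_mapDeriv, leftField_eq_mapDeriv]
  exact (congrArg (fun A : E →L[ℝ] E => A X) h).symm

/-- The map `y ↦ g (x y) g⁻¹` is differentiated at `1` in two ways: as conjugation after left
multiplication by `x`, and as left multiplication by `g x g⁻¹` after conjugation. -/
theorem mapDeriv_conj_leftField (X : GroupLieAlgebra 𝓘(ℝ, E) G) (g x : G) :
    mapDeriv (E := E) (fun y => g * y * g⁻¹) x (leftField X x) =
      leftField (Ad g X) (g * x * g⁻¹) := by
  have h₁ := mapDeriv_comp (E := E) (c := fun y => g * y * g⁻¹) (d := fun y => x * y) (x := 1)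
    (mdifferentiableAt_conj g _) (mdifferentiableAt_mul_left x _)
  have h₂ := mapDeriv_comp (E := E) (c := fun y => g * x * g⁻¹ * y) (d := fun y => g * y * g⁻¹)
    (x := 1) (mdifferentiableAt_mul_left _ _) (mdifferentiableAt_conj g _)
  have e : (fun y => g * x * g⁻¹ * (g * y * g⁻¹)) = fun y => g * (x * y) * g⁻¹ := by
    funext y
    group
  have e1 : g * 1 * g⁻¹ = 1 := by simp
  rw [e, h₁] at h₂
  rw [mul_one, e1] at h₂
  exact congrArg (fun A : E →L[ℝ] E => A X) h₂

theorem HasMFDerivAt_comp_curve {c : G → G} {γ : ℝ → G} {t : ℝ} {v : E}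
    (hc : MDifferentiableAt 𝓘(ℝ, E) 𝓘(ℝ, E) c (γ t))
    (hγ : HasMFDerivAt 𝓘(ℝ, ℝ) 𝓘(ℝ, E) γ t ((1 : ℝ →L[ℝ] ℝ).smulRight v : ℝ →L[ℝ] E)) :
    HasMFDerivAt 𝓘(ℝ, ℝ) 𝓘(ℝ, E) (fun t => c (γ t)) t
      ((1 : ℝ →L[ℝ] ℝ).smulRight (mapDeriv (E := E) c (γ t) v) : ℝ →L[ℝ] E) := by
  have h := hc.hasMFDerivAt.comp t hγ
  have e : (mapDeriv (E := E) c (γ t) ∘L ((1 : ℝ →L[ℝ] ℝ).smulRight v : ℝ →L[ℝ] E)) =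
      (1 : ℝ →L[ℝ] ℝ).smulRight (mapDeriv (E := E) c (γ t) v) := by
    ext
    simp
  rw [← e]
  exact h

theorem IsExpCurve.mul_left {γ : ℝ → G} {X : GroupLieAlgebra 𝓘(ℝ, E) G} (hγ : IsExpCurve γ X)
    (g : G) : IsMIntegralCurve (I := 𝓘(ℝ, E)) (fun t => g * γ t) (mulInvariantVectorField X) := by
  rw [isMIntegralCurve_leftField_iff]
  intro t
  have h := HasMFDerivAt_comp_curve (mdifferentiableAt_mul_left g (γ t))
    (isMIntegralCurve_leftField_iff.1 hγ.2 t)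
  rw [mapDeriv_mul_left_leftField] at h
  exact h

theorem IsExpCurve.conj {γ : ℝ → G} {X : GroupLieAlgebra 𝓘(ℝ, E) G} (hγ : IsExpCurve γ X)
    (g : G) : IsExpCurve (fun t => g * γ t * g⁻¹) (Ad g X) := by
  refine ⟨by simp [hγ.1], ?_⟩
  rw [isMIntegralCurve_leftField_iff]
  intro t
  have h := HasMFDerivAt_comp_curve (mdifferentiableAt_conj g (γ t))
    (isMIntegralCurve_leftField_iff.1 hγ.2 t)
  rw [mapDeriv_conj_leftField] at h
  exact h

theorem IsExpCurve.smul {γ : ℝ → G} {X : GroupLieAlgebra 𝓘(ℝ, E) G} (hγ : IsExpCurve γ X)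
    (a : ℝ) : IsExpCurve (fun t => γ (t * a)) (a • X) := by
  refine ⟨by simp [hγ.1], ?_⟩
  rw [mulInvariantVectorField_smul]
  exact hγ.2.comp_mul a

theorem IsExpCurve.continuous {γ : ℝ → G} {X : GroupLieAlgebra 𝓘(ℝ, E) G} (hγ : IsExpCurve γ X) :
    Continuous γ :=
  continuous_iff_continuousAt.2 fun t => (hγ.2 t).continuousAt

/-! ### Velocities and powers in the chart at the identity. -/

section FD
variable [FiniteDimensional ℝ E] [T2Space G]

/-- Uniqueness of integral curves: as functions of `t` both sides follow the same field and start at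
`γ s`. -/
theorem IsExpCurve.add {γ : ℝ → G} {X : GroupLieAlgebra 𝓘(ℝ, E) G} (hγ : IsExpCurve γ X)
    (s t : ℝ) : γ (s + t) = γ s * γ t := by
  have := isManifold_of_lieGroup (E := E) (G := G)
  have hM : IsManifold 𝓘(ℝ, E) 1 G := IsManifold.of_le (n := ∞) (by simp)
  have hL : LieGroup 𝓘(ℝ, E) (minSmoothness ℝ 3) G :=
    LieGroup.of_le (n := ∞) (by simpa using (ENat.LEInfty.out : (3 : WithTop ℕ∞) ≤ ∞))
  have h₁ : IsMIntegralCurve (I := 𝓘(ℝ, E)) (γ ∘ (· + s)) (mulInvariantVectorField X) :=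
    hγ.2.comp_add s
  have hv : ContMDiff 𝓘(ℝ, E) 𝓘(ℝ, E).tangent 1
      (fun g : G => (⟨g, mulInvariantVectorField X g⟩ : TangentBundle 𝓘(ℝ, E) G)) :=
    (contMDiff_mulInvariantVectorField X).of_le (by simp)
  have h₂ := isMIntegralCurve_Ioo_eq_of_contMDiff_boundaryless (t₀ := 0) hv h₁ (hγ.mul_left (γ s))
    (by simp [hγ.1])
  have h₃ := congrFun h₂ t
  simpa [add_comm] using h₃

/-- In the chart at the identity, a one-parameter subgroup has the expected initial velocity. -/
theorem IsExpCurve.hasDerivAt_chart {γ : ℝ → G} {X : GroupLieAlgebra 𝓘(ℝ, E) G}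
    (hγ : IsExpCurve γ X) : HasDerivAt (fun t => chartAt E (1 : G) (γ t)) (X : E) 0 := by
  have := isManifold_of_lieGroup (E := E) (G := G)
  have hc : MDifferentiableAt 𝓘(ℝ, E) 𝓘(ℝ, E) (chartAt E (1 : G)) (γ 0) := by
    rw [hγ.1]
    exact mdifferentiableAt_atlas (ChartedSpace.chart_mem_atlas _) (mem_chart_source E 1)
  have h₁ := hasMFDerivAt_iff_hasFDerivAt.1 (hc.hasMFDerivAt.comp (0 : ℝ) (hγ.2 0))
  have h₂ : HasFDerivAt (fun t => chartAt E (1 : G) (γ t)) (chartDeriv (E := E) (1 : G) (γ 0) ∘L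
    (1 : ℝ →L[ℝ] ℝ).smulRight (leftField X (γ 0))) 0 := h₁
  have h₃ := h₂.hasDerivAt
  rw [hγ.1, leftField_one] at h₃
  refine h₃.congr_deriv ?_
  have h₄ : chartDeriv (E := E) (1 : G) 1 X = X := mfderiv_chartAt_self_apply 1 _
  refine Eq.trans ?_ h₄
  refine (congrArg (chartDeriv (E := E) (1 : G) 1) ?_)
  exact one_smul ℝ (X : E)

variable (E G) in
/-- Multiplication in the chart at the identity. -/
def chartMul (p : E × E) : E :=
  chartAt E (1 : G) ((chartAt E (1 : G)).symm p.1 * (chartAt E (1 : G)).symm p.2)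

variable (E G) in
theorem contDiffAt_chartMul :
    ContDiffAt ℝ 1 (chartMul E G) (chartAt E (1 : G) 1, chartAt E (1 : G) 1) := by
  have := isManifold_of_lieGroup (E := E) (G := G)
  set φ := chartAt E (1 : G) with hφ
  have hqt : φ 1 ∈ φ.target := φ.map_source (mem_chart_source E 1)
  have hq1 : φ.symm (φ 1) = 1 := φ.left_inv (mem_chart_source E 1)
  have hs : ContMDiffAt 𝓘(ℝ, E) 𝓘(ℝ, E) ∞ φ.symm (φ 1) :=
    (contMDiffOn_chart_symm (I := 𝓘(ℝ, E)) (n := ∞) (x := (1 : G))).contMDiffAt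
      (φ.open_target.mem_nhds hqt)
  have hc : ContMDiffAt 𝓘(ℝ, E) 𝓘(ℝ, E) ∞ φ
      (φ.symm (φ 1, φ 1).1 * φ.symm (φ 1, φ 1).2) := by
    simp only [hq1, mul_one]
    exact (contMDiffOn_chart (I := 𝓘(ℝ, E)) (n := ∞) (x := (1 : G))).contMDiffAt
      (φ.open_source.mem_nhds (mem_chart_source E 1))
  have h1 : ContMDiffAt (𝓘(ℝ, E).prod 𝓘(ℝ, E)) 𝓘(ℝ, E) ∞
      (fun p : E × E => φ.symm p.1 * φ.symm p.2) (φ 1, φ 1) :=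
    (hs.comp (φ 1, φ 1) contMDiffAt_fst).mul (hs.comp (φ 1, φ 1) contMDiffAt_snd)
  have h : ContMDiffAt (𝓘(ℝ, E).prod 𝓘(ℝ, E)) 𝓘(ℝ, E) ∞ (chartMul E G) (φ 1, φ 1) :=
    hc.comp (φ 1, φ 1) h1
  rw [← modelWithCornersSelf_prod, chartedSpaceSelf_prod] at h
  exact (contMDiffAt_iff_contDiffAt.1 h).of_le (by simp)

theorem chartMul_left {u : E} (hu : u ∈ (chartAt E (1 : G)).target) :
    chartMul E G (u, chartAt E (1 : G) 1) = u := by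
  simp [chartMul, (chartAt E (1 : G)).left_inv (mem_chart_source E 1),
    (chartAt E (1 : G)).right_inv hu]

theorem chartMul_right {u : E} (hu : u ∈ (chartAt E (1 : G)).target) :
    chartMul E G (chartAt E (1 : G) 1, u) = u := by
  simp [chartMul, (chartAt E (1 : G)).left_inv (mem_chart_source E 1),
    (chartAt E (1 : G)).right_inv hu]

/-- A curve through the identity with velocity `X`, in the chart at the identity. -/
structure HasVelocity (β : ℝ → G) (X : E) : Prop where
  zero : β 0 = 1
  continuousAt : ContinuousAt β 0
  hasDerivAt : HasDerivAt (fun t => chartAt E (1 : G) (β t)) X 0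

/-- On each of the two axes through the identity `chartMul` is the identity map, so its differential
there is addition of vectors. -/
theorem HasVelocity.mul {β β' : ℝ → G} {X X' : E} (h : HasVelocity β X) (h' : HasVelocity β' X') :
    HasVelocity (fun t => β t * β' t) (X + X') := by
  have hG : IsTopologicalGroup G := topologicalGroup_of_lieGroup 𝓘(ℝ, E) ∞
  set φ := chartAt E (1 : G) with hφ
  have hqt : φ 1 ∈ φ.target := φ.map_source (mem_chart_source E 1)
  have hd := ((contDiffAt_chartMul E G).differentiableAt (by simp)).hasFDerivAt
  have hl : HasFDerivAt (fun u => chartMul E G (u, φ 1)) (ContinuousLinearMap.id ℝ E) (φ 1) :=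
    (hasFDerivAt_id (φ 1)).congr_of_eventuallyEq
      (by filter_upwards [φ.open_target.mem_nhds hqt] with u hu using chartMul_left hu)
  have hr : HasFDerivAt (fun u => chartMul E G (φ 1, u)) (ContinuousLinearMap.id ℝ E) (φ 1) :=
    (hasFDerivAt_id (φ 1)).congr_of_eventuallyEq
      (by filter_upwards [φ.open_target.mem_nhds hqt] with u hu using chartMul_right hu)
  have hl' := hl.unique (HasFDerivAt.comp (f := fun u => (u, φ 1)) (φ 1) hd
    (hasFDerivAt_prodMk_left (φ 1) (φ 1)))
  have hr' := hr.unique (HasFDerivAt.comp (f := fun u => (φ 1, u)) (φ 1) hd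
    (hasFDerivAt_prodMk_right (φ 1) (φ 1)))
  refine ⟨by simp [h.zero, h'.zero], h.continuousAt.mul h'.continuousAt, ?_⟩
  have hd' : HasFDerivAt (chartMul E G) (fderiv ℝ (chartMul E G) (φ 1, φ 1))
      (φ (β 0), φ (β' 0)) := by
    rw [h.zero, h'.zero]
    exact hd
  have hp := hd'.comp_hasDerivAt (0 : ℝ) (h.hasDerivAt.prodMk h'.hasDerivAt)
  have e : fderiv ℝ (chartMul E G) (φ 1, φ 1) (X, X') = X + X' := by
    have h₁ := congrArg (fun A : E →L[ℝ] E => A X) hl'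
    have h₂ := congrArg (fun A : E →L[ℝ] E => A X') hr'
    simp only [ContinuousLinearMap.id_apply, ContinuousLinearMap.comp_apply,
      ContinuousLinearMap.inl_apply, ContinuousLinearMap.inr_apply] at h₁ h₂
    conv_rhs => rw [h₁, h₂, ← map_add]
    simp [hφ]
  rw [e] at hp
  refine hp.congr_of_eventuallyEq ?_
  have hs : φ.source ∈ 𝓝 (1 : G) := φ.open_source.mem_nhds (mem_chart_source E 1)
  have ev := h.continuousAt.eventually_mem (by rw [h.zero]; exact hs)
  have ev' := h'.continuousAt.eventually_mem (by rw [h'.zero]; exact hs)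
  filter_upwards [ev, ev'] with t ht ht'
  simp only [Function.comp_apply, chartMul]
  rw [← hφ, φ.left_inv ht, φ.left_inv ht']

theorem hasVelocity_one : HasVelocity (fun _ : ℝ => (1 : G)) (0 : E) :=
  ⟨rfl, continuousAt_const, hasDerivAt_const _ _⟩

theorem IsExpCurve.hasVelocity {γ : ℝ → G} {X : GroupLieAlgebra 𝓘(ℝ, E) G} (hγ : IsExpCurve γ X) :
    HasVelocity (E := E) γ X :=
  ⟨hγ.1, hγ.continuous.continuousAt, hγ.hasDerivAt_chart⟩

theorem hasVelocity_list_prod {ι : Type*} (γ : ι → ℝ → G) (X : ι → E)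
    (h : ∀ i, HasVelocity (γ i) (X i)) (l : List ι) :
    HasVelocity (fun t => (l.map fun i => γ i t).prod) (l.map X).sum := by
  induction l with
  | nil => exact hasVelocity_one
  | cons a l ih => simpa using (h a).mul ih

variable (E G) in
/-- Powers of small elements grow at most linearly in the chart at the identity. -/
theorem exists_norm_chart_pow_le : ∃ K > 0, ∃ δ > 0,
    Metric.ball (chartAt E (1 : G) 1) δ ⊆ (chartAt E (1 : G)).target ∧
    ∀ x ∈ (chartAt E (1 : G)).source, ∀ n : ℕ,
      n * K * ‖chartAt E (1 : G) x - chartAt E (1 : G) 1‖ < δ → ∀ k ≤ n,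
        x ^ k ∈ (chartAt E (1 : G)).source ∧
        ‖chartAt E (1 : G) (x ^ k) - chartAt E (1 : G) 1‖ ≤
          k * K * ‖chartAt E (1 : G) x - chartAt E (1 : G) 1‖ := by
  have hG : IsTopologicalGroup G := topologicalGroup_of_lieGroup 𝓘(ℝ, E) ∞
  set φ := chartAt E (1 : G) with hφ
  have hqt : φ 1 ∈ φ.target := φ.map_source (mem_chart_source E 1)
  have hq1 : φ.symm (φ 1) = 1 := φ.left_inv (mem_chart_source E 1)
  obtain ⟨K₀, W, hW, hLip⟩ := (contDiffAt_chartMul E G).exists_lipschitzOnWith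
  have hcs : ContinuousAt φ.symm (φ 1) := φ.continuousAt_symm hqt
  have hsrc : {p : E × E | φ.symm p.1 * φ.symm p.2 ∈ φ.source} ∈ 𝓝 (φ 1, φ 1) := by
    have hc : ContinuousAt (fun p : E × E => φ.symm p.1 * φ.symm p.2) (φ 1, φ 1) :=
      (ContinuousAt.comp (f := Prod.fst) (x := (φ 1, φ 1)) hcs continuousAt_fst).mul
        (ContinuousAt.comp (f := Prod.snd) (x := (φ 1, φ 1)) hcs continuousAt_snd)
    refine hc.preimage_mem_nhds (φ.open_source.mem_nhds ?_)
    simp [hφ]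
  obtain ⟨δ₁, hδ₁, hball⟩ := Metric.mem_nhds_iff.1 (Filter.inter_mem hW hsrc)
  obtain ⟨δ₂, hδ₂, hball₂⟩ := Metric.mem_nhds_iff.1 (φ.open_target.mem_nhds hqt)
  -- The constant must dominate the Lipschitz constant and also be at least `1`, so that the bound
  -- on `x ^ (k + 1)` keeps `x` itself in the ball.
  refine ⟨max K₀ 1, lt_max_of_lt_right one_pos, min δ₁ δ₂, lt_min hδ₁ hδ₂,
    (Metric.ball_subset_ball (min_le_right _ _)).trans hball₂, fun x hx n hn => ?_⟩
  set K : ℝ := max K₀ 1 with hK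
  have hK1 : 1 ≤ K := le_max_right _ _
  set ρ := ‖φ x - φ 1‖ with hρ
  have hρ0 : 0 ≤ ρ := norm_nonneg _
  intro k
  induction k with
  | zero => intro _; simp [hφ]
  | succ k ih =>
    intro hk
    obtain ⟨h₁, h₂⟩ := ih (by omega)
    have hkn : ((k : ℝ) + 1) ≤ n := by exact_mod_cast hk
    have hle : ((k : ℝ) + 1) * K * ρ ≤ n * K * ρ := by gcongr
    have hu : ‖φ (x ^ k) - φ 1‖ < δ₁ := by
      refine (h₂.trans ?_).trans_lt (hn.trans_le (min_le_left _ _))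
      refine le_trans ?_ hle
      gcongr
      linarith
    have hv : ρ < δ₁ := by
      refine lt_of_le_of_lt ?_ (hn.trans_le (min_le_left _ _))
      refine le_trans ?_ hle
      have : (1 : ℝ) ≤ ((k : ℝ) + 1) * K := by
        have := Nat.cast_nonneg (α := ℝ) k
        nlinarith
      nlinarith
    have hm : (φ (x ^ k), φ x) ∈ Metric.ball (φ 1, φ 1) δ₁ := by
      rw [Metric.mem_ball, Prod.dist_eq, dist_eq_norm, dist_eq_norm]
      exact max_lt hu hv
    have hm' : (φ (x ^ k), φ 1) ∈ Metric.ball (φ 1, φ 1) δ₁ := by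
      rw [Metric.mem_ball, Prod.dist_eq, dist_eq_norm, dist_self]
      exact max_lt hu hδ₁
    have hx' := (hball hm).2
    simp only [Set.mem_ofPred_eq, φ.left_inv h₁, φ.left_inv hx, ← pow_succ] at hx'
    refine ⟨hx', ?_⟩
    -- The products `x ^ k * x` and `x ^ k * 1` are compared, so one more factor moves the point by
    -- at most `K₀ * ρ`.
    have hL := hLip.dist_le_mul _ (hball hm).1 _ (hball hm').1
    rw [chartMul_left (φ.map_source h₁)] at hL
    simp only [chartMul] at hL
    rw [← hφ, φ.left_inv h₁, φ.left_inv hx, ← pow_succ, dist_eq_norm, Prod.dist_eq, dist_self,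
      dist_eq_norm, max_eq_right hρ0] at hL
    calc ‖φ (x ^ (k + 1)) - φ 1‖
        ≤ ‖φ (x ^ (k + 1)) - φ (x ^ k)‖ + ‖φ (x ^ k) - φ 1‖ := norm_sub_le_norm_sub_add_norm_sub _ _ _
      _ ≤ K₀ * ρ + k * K * ρ := add_le_add hL h₂
      _ ≤ K * ρ + k * K * ρ := by gcongr; exact le_max_left _ _
      _ = ((k + 1 : ℕ) : ℝ) * K * ρ := by push_cast; ring

/-- For a curve with zero velocity, `β(s/n)ⁿ` tends to the identity. -/
theorem HasVelocity.tendsto_pow {β : ℝ → G} (h : HasVelocity β (0 : E)) (s : ℝ) :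
    Filter.Tendsto (fun n : ℕ => β (s / n) ^ n) Filter.atTop (𝓝 1) := by
  set φ := chartAt E (1 : G) with hφ
  obtain ⟨K, hK, δ, hδ, hball, hpow⟩ := exists_norm_chart_pow_le E G
  have hs0 : Filter.Tendsto (fun n : ℕ => s / n) Filter.atTop (𝓝 0) :=
    tendsto_const_div_atTop_nhds_zero_nat s
  -- Zero velocity makes the displacement of `β (s / n)` of size `o(1/n)`, so `n` factors together
  -- contribute `o(1)`.
  have ho : Filter.Tendsto (fun n : ℕ => (n : ℝ) * K * ‖φ (β (s / n)) - φ 1‖) Filter.atTop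
      (𝓝 0) := by
    have h₁ := (hasDerivAt_iff_isLittleO_nhds_zero.1 h.hasDerivAt).comp_tendsto hs0
    simp only [zero_add, smul_zero, sub_zero, h.zero, Function.comp_def] at h₁
    have h₂ : (fun n : ℕ => (n : ℝ)⁻¹ * s) =O[Filter.atTop] fun n : ℕ => (n : ℝ)⁻¹ := by
      simpa [mul_comm] using
        Asymptotics.isBigO_const_mul_self s (fun n : ℕ => (n : ℝ)⁻¹) Filter.atTop
    have h₃ : (fun n : ℕ => φ (β (s / n)) - φ 1) =o[Filter.atTop] fun n : ℕ => (n : ℝ)⁻¹ := by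
      refine h₁.trans_isBigO ?_
      simpa [div_eq_inv_mul] using h₂
    have h₄ := (h₃.norm_left.tendsto_div_nhds_zero).const_mul K
    simp only [mul_zero, div_inv_eq_mul] at h₄
    refine h₄.congr fun n => by ring
  have hsrc : ∀ᶠ n : ℕ in Filter.atTop, β (s / n) ∈ φ.source :=
    (h.continuousAt.tendsto.comp hs0).eventually_mem
      (by rw [h.zero]; exact φ.open_source.mem_nhds (mem_chart_source E 1))
  have hsmall := ho.eventually_lt_const hδ
  have hmem : ∀ᶠ n : ℕ in Filter.atTop, β (s / n) ^ n ∈ φ.source := by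
    filter_upwards [hsrc, hsmall] with n h₁ h₂ using (hpow _ h₁ n h₂ n le_rfl).1
  have hφt : Filter.Tendsto (fun n : ℕ => φ (β (s / n) ^ n)) Filter.atTop (𝓝 (φ 1)) := by
    rw [tendsto_iff_norm_sub_tendsto_zero]
    refine squeeze_zero' (Filter.Eventually.of_forall fun n => norm_nonneg _) ?_ ho
    filter_upwards [hsrc, hsmall] with n h₁ h₂ using (hpow _ h₁ n h₂ n le_rfl).2
  have hcs : ContinuousAt φ.symm (φ 1) :=
    φ.continuousAt_symm (φ.map_source (mem_chart_source E 1))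
  have h₅ := hcs.tendsto.comp hφt
  rw [φ.left_inv (mem_chart_source E 1)] at h₅
  refine h₅.congr' ?_
  filter_upwards [hmem] with n hn using φ.left_inv hn

end FD
end Lie
end InvDiffOp

namespace InvDiffOp

/-! ### The differential of a character -/

/-- A continuous function on the line turning sums into products is an exponential. -/
theorem exists_eq_exp_of_add_eq_mul {u : ℝ → ℂ} (hc : Continuous u) (h0 : u 0 = 1)
    (hadd : ∀ s t, u (s + t) = u s * u t) : ∃ c : ℂ, ∀ t : ℝ, u t = Complex.exp (t * c) := by
  set U : ℝ → ℂ := fun t => ∫ x in (0 : ℝ)..t, u x with hU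
  have hUd : ∀ t, HasDerivAt U (u t) t := fun t => hc.integral_hasStrictDerivAt 0 t |>.hasDerivAt
  -- The primitive `U` has derivative `u 0 = 1` at `0`, so it is not identically zero.
  obtain ⟨a, ha⟩ : ∃ a, U a ≠ 0 := by
    by_contra! hne
    have h₁ : U = fun _ => 0 := funext hne
    have h₂ := hUd 0
    rw [h₁] at h₂
    have := h₂.unique (hasDerivAt_const _ _)
    rw [h0] at this
    exact one_ne_zero this
  -- Integrating `u (t + x) = u t * u x` over `[0, a]` expresses `u` through the differentiable
  -- function `U`.
  have hshift : ∀ t, u t * U a = U (t + a) - U t := by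
    intro t
    have h₁ : u t * U a = ∫ x in (0 : ℝ)..a, u (t + x) := by
      simp only [hadd, hU, intervalIntegral.integral_const_mul]
    rw [h₁, intervalIntegral.integral_comp_add_left (fun x => u x) t, add_zero]
    exact (intervalIntegral.integral_interval_sub_left (hc.intervalIntegrable _ _)
      (hc.intervalIntegrable _ _)).symm
  have hud : ∀ t, DifferentiableAt ℝ u t := by
    intro t
    have e : u = fun t => (U (t + a) - U t) * (U a)⁻¹ := by
      funext t
      rw [← hshift, mul_assoc, mul_inv_cancel₀ ha, mul_one]
    rw [e]
    have h₁ : DifferentiableAt ℝ (fun t => U (t + a)) t :=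
      ((hUd (t + a)).comp_add_const t a).differentiableAt
    exact (h₁.sub (hUd t).differentiableAt).mul_const _
  set c := deriv u 0 with hcdef
  have hder : ∀ t, HasDerivAt u (u t * c) t := by
    intro t
    have h₁ : HasDerivAt (fun x => u (x - t)) c t := by
      have h := (hud (t - t)).hasDerivAt.comp_sub_const t t
      simpa [hcdef] using h
    have h₂ := h₁.const_mul (u t)
    refine h₂.congr_of_eventuallyEq (Filter.Eventually.of_forall fun x => ?_)
    simp only [← hadd]
    congr 1
    ring
  refine ⟨c, ?_⟩
  have hexp : ∀ t : ℝ, HasDerivAt (fun t : ℝ => Complex.exp (-(t * c)))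
      (Complex.exp (-(t * c)) * (-c)) t := by
    intro t
    have h₁ : HasDerivAt (fun t : ℝ => -((t : ℂ) * c)) (-c) t := by
      simpa using ((Complex.ofRealCLM.hasDerivAt (x := t)).mul_const c).fun_neg
    exact h₁.cexp
  have hprod : ∀ t : ℝ, HasDerivAt (fun t : ℝ => u t * Complex.exp (-(t * c))) 0 t := by
    intro t
    refine ((hder t).mul (hexp t)).congr_deriv ?_
    ring
  intro t
  have hconst := is_const_of_deriv_eq_zero (fun t => (hprod t).differentiableAt)
    (fun t => (hprod t).deriv) t 0
  simp only [h0, Complex.ofReal_zero, zero_mul, neg_zero, Complex.exp_zero, mul_one] at hconst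
  rw [Complex.exp_neg, mul_inv_eq_one₀ (Complex.exp_ne_zero _)] at hconst
  exact hconst

theorem eq_zero_of_exp_eq_one {c : ℂ} (h : ∀ s : ℝ, Complex.exp (s * c) = 1) : c = 0 := by
  have h₁ : HasDerivAt (fun s : ℝ => Complex.exp (s * c)) (Complex.exp ((0 : ℝ) * c) * c) 0 := by
    have h₁ : HasDerivAt (fun t : ℝ => (t : ℂ) * c) c 0 := by
      simpa using ((Complex.ofRealCLM.hasDerivAt (x := (0 : ℝ))).mul_const c)
    exact h₁.cexp
  have h₂ : (fun s : ℝ => Complex.exp (s * c)) = fun _ => 1 := funext h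
  rw [h₂] at h₁
  simpa using h₁.unique (hasDerivAt_const _ _)

variable {E : Type*} [NormedAddCommGroup E] [NormedSpace ℝ E]
  {G : Type*} [TopologicalSpace G] [ChartedSpace E G] [Group G]

/-- The `X` in the Lie algebra with `exp(tX) ∈ H` for all `t`. -/
def expSet (E : Type*) [NormedAddCommGroup E] [NormedSpace ℝ E] {G : Type*} [TopologicalSpace G]
    [ChartedSpace E G] [Group G] (H : Subgroup G) : Set (GroupLieAlgebra 𝓘(ℝ, E) G) :=
  {X | ∃ γ : ℝ → G, IsExpCurve γ X ∧ ∀ t, γ t ∈ H}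

theorem lieSub_eq (H : Subgroup G) : lieSub E H = Submodule.span ℝ (expSet E H) := rfl

section Lie
variable [LieGroup 𝓘(ℝ, E) ∞ G] [FiniteDimensional ℝ E] [T2Space G]

theorem exists_character_eq_exp {H : Subgroup G} (χ : H →ₜ* ℂˣ) {γ : ℝ → G}
    {X : GroupLieAlgebra 𝓘(ℝ, E) G} (hγ : IsExpCurve γ X) (hH : ∀ t, γ t ∈ H) :
    ∃ c : ℂ, ∀ t : ℝ, ((χ ⟨γ t, hH t⟩ : ℂˣ) : ℂ) = Complex.exp (t * c) := by
  have hcont : Continuous fun t => (⟨γ t, hH t⟩ : H) := hγ.continuous.subtype_mk hH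
  refine exists_eq_exp_of_add_eq_mul
    (u := fun t => ((χ ⟨γ t, hH t⟩ : ℂˣ) : ℂ)) ?_ ?_ fun s t => ?_
  · exact Units.continuous_val.comp (χ.continuous_toFun.comp hcont)
  · have : (⟨γ 0, hH 0⟩ : H) = 1 := Subtype.ext hγ.1
    simp [this]
  · have : (⟨γ (s + t), hH (s + t)⟩ : H) = ⟨γ s, hH s⟩ * ⟨γ t, hH t⟩ := Subtype.ext (hγ.add s t)
    simp only [this, map_mul, Units.val_mul]

/-- The exponents of a character along one-parameter subgroups satisfy all the linear relations of
their generators. -/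
theorem sum_exponent_eq_zero {H : Subgroup G} (χ : H →ₜ* ℂˣ) {ι : Type*} (s : Finset ι)
    (γ : ι → ℝ → G) (X : ι → GroupLieAlgebra 𝓘(ℝ, E) G) (c : ι → ℂ)
    (hγ : ∀ i, IsExpCurve (γ i) (X i)) (hH : ∀ i t, γ i t ∈ H)
    (hc : ∀ i, ∀ t : ℝ, ((χ ⟨γ i t, hH i t⟩ : ℂˣ) : ℂ) = Complex.exp (t * c i))
    (hX : ∑ i ∈ s, X i = 0) : ∑ i ∈ s, c i = 0 := by
  -- The velocities of the factors add up to zero, whereas the exponents of the character add up to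
  -- `∑ c i`.
  set β : ℝ → H := fun t => (s.toList.map fun i => (⟨γ i t, hH i t⟩ : H)).prod with hβ
  have hβG : ∀ t, ((β t : H) : G) = (s.toList.map fun i => γ i t).prod := by
    intro t
    rw [hβ]
    rw [SubmonoidClass.coe_list_prod, List.map_map]
    rfl
  have hv : HasVelocity (E := E) (fun t => ((β t : H) : G)) 0 := by
    have h := hasVelocity_list_prod (E := E) γ X (fun i => (hγ i).hasVelocity) s.toList
    have h0 : (s.toList.map X).sum = 0 := by rw [Finset.sum_map_toList]; exact hX
    simp only [hβG]
    exact (congrArg (HasVelocity (E := E) _) h0).mp h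
  have hχβ : ∀ t : ℝ, ((χ (β t) : ℂˣ) : ℂ) = Complex.exp (t * ∑ i ∈ s, c i) := by
    intro t
    rw [hβ]
    simp only [← Units.coeHom_apply, map_list_prod, List.map_map, Function.comp_def]
    simp only [Units.coeHom_apply, hc]
    rw [Finset.prod_map_toList, ← Complex.exp_sum, Finset.mul_sum]
  -- The powers `β (x / n) ^ n` tend to `1` in `H`, but for `n ≠ 0` the character has the constant
  -- value `exp (x ∑ c i)` on them.
  refine eq_zero_of_exp_eq_one fun x => ?_
  have hlim : Filter.Tendsto (fun n : ℕ => β (x / n) ^ n) Filter.atTop (𝓝 1) := by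
    rw [tendsto_subtype_rng]
    exact hv.tendsto_pow x
  have h₁ : Filter.Tendsto (fun n : ℕ => ((χ (β (x / n) ^ n) : ℂˣ) : ℂ)) Filter.atTop (𝓝 1) := by
    have h := (Units.continuous_val.comp χ.continuous_toFun).continuousAt.tendsto.comp hlim
    simpa [Function.comp_def] using h
  refine tendsto_nhds_unique ?_ h₁
  refine tendsto_const_nhds.congr' ?_
  filter_upwards [Filter.eventually_ne_atTop 0] with n hn
  rw [map_pow, Units.val_pow_eq_pow_val, hχβ, ← Complex.exp_nat_mul]
  congr 1
  have : (n : ℂ) ≠ 0 := by exact_mod_cast hn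
  push_cast
  field_simp

/-- The differential of a character of a subgroup. -/
theorem exists_charDeriv {H : Subgroup G} (χ : H →ₜ* ℂˣ) :
    ∃ χ' : GroupLieAlgebra 𝓘(ℝ, E) G →ₗ[ℝ] ℂ, ∀ (X : GroupLieAlgebra 𝓘(ℝ, E) G) (γ : ℝ → G)
      (_ : IsExpCurve γ X) (hH : ∀ t, γ t ∈ H) (t : ℝ),
        ((χ ⟨γ t, hH t⟩ : ℂˣ) : ℂ) = Complex.exp (t * χ' X) := by
  set ι := {p : (ℝ → G) × GroupLieAlgebra 𝓘(ℝ, E) G // IsExpCurve p.1 p.2 ∧ ∀ t, p.1 t ∈ H}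
  choose c hc using fun i : ι => exists_character_eq_exp χ i.2.1 i.2.2
  set f : (ι →₀ ℝ) →ₗ[ℝ] GroupLieAlgebra 𝓘(ℝ, E) G :=
    Finsupp.linearCombination ℝ fun i : ι => i.1.2 with hf
  set k : (ι →₀ ℝ) →ₗ[ℝ] ℂ := Finsupp.linearCombination ℝ c with hk
  -- The coefficients of a linear relation are absorbed into the time parameter of the curves.
  have hker : ∀ v, f v = 0 → k v = 0 := by
    intro v hv
    rw [hf, Finsupp.linearCombination_apply, Finsupp.sum] at hv
    rw [hk, Finsupp.linearCombination_apply, Finsupp.sum]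
    refine sum_exponent_eq_zero χ v.support (fun i t => i.1.1 (t * v i)) (fun i => v i • i.1.2)
      (fun i => v i • c i) (fun i => i.2.1.smul (v i)) (fun i t => i.2.2 _) (fun i t => ?_) hv
    rw [hc i (t * v i)]
    congr 1
    simp [mul_assoc]
  -- Exponents depend only on the generator by `hker`, so a linear section of `f` over its range
  -- carries them to a linear form there; outside the range the extension is arbitrary.
  obtain ⟨g, hg⟩ := f.rangeRestrict.exists_rightInverse_of_surjective f.range_rangeRestrict
  obtain ⟨χ', hχ'⟩ := LinearMap.exists_extend (k ∘ₗ g)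
  refine ⟨χ', fun X γ hγ hH t => ?_⟩
  set i : ι := ⟨(γ, X), hγ, hH⟩
  have hXi : f (Finsupp.single i 1) = X := by simp [hf, i]
  have hki : k (Finsupp.single i 1) = c i := by simp [hk]
  have h₁ : χ' X = k (g (f.rangeRestrict (Finsupp.single i 1))) := by
    have := LinearMap.congr_fun hχ' (f.rangeRestrict (Finsupp.single i 1))
    simpa [hXi] using this
  have h₂ : f (g (f.rangeRestrict (Finsupp.single i 1))) = f (Finsupp.single i 1) :=
    congrArg Subtype.val (LinearMap.congr_fun hg (f.rangeRestrict (Finsupp.single i 1)))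
  have h₃ : k (g (f.rangeRestrict (Finsupp.single i 1)) - Finsupp.single i 1) = 0 :=
    hker _ (by rw [map_sub, h₂, sub_self])
  rw [map_sub, sub_eq_zero, hki] at h₃
  rw [h₁, h₃]
  exact hc i t

end Lie
end InvDiffOp

namespace InvDiffOp

/-! ### Words in an algebra with commutators of lower order -/

section Words
variable {A : Type*} [Ring A] [Algebra ℂ A] {ι : Type*}

/-- The product of the letters of a word. -/
def wordProd (W : ι → A) (l : List ι) : A := (l.map W).prod

theorem wordProd_nil (W : ι → A) : wordProd W [] = 1 := rfl

theorem wordProd_cons (W : ι → A) (a : ι) (l : List ι) :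
    wordProd W (a :: l) = W a * wordProd W l := by simp [wordProd]

theorem wordProd_append (W : ι → A) (l l' : List ι) :
    wordProd W (l ++ l') = wordProd W l * wordProd W l' := by simp [wordProd]

theorem wordProd_map {κ : Type*} (W : ι → A) (f : κ → ι) (l : List κ) :
    wordProd W (l.map f) = wordProd (W ∘ f) l := by simp [wordProd]

/-- Reordering the letters changes a product by lower order terms. -/
theorem wordProd_sub_mem_of_perm {W : ι → A} {F : ℕ → Submodule ℂ A}
    (h₁ : ∀ a k, ∀ x ∈ F k, W a * x ∈ F (k + 1))
    (h₂ : ∀ a b l, (W a * W b - W b * W a) * wordProd W l ∈ F (l.length + 2))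
    {l l' : List ι} (h : l.Perm l') : wordProd W l - wordProd W l' ∈ F l.length := by
  induction h with
  | nil => simp
  | cons a _ ih =>
    rw [wordProd_cons, wordProd_cons, ← mul_sub]
    exact h₁ a _ _ ih
  | swap a b l =>
    have := h₂ b a l
    rwa [sub_mul, mul_assoc, mul_assoc, ← wordProd_cons, ← wordProd_cons, ← wordProd_cons,
      ← wordProd_cons] at this
  | trans h h' ih ih' =>
    rw [← h.length_eq] at ih'
    simpa using add_mem ih ih'

/-- The span of the products of fewer than `k` letters. -/
def wordFilt (W : ι → A) (k : ℕ) : Submodule ℂ A :=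
  Submodule.span ℂ {x | ∃ l : List ι, l.length < k ∧ x = wordProd W l}

variable {W : ι → A}

theorem wordProd_mem_wordFilt (l : List ι) {k : ℕ} (h : l.length < k) :
    wordProd W l ∈ wordFilt W k := Submodule.subset_span ⟨l, h, rfl⟩

theorem wordFilt_mono {k k' : ℕ} (h : k ≤ k') : wordFilt W k ≤ wordFilt W k' :=
  Submodule.span_mono fun _ ⟨l, hl, e⟩ => ⟨l, hl.trans_le h, e⟩

theorem wordFilt_zero : wordFilt W 0 = ⊥ := by
  rw [wordFilt, Submodule.span_eq_bot]
  rintro x ⟨l, hl, -⟩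
  exact absurd hl (Nat.not_lt_zero _)

/-- Index `k` stands for length at most `k - 1`, so the concatenated words have length at most `j +
k - 2`. -/
theorem wordFilt_mul {j k n : ℕ} (hn : j + k ≤ n + 1) {x y : A} (hx : x ∈ wordFilt W j)
    (hy : y ∈ wordFilt W k) : x * y ∈ wordFilt W n := by
  induction hx using Submodule.span_induction with
  | mem x hx =>
    obtain ⟨l, hl, rfl⟩ := hx
    induction hy using Submodule.span_induction with
    | mem y hy =>
      obtain ⟨l', hl', rfl⟩ := hy
      rw [← wordProd_append]
      exact wordProd_mem_wordFilt _ (by rw [List.length_append]; omega)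
    | zero => simp
    | add x y _ _ hx hy => rw [mul_add]; exact add_mem hx hy
    | smul a x _ hx => rw [mul_smul_comm]; exact Submodule.smul_mem _ _ hx
  | zero => simp
  | add x y _ _ hx hy => rw [add_mul]; exact add_mem hx hy
  | smul a x _ hx => rw [smul_mul_assoc]; exact Submodule.smul_mem _ _ hx

theorem letter_mem_wordFilt (a : ι) : W a ∈ wordFilt W 2 := by
  have := wordProd_mem_wordFilt (W := W) [a] (k := 2) (by simp)
  simpa [wordProd] using this

theorem one_mem_wordFilt {k : ℕ} (hk : 0 < k) : (1 : A) ∈ wordFilt W k := by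
  exact wordProd_mem_wordFilt (W := W) [] (k := k) (by simpa)

theorem wordProd_sub_mem_wordFilt
    (hW : ∀ a b, W a * W b - W b * W a ∈ wordFilt W 2) {l l' : List ι} (h : l.Perm l') :
    wordProd W l - wordProd W l' ∈ wordFilt W l.length :=
  wordProd_sub_mem_of_perm (fun a k x hx => wordFilt_mul (by omega) (letter_mem_wordFilt a) hx)
    (fun a b l => wordFilt_mul (k := l.length + 1) (by omega) (hW a b)
      (wordProd_mem_wordFilt l (by omega))) h

/-- Moving one letter from the front of a word to its end is a permutation, so the difference has
smaller length. -/
theorem commutator_mem_wordFilt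
    (hW : ∀ a b, W a * W b - W b * W a ∈ wordFilt W 2) (a : ι) {k : ℕ} {x : A} (hx : x ∈ wordFilt W k) :
    W a * x - x * W a ∈ wordFilt W k := by
  induction hx using Submodule.span_induction with
  | mem x hx =>
    obtain ⟨l, hl, rfl⟩ := hx
    have h := wordProd_sub_mem_wordFilt hW (l := a :: l) (l' := l ++ [a])
      (List.perm_append_singleton a l).symm
    rw [wordProd_append, wordProd_cons, wordProd_cons, wordProd_nil, mul_one] at h
    exact wordFilt_mono (by simpa using hl) h
  | zero => simp
  | add x y _ _ hx hy =>
    rw [mul_add, add_mul, add_sub_add_comm]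
    exact add_mem hx hy
  | smul c x _ hx =>
    rw [mul_smul_comm, smul_mul_assoc, ← smul_sub]
    exact Submodule.smul_mem _ _ hx

/-- Normally ordered products are linearly independent if they can be separated degree by
degree. -/
theorem linearIndependent_wordProd {J : Type*} (nf : J → List ι)
    (hnf : ∀ i j, (nf i : Multiset ι) = nf j → i = j)
    (hsep : ∀ γ : Multiset ι, ∃ p : A →ₗ[ℂ] ℂ, ∀ l : List ι, l.length ≤ γ.card →
      (p (wordProd W l) ≠ 0 ↔ (l : Multiset ι) = γ)) :
    LinearIndependent ℂ fun j => wordProd W (nf j) := by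
  rw [linearIndependent_iff]
  intro c hc
  by_contra hne
  -- The functional belonging to a longest word of the relation kills all the other words in it.
  obtain ⟨j, hj, hmax⟩ := c.support.exists_max_image (fun j => (nf j).length)
    (Finsupp.support_nonempty_iff.2 hne)
  obtain ⟨p, hp⟩ := hsep (nf j)
  have h := congrArg p hc
  rw [map_zero, Finsupp.linearCombination_apply, Finsupp.sum, map_sum,
    Finset.sum_eq_single_of_mem j hj] at h
  · rw [map_smul, smul_eq_mul] at h
    exact mul_ne_zero (Finsupp.mem_support_iff.1 hj) ((hp (nf j) (by simp)).2 rfl) h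
  · intro i hi hij
    have h₁ : ¬ p (wordProd W (nf i)) ≠ 0 := by
      rw [hp (nf i) (by simpa using hmax i hi)]
      exact fun e => hij (hnf _ _ e)
    rw [map_smul, not_not.1 h₁, smul_zero]

end Words

/-! ### Sorted words in two kinds of letters. -/

section Splitting
variable {A : Type*} [Ring A] [Algebra ℂ A] {r s : ℕ} {W : Fin r ⊕ Fin s → A}

/-- The span of the products of a word and a letter of the second kind. -/
def wordIdeal (W : Fin r ⊕ Fin s → A) : Submodule ℂ A :=
  Submodule.span ℂ {x | ∃ (l : List (Fin r ⊕ Fin s)) (j : Fin s),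
    x = wordProd W l * W (Sum.inr j)}

theorem mul_mem_wordIdeal {k : ℕ} {x : A} (hx : x ∈ wordFilt W k) (j : Fin s) :
    x * W (Sum.inr j) ∈ wordIdeal W := by
  induction hx using Submodule.span_induction with
  | mem x hx =>
    obtain ⟨l, -, rfl⟩ := hx
    exact Submodule.subset_span ⟨l, j, rfl⟩
  | zero => simp
  | add x y _ _ hx hy => rw [add_mul]; exact add_mem hx hy
  | smul a x _ hx => rw [smul_mul_assoc]; exact Submodule.smul_mem _ _ hx

theorem wordFilt_mul_wordIdeal {k : ℕ} {x y : A} (hx : x ∈ wordFilt W k)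
    (hy : y ∈ wordIdeal W) : x * y ∈ wordIdeal W := by
  induction hy using Submodule.span_induction with
  | mem y hy =>
    obtain ⟨l, j, rfl⟩ := hy
    rw [← mul_assoc]
    exact mul_mem_wordIdeal (k := k + l.length) (wordFilt_mul (k := l.length + 1) (by omega) hx
      (wordProd_mem_wordFilt l (by omega))) j
  | zero => simp
  | add x y _ _ hx hy => rw [mul_add]; exact add_mem hx hy
  | smul a x _ hx => rw [mul_smul_comm]; exact Submodule.smul_mem _ _ hx

/-- The word with letters of the first kind from `α` followed by letters of the second kind
from `β`. -/
def normalWord (p : Multiset (Fin r) × Multiset (Fin s)) : List (Fin r ⊕ Fin s) :=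
  p.1.toList.map Sum.inl ++ p.2.toList.map Sum.inr

theorem coe_normalWord (p : Multiset (Fin r) × Multiset (Fin s)) :
    (normalWord p : Multiset (Fin r ⊕ Fin s)) = p.1.map Sum.inl + p.2.map Sum.inr := by
  rw [normalWord, ← Multiset.coe_add, ← Multiset.map_coe, ← Multiset.map_coe, Multiset.coe_toList,
    Multiset.coe_toList]

theorem normalWord_injective (p q : Multiset (Fin r) × Multiset (Fin s))
    (h : (normalWord p : Multiset (Fin r ⊕ Fin s)) = normalWord q) : p = q := by
  rw [coe_normalWord, coe_normalWord] at h
  refine Prod.ext (Multiset.ext.2 fun a => ?_) (Multiset.ext.2 fun a => ?_)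
  · have := congrArg (Multiset.count (Sum.inl a)) h
    simpa [Multiset.count_map_eq_count' _ _ Sum.inl_injective] using this
  · have := congrArg (Multiset.count (Sum.inr a)) h
    simpa [Multiset.count_map_eq_count' _ _ Sum.inr_injective] using this

theorem exists_perm_normalWord (l : List (Fin r ⊕ Fin s)) : ∃ p, l.Perm (normalWord p) := by
  simp only [← Multiset.coe_eq_coe, coe_normalWord]
  induction l with
  | nil => exact ⟨(0, 0), by simp⟩
  | cons a l ih =>
    obtain ⟨p, hp⟩ := ih
    rw [← Multiset.cons_coe, hp]
    rcases a with a | a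
    · exact ⟨(a ::ₘ p.1, p.2), by simp⟩
    · exact ⟨(p.1, a ::ₘ p.2), by simp⟩

/-- By induction on the length, since sorting a word costs only shorter words. -/
theorem wordFilt_le_span_normalWord
    (hW : ∀ a b, W a * W b - W b * W a ∈ wordFilt W 2) (d : ℕ) : wordFilt W d ≤ Submodule.span ℂ
    ((fun p => wordProd W (normalWord p)) '' {p | (normalWord p).length < d}) := by
  induction d with
  | zero => rw [wordFilt_zero]; exact bot_le
  | succ d ih =>
    refine Submodule.span_le.2 ?_
    rintro x ⟨l, hl, rfl⟩
    have hmono : Submodule.span ℂ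
        ((fun p => wordProd W (normalWord p)) '' {p | (normalWord p).length < d}) ≤
        Submodule.span ℂ ((fun p : Multiset (Fin r) × Multiset (Fin s) =>
          wordProd W (normalWord p)) '' {p | (normalWord p).length < d + 1}) :=
      Submodule.span_mono (Set.image_mono fun p hp => Nat.lt_succ_of_lt hp)
    obtain ⟨p, hp⟩ := exists_perm_normalWord l
    have h₁ := hmono (ih (wordFilt_mono (Nat.lt_succ_iff.1 hl) (wordProd_sub_mem_wordFilt hW hp)))
    have h₂ : wordProd W (normalWord p) ∈ Submodule.span ℂ
        ((fun p : Multiset (Fin r) × Multiset (Fin s) =>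
          wordProd W (normalWord p)) '' {p | (normalWord p).length < d + 1}) :=
      Submodule.subset_span ⟨p, by rw [Set.mem_ofPred_eq, ← hp.length_eq]; exact hl, rfl⟩
    simpa using add_mem h₁ h₂

/-- Commutators of letters of the second kind are combinations of such letters without constant
term, so sorting a nonempty word never produces the empty one. The filtration `F` by nonempty words
records this. -/
theorem wordProd_inr_mem_span (hW' : ∀ i j, W (Sum.inr i) * W (Sum.inr j) -
      W (Sum.inr j) * W (Sum.inr i) ∈ Submodule.span ℂ (Set.range (W ∘ Sum.inr)))
    (m : List (Fin s)) (hm : m ≠ []) : wordProd (W ∘ Sum.inr) m ∈ Submodule.span ℂ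
      {x | ∃ β : Multiset (Fin s), β ≠ 0 ∧ x = wordProd (W ∘ Sum.inr) β.toList} := by
  set F : ℕ → Submodule ℂ A := fun k => Submodule.span ℂ
    {x | ∃ l : List (Fin s), l ≠ [] ∧ l.length < k ∧ x = wordProd (W ∘ Sum.inr) l} with hF
  have h₁ : ∀ a k, ∀ x ∈ F k, (W ∘ Sum.inr) a * x ∈ F (k + 1) := by
    intro a k x hx
    induction hx using Submodule.span_induction with
    | mem x hx =>
      obtain ⟨l, h0, hl, rfl⟩ := hx
      exact Submodule.subset_span ⟨a :: l, by simp, by simpa using hl, (wordProd_cons _ _ _).symm⟩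
    | zero => simp
    | add x y _ _ hx hy => rw [mul_add]; exact add_mem hx hy
    | smul a x _ hx => rw [mul_smul_comm]; exact Submodule.smul_mem _ _ hx
  have h₂ : ∀ a b l, ((W ∘ Sum.inr) a * (W ∘ Sum.inr) b - (W ∘ Sum.inr) b * (W ∘ Sum.inr) a) *
      wordProd (W ∘ Sum.inr) l ∈ F (l.length + 2) := by
    intro a b l
    have hab := hW' a b
    change (W (Sum.inr a) * W (Sum.inr b) - W (Sum.inr b) * W (Sum.inr a)) * _ ∈ _
    generalize W (Sum.inr a) * W (Sum.inr b) - W (Sum.inr b) * W (Sum.inr a) = y at hab ⊢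
    induction hab using Submodule.span_induction with
    | mem x hx =>
      obtain ⟨c, rfl⟩ := hx
      exact Submodule.subset_span ⟨c :: l, by simp, by simp, (wordProd_cons _ _ _).symm⟩
    | zero => simp
    | add x y _ _ hx hy => rw [add_mul]; exact add_mem hx hy
    | smul a x _ hx => rw [smul_mul_assoc]; exact Submodule.smul_mem _ _ hx
  have key : ∀ k, F k ≤ Submodule.span ℂ
      {x | ∃ β : Multiset (Fin s), β ≠ 0 ∧ x = wordProd (W ∘ Sum.inr) β.toList} := by
    intro k
    induction k with
    | zero =>
      refine Submodule.span_le.2 ?_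
      rintro x ⟨l, -, hl, -⟩
      exact absurd hl (Nat.not_lt_zero _)
    | succ k ih =>
      refine Submodule.span_le.2 ?_
      rintro x ⟨l, h0, hl, rfl⟩
      have hp : l.Perm (l : Multiset (Fin s)).toList := by
        rw [← Multiset.coe_eq_coe, Multiset.coe_toList]
      have h₃ := wordProd_sub_mem_of_perm h₁ h₂ hp
      have h₄ : F l.length ≤ F k := Submodule.span_mono fun x ⟨l', a, b, c⟩ =>
        ⟨l', a, b.trans_le (Nat.lt_succ_iff.1 hl), c⟩
      have h₅ : wordProd (W ∘ Sum.inr) (l : Multiset (Fin s)).toList ∈ Submodule.span ℂ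
          {x | ∃ β : Multiset (Fin s), β ≠ 0 ∧ x = wordProd (W ∘ Sum.inr) β.toList} :=
        Submodule.subset_span ⟨l, by simpa using h0, rfl⟩
      simpa using add_mem (ih (h₄ h₃)) h₅
  exact key (m.length + 1) (Submodule.subset_span ⟨m, hm, by omega, rfl⟩)

/-- After the left factor is sorted, the appended letter keeps the part of the second kind nonempty,
and sorting that part preserves this. -/
theorem wordIdeal_le_span_normalWord
    (hW : ∀ a b, W a * W b - W b * W a ∈ wordFilt W 2)
    (hW' : ∀ i j, W (Sum.inr i) * W (Sum.inr j) -
      W (Sum.inr j) * W (Sum.inr i) ∈ Submodule.span ℂ (Set.range (W ∘ Sum.inr))) :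
    wordIdeal W ≤ Submodule.span ℂ
      ((fun p => wordProd W (normalWord p)) '' {p | p.2 ≠ 0}) := by
  have h₁ : ∀ (α : Multiset (Fin r)) (x : A), x ∈ Submodule.span ℂ
      {x | ∃ β : Multiset (Fin s), β ≠ 0 ∧ x = wordProd (W ∘ Sum.inr) β.toList} →
      wordProd (W ∘ Sum.inl) α.toList * x ∈ Submodule.span ℂ
        ((fun p => wordProd W (normalWord p)) '' {p | p.2 ≠ 0}) := by
    intro α x hx
    induction hx using Submodule.span_induction with
    | mem x hx =>
      obtain ⟨β, hβ, rfl⟩ := hx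
      refine Submodule.subset_span ⟨(α, β), hβ, ?_⟩
      simp only [normalWord, wordProd_append, wordProd_map]
    | zero => simp
    | add x y _ _ hx hy => rw [mul_add]; exact add_mem hx hy
    | smul a x _ hx => rw [mul_smul_comm]; exact Submodule.smul_mem _ _ hx
  refine Submodule.span_le.2 ?_
  rintro x ⟨l, j, rfl⟩
  have hl := wordFilt_le_span_normalWord hW (l.length + 1)
    (wordProd_mem_wordFilt l (by omega))
  rw [SetLike.mem_coe]
  generalize wordProd W l = y at hl ⊢
  induction hl using Submodule.span_induction with
  | mem x hx =>
    obtain ⟨⟨α, β⟩, -, rfl⟩ := hx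
    have e : wordProd W (normalWord (α, β)) * W (Sum.inr j) =
        wordProd (W ∘ Sum.inl) α.toList * wordProd (W ∘ Sum.inr) (β.toList ++ [j]) := by
      simp only [normalWord, wordProd_append, wordProd_map, wordProd_cons, wordProd_nil, mul_one,
        mul_assoc, Function.comp_apply]
    rw [e]
    exact h₁ α _ (wordProd_inr_mem_span hW' _ (by simp))
  | zero => simp
  | add x y _ _ hx hy => rw [add_mul]; exact add_mem hx hy
  | smul a x _ hx => rw [smul_mul_assoc]; exact Submodule.smul_mem _ _ hx

end Splitting
end InvDiffOp

namespace InvDiffOp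

/-! ### Symmetrization up to lower order terms -/

section Polynomials
variable {r : ℕ}

theorem isHomogeneous_iff_degree {P : MvPolynomial (Fin r) ℂ} {d : ℕ} :
    P.IsHomogeneous d ↔ ∀ α, P.coeff α ≠ 0 → α.degree = d := by
  refine ⟨fun h α hα => ?_, fun h α hα => ?_⟩
  · rw [Finsupp.degree_eq_weight_one]; exact h hα
  · rw [← h α hα, Finsupp.degree_eq_weight_one]; rfl

theorem isHomogeneous_induction {d : ℕ} {p : MvPolynomial (Fin r) ℂ → Prop}
    (h0 : p 0) (hadd : ∀ P Q, p P → p Q → p (P + Q)) (hsmul : ∀ (c : ℂ) P, p P → p (c • P))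
    (hmon : ∀ α : Fin r →₀ ℕ, α.degree = d → p (MvPolynomial.monomial α 1))
    {P : MvPolynomial (Fin r) ℂ} (hP : P.IsHomogeneous d) : p P := by
  rw [P.as_sum]
  refine Finset.sum_induction _ p hadd h0 fun α hα => ?_
  have e : MvPolynomial.monomial α (P.coeff α) =
      P.coeff α • (MvPolynomial.monomial α 1 : MvPolynomial (Fin r) ℂ) := by
    rw [MvPolynomial.smul_monomial, smul_eq_mul, mul_one]
  rw [e]
  exact hsmul _ _ (hmon α (isHomogeneous_iff_degree.1 hP α (MvPolynomial.mem_support_iff.1 hα)))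

theorem length_toList_toMultiset (α : Fin r →₀ ℕ) : α.toMultiset.toList.length = α.degree := by
  rw [Multiset.length_toList, Finsupp.card_toMultiset]
  rfl

end Polynomials

section Splitting
variable {A : Type*} [Ring A] [Algebra ℂ A] {r s : ℕ} {W : Fin r ⊕ Fin s → A}
  {Λ : MvPolynomial (Fin r) ℂ →ₗ[ℂ] A}

/-- A linear map on polynomials that sends every monomial to the product of its letters, up to terms
of lower order. -/
def IsQuantization (W : Fin r ⊕ Fin s → A) (Λ : MvPolynomial (Fin r) ℂ →ₗ[ℂ] A) : Prop :=
  ∀ α : Fin r →₀ ℕ, Λ (MvPolynomial.monomial α 1) -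
    wordProd W (α.toMultiset.toList.map Sum.inl) ∈ wordFilt W α.degree

theorem IsQuantization.monomial_mem (hΛ : IsQuantization W Λ) (α : Fin r →₀ ℕ) :
    Λ (MvPolynomial.monomial α 1) ∈ wordFilt W (α.degree + 1) := by
  have h := add_mem (wordFilt_mono (Nat.le_succ _) (hΛ α)) (wordProd_mem_wordFilt (W := W)
    (α.toMultiset.toList.map Sum.inl) (k := α.degree + 1) (by
      rw [List.length_map, length_toList_toMultiset]; omega))
  simpa using h

theorem IsQuantization.mem_of_degree_lt (hΛ : IsQuantization W Λ) {d : ℕ}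
    {P : MvPolynomial (Fin r) ℂ} (hP : ∀ α ∈ P.support, α.degree < d) : Λ P ∈ wordFilt W d := by
  rw [P.as_sum, map_sum]
  refine sum_mem fun α hα => ?_
  have e : MvPolynomial.monomial α (P.coeff α) =
      P.coeff α • (MvPolynomial.monomial α 1 : MvPolynomial (Fin r) ℂ) := by
    rw [MvPolynomial.smul_monomial, smul_eq_mul, mul_one]
  rw [e, map_smul]
  exact Submodule.smul_mem _ _ (wordFilt_mono (hP α hα) (hΛ.monomial_mem α))

theorem IsQuantization.mem (hΛ : IsQuantization W Λ) {d : ℕ}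
    {P : MvPolynomial (Fin r) ℂ} (hP : P.IsHomogeneous d) : Λ P ∈ wordFilt W (d + 1) := by
  refine hΛ.mem_of_degree_lt fun α hα => ?_
  rw [isHomogeneous_iff_degree.1 hP α (MvPolynomial.mem_support_iff.1 hα)]
  omega

/-- For monomials, concatenating two sorted words and sorting the letters of the product monomial
differ only in lower order; bilinearity does the rest. Thus symbols multiply. -/
theorem IsQuantization.mul_sub_mem
    (hW : ∀ a b, W a * W b - W b * W a ∈ wordFilt W 2) (hΛ : IsQuantization W Λ) {p q : ℕ}
    {P Q : MvPolynomial (Fin r) ℂ} (hP : P.IsHomogeneous p) (hQ : Q.IsHomogeneous q) :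
    Λ P * Λ Q - Λ (P * Q) ∈ wordFilt W (p + q) := by
  refine isHomogeneous_induction (p := fun P => Λ P * Λ Q - Λ (P * Q) ∈ wordFilt W (p + q))
    (by simp) (fun P P' h h' => ?_) (fun c P h => ?_) (fun α hα => ?_) hP
  · rw [map_add, add_mul, add_mul, map_add, add_sub_add_comm]
    exact add_mem h h'
  · rw [map_smul, smul_mul_assoc, smul_mul_assoc, map_smul, ← smul_sub]
    exact Submodule.smul_mem _ _ h
  refine isHomogeneous_induction (p := fun Q => Λ (MvPolynomial.monomial α 1) * Λ Q -
    Λ (MvPolynomial.monomial α 1 * Q) ∈ wordFilt W (p + q))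
    (by simp) (fun P P' h h' => ?_) (fun c P h => ?_) (fun β hβ => ?_) hQ
  · rw [map_add, mul_add, mul_add, map_add, add_sub_add_comm]
    exact add_mem h h'
  · rw [map_smul, mul_smul_comm, mul_smul_comm, map_smul, ← smul_sub]
    exact Submodule.smul_mem _ _ h
  subst hα hβ
  rw [MvPolynomial.monomial_mul, one_mul]
  set wα := wordProd W (α.toMultiset.toList.map Sum.inl) with hwα
  set wβ := wordProd W (β.toMultiset.toList.map Sum.inl) with hwβ
  have h₁ := hΛ α
  have h₂ := hΛ β
  have h₃ := hΛ (α + β)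
  rw [map_add] at h₃
  have hwm : wα ∈ wordFilt W (α.degree + 1) := wordProd_mem_wordFilt _ (by
      rw [List.length_map, length_toList_toMultiset]; omega)
  have h₄ : wα * wβ - wordProd W ((α + β).toMultiset.toList.map Sum.inl) ∈
      wordFilt W (α.degree + β.degree) := by
    rw [hwα, hwβ, ← wordProd_append, ← List.map_append]
    have hp : ((α.toMultiset.toList ++ β.toMultiset.toList).map Sum.inl : List (Fin r ⊕ Fin s)).Perm
        ((α + β).toMultiset.toList.map Sum.inl) := by
      refine List.Perm.map _ ?_
      rw [← Multiset.coe_eq_coe, ← Multiset.coe_add, Multiset.coe_toList, Multiset.coe_toList,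
        Multiset.coe_toList, map_add]
    have := wordProd_sub_mem_wordFilt hW hp
    rwa [List.length_map, List.length_append, length_toList_toMultiset,
      length_toList_toMultiset] at this
  have h₅ : Λ (MvPolynomial.monomial α 1) * (Λ (MvPolynomial.monomial β 1) - wβ) ∈
      wordFilt W (α.degree + β.degree) := wordFilt_mul (by omega) (hΛ.monomial_mem α) h₂
  have h₆ : (Λ (MvPolynomial.monomial α 1) - wα) * wβ ∈ wordFilt W (α.degree + β.degree) :=
    wordFilt_mul (k := β.degree + 1) (by omega) h₁ (wordProd_mem_wordFilt _ (by
      rw [List.length_map, length_toList_toMultiset]; omega))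
  have := sub_mem (add_mem (add_mem h₅ h₆) h₄) h₃
  convert this using 1
  rw [map_add]
  noncomm_ring

theorem IsQuantization.X_sub_mem (hΛ : IsQuantization W Λ) (j : Fin r) :
    Λ (MvPolynomial.X j) - W (Sum.inl j) ∈ wordFilt W 1 := by
  have h := hΛ (Finsupp.single j 1)
  rw [Finsupp.toMultiset_single, one_smul, Multiset.toList_singleton, Finsupp.degree_single] at h
  have e : wordProd W ([j].map Sum.inl) = W (Sum.inl j) := by simp [wordProd]
  rwa [e] at h

theorem IsQuantization.letter_mul_sub_mem
    (hW : ∀ a b, W a * W b - W b * W a ∈ wordFilt W 2) (hΛ : IsQuantization W Λ) {n : ℕ}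
    (j : Fin r) {P : MvPolynomial (Fin r) ℂ} (hP : P.IsHomogeneous n) :
    W (Sum.inl j) * Λ P - Λ (MvPolynomial.X j * P) ∈ wordFilt W (n + 1) := by
  have h₁ := hΛ.mul_sub_mem hW (MvPolynomial.isHomogeneous_X ℂ j) hP
  have h₂ : (Λ (MvPolynomial.X j) - W (Sum.inl j)) * Λ P ∈ wordFilt W (n + 1) :=
    wordFilt_mul (by omega) (hΛ.X_sub_mem j) (hΛ.mem hP)
  rw [add_comm] at h₁
  have := sub_mem h₁ h₂
  convert this using 1
  noncomm_ring

theorem wordFilt_mul_sup {d j k : ℕ} (hd : j + k ≤ d + 1) {x y : A} (hx : x ∈ wordFilt W j)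
    (hy : y ∈ wordFilt W k ⊔ wordIdeal W) : x * y ∈ wordFilt W d ⊔ wordIdeal W := by
  obtain ⟨u, hu, v, hv, rfl⟩ := Submodule.mem_sup.1 hy
  rw [mul_add]
  exact add_mem (Submodule.mem_sup_left (wordFilt_mul hd hx hu))
    (Submodule.mem_sup_right (wordFilt_mul_wordIdeal hx hv))

/-- Every element is a quantized polynomial modulo the ideal and terms of lower order. -/
theorem IsQuantization.exists_sub_mem
    (hW : ∀ a b, W a * W b - W b * W a ∈ wordFilt W 2) (hΛ : IsQuantization W Λ) {k : ℕ} {x : A}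
    (hx : x ∈ wordFilt W (k + 1)) : ∃ P : MvPolynomial (Fin r) ℂ, P.IsHomogeneous k ∧
      x - Λ P ∈ wordFilt W k ⊔ wordIdeal W := by
  induction hx using Submodule.span_induction with
  | mem x hx =>
    obtain ⟨l, hl, rfl⟩ := hx
    rcases Nat.lt_or_ge l.length k with hlk | hlk
    · refine ⟨0, MvPolynomial.isHomogeneous_zero _ _ _, ?_⟩
      rw [map_zero, sub_zero]
      exact Submodule.mem_sup_left (wordProd_mem_wordFilt l hlk)
    have hlk' : l.length = k := by omega
    obtain ⟨p, hp⟩ := exists_perm_normalWord l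
    have h₁ := wordProd_sub_mem_wordFilt hW hp
    rw [hlk'] at h₁
    -- A sorted word of the first kind alone is the leading term of a quantized monomial; any other
    -- one ends in a letter of the second kind and lies in the ideal.
    by_cases hp2 : p.2.toList = []
    · refine ⟨MvPolynomial.monomial (Multiset.toFinsupp p.1) 1,
        MvPolynomial.isHomogeneous_monomial _ ?_, ?_⟩
      · rw [← hlk', hp.length_eq, normalWord, hp2, ← length_toList_toMultiset]
        simp
      · have h₂ := hΛ (Multiset.toFinsupp p.1)
        have e : normalWord p = (Multiset.toFinsupp p.1).toMultiset.toList.map Sum.inl := by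
          rw [normalWord, hp2]
          simp
        have hdeg : (Multiset.toFinsupp p.1).degree = k := by
          rw [← hlk', hp.length_eq, e, List.length_map, length_toList_toMultiset]
        rw [hdeg, ← e] at h₂
        refine Submodule.mem_sup_left ?_
        simpa using sub_mem h₁ h₂
    · refine ⟨0, MvPolynomial.isHomogeneous_zero _ _ _, ?_⟩
      rw [map_zero, sub_zero]
      have h₃ : wordProd W (normalWord p) ∈ wordIdeal W := by
        obtain ⟨m, j, hm⟩ := List.eq_nil_or_concat _ |>.resolve_left hp2
        rw [normalWord, hm, List.concat_eq_append, List.map_append, ← List.append_assoc,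
          wordProd_append]
        refine Submodule.subset_span ⟨p.1.toList.map Sum.inl ++ m.map Sum.inr, j, ?_⟩
        simp [wordProd]
      simpa using add_mem (Submodule.mem_sup_left (T := wordIdeal W) h₁)
        (Submodule.mem_sup_right (S := wordFilt W k) h₃)
  | zero => exact ⟨0, MvPolynomial.isHomogeneous_zero _ _ _, by simp⟩
  | add x y _ _ hx hy =>
    obtain ⟨P, hP, h⟩ := hx
    obtain ⟨Q, hQ, h'⟩ := hy
    refine ⟨P + Q, hP.add hQ, ?_⟩
    rw [map_add, add_sub_add_comm]
    exact add_mem h h'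
  | smul c x _ hx =>
    obtain ⟨P, hP, h⟩ := hx
    refine ⟨c • P, (MvPolynomial.homogeneousSubmodule (Fin r) ℂ k).smul_mem c hP, ?_⟩
    rw [map_smul, ← smul_sub]
    exact Submodule.smul_mem _ _ h

/-- Quantized homogeneous polynomials are not in the ideal modulo terms of lower order. -/
theorem IsQuantization.eq_zero_of_mem
    (hW : ∀ a b, W a * W b - W b * W a ∈ wordFilt W 2)
    (hW' : ∀ i j, W (Sum.inr i) * W (Sum.inr j) -
      W (Sum.inr j) * W (Sum.inr i) ∈ Submodule.span ℂ (Set.range (W ∘ Sum.inr)))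
    (hsep : ∀ γ : Multiset (Fin r ⊕ Fin s), ∃ p : A →ₗ[ℂ] ℂ, ∀ l : List (Fin r ⊕ Fin s),
      l.length ≤ γ.card → (p (wordProd W l) ≠ 0 ↔ (l : Multiset (Fin r ⊕ Fin s)) = γ))
    (hΛ : IsQuantization W Λ) {d : ℕ} {P : MvPolynomial (Fin r) ℂ} (hP : P.IsHomogeneous d)
    (h : Λ P ∈ wordFilt W d ⊔ wordIdeal W) : P = 0 := by
  have hli := linearIndependent_wordProd (W := W) normalWord normalWord_injective hsep
  set N : Multiset (Fin r) × Multiset (Fin s) → A := fun p => wordProd W (normalWord p) with hN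
  -- These sorted words span the lower order terms and the ideal. Words of length `d` in letters of
  -- the first kind are not among them.
  set S : Set (Multiset (Fin r) × Multiset (Fin s)) :=
    {p | (normalWord p).length < d} ∪ {p | p.2 ≠ 0} with hS
  have hfilt : wordFilt W d ≤ Submodule.span ℂ (N '' S) :=
    (wordFilt_le_span_normalWord hW d).trans
      (Submodule.span_mono (Set.image_mono Set.subset_union_left))
  have hideal : wordIdeal W ≤ Submodule.span ℂ (N '' S) :=
    (wordIdeal_le_span_normalWord hW hW').trans
      (Submodule.span_mono (Set.image_mono Set.subset_union_right))
  have hΛS : Λ P ∈ Submodule.span ℂ (N '' S) := (sup_le hfilt hideal) h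
  have hNα : ∀ α : Fin r →₀ ℕ, N (α.toMultiset, 0) =
      wordProd W (α.toMultiset.toList.map Sum.inl) := by
    intro α
    simp [hN, normalWord]
  have hsum : ∑ α ∈ P.support, P.coeff α • N (α.toMultiset, 0) ∈ Submodule.span ℂ (N '' S) := by
    have hdiff : Λ P - ∑ α ∈ P.support, P.coeff α • N (α.toMultiset, 0) ∈
        Submodule.span ℂ (N '' S) := by
      have e : Λ P = ∑ α ∈ P.support, Λ (MvPolynomial.monomial α (P.coeff α)) := by
        rw [← map_sum, ← P.as_sum]
      rw [e, ← Finset.sum_sub_distrib]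
      refine sum_mem fun α hα => hfilt ?_
      have e : MvPolynomial.monomial α (P.coeff α) =
          P.coeff α • (MvPolynomial.monomial α 1 : MvPolynomial (Fin r) ℂ) := by
        rw [MvPolynomial.smul_monomial, smul_eq_mul, mul_one]
      rw [e, map_smul, ← smul_sub, hNα]
      have h₁ := hΛ α
      rw [isHomogeneous_iff_degree.1 hP α (MvPolynomial.mem_support_iff.1 hα)] at h₁
      exact Submodule.smul_mem _ _ h₁
    simpa using sub_mem hΛS hdiff
  obtain ⟨v, hvS, hv⟩ := (Finsupp.mem_span_image_iff_linearCombination ℂ).1 hsum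
  set f : (Fin r →₀ ℕ) → Multiset (Fin r) × Multiset (Fin s) := fun α => (α.toMultiset, 0)
  have hfinj : Function.Injective f := fun α β hαβ =>
    Multiset.toFinsupp.symm.injective (congrArg Prod.fst hαβ)
  have hv' : Finsupp.linearCombination ℂ N (∑ α ∈ P.support, Finsupp.single (f α) (P.coeff α)) =
      ∑ α ∈ P.support, P.coeff α • N (α.toMultiset, 0) := by
    rw [map_sum]
    exact Finset.sum_congr rfl fun α _ => Finsupp.linearCombination_single ℂ _ _
  have hvP := hli (hv.trans hv'.symm)
  ext α
  rw [MvPolynomial.coeff_zero]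
  by_contra hα
  have h₁ : v (f α) = P.coeff α := by
    rw [hvP, Finsupp.finsetSum_apply, Finset.sum_eq_single α]
    · exact Finsupp.single_eq_same
    · exact fun β _ hβ => Finsupp.single_eq_of_ne (fun h => hβ (hfinj h).symm)
    · exact fun h => absurd (MvPolynomial.mem_support_iff.2 hα) h
  have h₂ : f α ∈ S := hvS (by
    rw [Finset.mem_coe, Finsupp.mem_support_iff, h₁]
    exact hα)
  rcases h₂ with h₂ | h₂
  · have hd := isHomogeneous_iff_degree.1 hP α hα
    simp only [Set.mem_ofPred_eq, f, normalWord, Multiset.toList_zero, List.map_nil,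
      List.append_nil, List.length_map, length_toList_toMultiset] at h₂
    omega
  · exact h₂ rfl

/-- A product of first order elements is the quantization of the product of their components along
the letters of the first kind, modulo the ideal and terms of lower order. -/
theorem IsQuantization.list_prod_sub_mem
    (hW : ∀ a b, W a * W b - W b * W a ∈ wordFilt W 2) (hΛ : IsQuantization W Λ) {κ : Type*}
    (y : κ → A) (a : κ → Fin r → ℂ) (hy : ∀ k, ∃ (b : Fin s → ℂ) (c : ℂ),
      y k = ∑ j, a k j • W (Sum.inl j) + ∑ j, b j • W (Sum.inr j) + c • (1 : A)) (l : List κ) :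
    (l.map fun k => ∑ j, MvPolynomial.C (a k j) * MvPolynomial.X j).prod.IsHomogeneous l.length ∧
    (l.map y).prod - Λ (l.map fun k => ∑ j, MvPolynomial.C (a k j) * MvPolynomial.X j).prod ∈
      wordFilt W l.length ⊔ wordIdeal W := by
  induction l with
  | nil =>
    refine ⟨MvPolynomial.isHomogeneous_one _ _, Submodule.mem_sup_left ?_⟩
    have h := hΛ 0
    simp only [map_zero, Multiset.toList_zero, List.map_nil, wordProd_nil] at h
    have h' := neg_mem h
    rw [neg_sub] at h'
    simpa using h'
  | cons k l ih =>
    obtain ⟨hl, ih⟩ := ih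
    set p : κ → MvPolynomial (Fin r) ℂ := fun k => ∑ j, MvPolynomial.C (a k j) * MvPolynomial.X j
    set n := l.length
    have hp : (p k).IsHomogeneous 1 := MvPolynomial.IsHomogeneous.sum _ _ _ fun j _ => by
      simpa using (MvPolynomial.isHomogeneous_C (Fin r) (a k j)).mul
        (MvPolynomial.isHomogeneous_X ℂ j)
    refine ⟨?_, ?_⟩
    · rw [List.map_cons, List.prod_cons, List.length_cons, add_comm]
      exact hp.mul hl
    obtain ⟨b, c, hyk⟩ := hy k
    have hy2 : y k ∈ wordFilt W 2 := by
      rw [hyk]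
      refine add_mem (add_mem (sum_mem fun j _ => Submodule.smul_mem _ _ (letter_mem_wordFilt _))
        (sum_mem fun j _ => Submodule.smul_mem _ _ (letter_mem_wordFilt _)))
        (Submodule.smul_mem _ _ (one_mem_wordFilt (by omega)))
    rw [List.map_cons, List.prod_cons, List.map_cons, List.prod_cons, List.length_cons]
    set Pl := (l.map p).prod
    have h₁ : y k * ((l.map y).prod - Λ Pl) ∈ wordFilt W (n + 1) ⊔ wordIdeal W :=
      wordFilt_mul_sup (by omega) hy2 ih
    -- The letter is moved to the right end, where the product lies in the ideal; the commutator
    -- does not raise the order.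
    have h₂ : ∀ j, W (Sum.inr j) * Λ Pl ∈ wordFilt W (n + 1) ⊔ wordIdeal W := by
      intro j
      have h := add_mem (Submodule.mem_sup_left (T := wordIdeal W)
        (commutator_mem_wordFilt hW (Sum.inr j) (hΛ.mem hl)))
        (Submodule.mem_sup_right (S := wordFilt W (n + 1)) (mul_mem_wordIdeal (hΛ.mem hl) j))
      simpa using h
    have h₃ : y k * Λ Pl - Λ (p k * Pl) ∈ wordFilt W (n + 1) ⊔ wordIdeal W := by
      have e : y k * Λ Pl - Λ (p k * Pl) =
          ∑ j, a k j • (W (Sum.inl j) * Λ Pl - Λ (MvPolynomial.X j * Pl)) +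
            ∑ j, b j • (W (Sum.inr j) * Λ Pl) + c • Λ Pl := by
        have e' : Λ (p k * Pl) = ∑ j, a k j • Λ (MvPolynomial.X j * Pl) := by
          simp only [p, Finset.sum_mul, map_sum]
          refine Finset.sum_congr rfl fun j _ => ?_
          rw [mul_assoc, ← MvPolynomial.smul_eq_C_mul, map_smul]
        rw [e', hyk, add_mul, add_mul, Finset.sum_mul, Finset.sum_mul, smul_mul_assoc, one_mul]
        simp only [smul_mul_assoc, smul_sub, Finset.sum_sub_distrib]
        abel
      rw [e]
      refine add_mem (add_mem (sum_mem fun j _ => Submodule.smul_mem _ _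
        (Submodule.mem_sup_left (hΛ.letter_mul_sub_mem hW j hl)))
        (sum_mem fun j _ => Submodule.smul_mem _ _ (h₂ j)))
        (Submodule.smul_mem _ _ (Submodule.mem_sup_left (hΛ.mem hl)))
    have := add_mem h₁ h₃
    rwa [mul_sub, sub_add_sub_cancel] at this

end Splitting
end InvDiffOp

namespace InvDiffOp

/-! ### Separating words by their values on monomials in coordinate functions -/

section Separation
variable {R : Type*} [CommRing R] [Algebra ℂ R] {F : Type*} [AddCommGroup F] [Module ℂ F]
  {ι : Type*} {W : ι → Module.End ℂ F} {D : ι → Derivation ℂ R R} {c : ι → ℂ} {φ : F ≃ₗ[ℂ] R}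
  {ev : R →ₐ[ℂ] ℂ} {x : ι → R}

/-- By Leibniz a derivation lowers the order of vanishing by at most one. -/
theorem derivation_apply_mem_pow (D : Derivation ℂ R R) (I : Ideal R) {n : ℕ} {f : R}
    (hf : f ∈ I ^ (n + 1)) : D f ∈ I ^ n := by
  induction n generalizing f with
  | zero => simp
  | succ n ih =>
    rw [pow_succ] at hf
    induction hf using Submodule.mul_induction_on' with
    | mem_mul_mem g hg h hh =>
      rw [Derivation.leibniz, smul_eq_mul, smul_eq_mul]
      refine add_mem (Ideal.mul_mem_right _ _ hg) ?_
      rw [pow_succ']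
      exact Ideal.mul_mem_mul hh (ih hg)
    | add f _ g _ hf hg => rw [map_add]; exact add_mem hf hg

/-- Every letter lowers the order of vanishing by at most one, and there are too few letters to
exhaust it. -/
theorem ev_wordProd_eq_zero (hW : ∀ a f, φ (W a f) = D a (φ f) + c a • φ f) (l : List ι) {n : ℕ}
    (hl : l.length < n) {f : F} (hf : φ f ∈ RingHom.ker ev ^ n) : ev (φ (wordProd W l f)) = 0 := by
  induction l using List.reverseRecOn generalizing f n with
  | nil =>
    have : φ f ∈ RingHom.ker ev := Ideal.pow_le_self (by simpa using hl.ne') hf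
    exact this
  | append_singleton l a ih =>
    obtain ⟨n, rfl⟩ : ∃ m, n = m + 1 := ⟨n - 1, by omega⟩
    rw [List.length_append, List.length_singleton] at hl
    have e : wordProd W (l ++ [a]) f = wordProd W l (W a f) := by
      rw [wordProd_append]; simp [wordProd]
    rw [e]
    refine ih (n := n) (by omega) ?_
    rw [hW]
    refine add_mem (derivation_apply_mem_pow _ _ hf) ?_
    rw [← algebraMap_smul R (c a), smul_eq_mul]
    exact Ideal.mul_mem_left _ _ (Ideal.pow_le_pow_right (by omega) hf)

theorem prod_map_mem_ker_pow (hx : ∀ a, ev (x a) = 0) (γ : Multiset ι) :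
    (γ.map x).prod ∈ RingHom.ker ev ^ γ.card := by
  induction γ using Multiset.induction_on with
  | empty => simp
  | cons b γ ih =>
    rw [Multiset.map_cons, Multiset.prod_cons, Multiset.card_cons, pow_succ']
    exact Ideal.mul_mem_mul (hx b) ih

variable [DecidableEq ι]

/-- Up to a higher order of vanishing `D a` acts as `∂/∂x_a` on monomials, because `D a (x b)`
differs from the Kronecker delta by a function vanishing at the point. -/
theorem derivation_prod_sub_mem (hx : ∀ a, ev (x a) = 0)
    (hDx : ∀ a b, ev (D a (x b)) = if a = b then 1 else 0) (a : ι) (γ : Multiset ι) :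
    D a (γ.map x).prod - (γ.count a : R) * ((γ.erase a).map x).prod ∈
      RingHom.ker ev ^ γ.card := by
  induction γ using Multiset.induction_on with
  | empty => simp
  | cons b γ ih =>
    rw [Multiset.map_cons, Multiset.prod_cons, Derivation.leibniz, smul_eq_mul, smul_eq_mul,
      Multiset.card_cons]
    have h₁ : x b * (D a (γ.map x).prod - (γ.count a : R) * ((γ.erase a).map x).prod) ∈
        RingHom.ker ev ^ (γ.card + 1) := by
      rw [pow_succ']
      exact Ideal.mul_mem_mul (hx b) ih
    have h₂ : (γ.map x).prod * (D a (x b) - if a = b then 1 else 0) ∈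
        RingHom.ker ev ^ (γ.card + 1) := by
      rw [pow_succ]
      refine Ideal.mul_mem_mul (prod_map_mem_ker_pow hx γ) ?_
      rw [RingHom.mem_ker, map_sub, hDx]
      split_ifs <;> simp
    have h₃ := add_mem h₁ h₂
    convert h₃ using 1
    by_cases hab : a = b
    · subst hab
      rw [Multiset.count_cons_self, Multiset.erase_cons_head]
      have h₄ : (γ.count a : R) * (γ.map x).prod =
          x a * ((γ.count a : R) * ((γ.erase a).map x).prod) := by
        by_cases ha : a ∈ γ
        · rw [← Multiset.prod_map_erase ha]; ring
        · rw [Multiset.count_eq_zero_of_notMem ha]; simp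
      simp only [if_true]
      push_cast
      rw [add_mul, h₄]
      ring
    · rw [Multiset.count_cons_of_ne hab, Multiset.erase_cons_tail _ (Ne.symm hab), if_neg hab,
        Multiset.map_cons, Multiset.prod_cons]
      ring

/-- The last letter acts first and strips its own variable from the monomial, with the multiplicity
as factor. The error, which includes the contribution of the constant `c a`, vanishes to an order
that the remaining letters cannot exhaust. A nonzero value therefore requires the letters to match
the variables exactly. -/
theorem ev_wordProd_prod_ne_zero_iff (hW : ∀ a f, φ (W a f) = D a (φ f) + c a • φ f)
    (hx : ∀ a, ev (x a) = 0) (hDx : ∀ a b, ev (D a (x b)) = if a = b then 1 else 0) (l : List ι)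
    (γ : Multiset ι) (hl : l.length ≤ γ.card) :
    ev (φ (wordProd W l (φ.symm (γ.map x).prod))) ≠ 0 ↔ (l : Multiset ι) = γ := by
  induction l using List.reverseRecOn generalizing γ with
  | nil =>
    rw [wordProd_nil, Module.End.one_apply, LinearEquiv.apply_symm_apply, Multiset.coe_nil]
    rcases Multiset.empty_or_exists_mem γ with rfl | ⟨b, hb⟩
    · simp
    · rw [← Multiset.prod_map_erase hb, map_mul, hx, zero_mul]
      simp only [ne_eq, not_true_eq_false, false_iff]
      rintro rfl
      simp at hb
  | append_singleton l a ih =>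
    rw [List.length_append, List.length_singleton] at hl
    have e : wordProd W (l ++ [a]) (φ.symm (γ.map x).prod) =
        wordProd W l (W a (φ.symm (γ.map x).prod)) := by
      rw [wordProd_append]; simp [wordProd]
    set g : F := (γ.count a : ℂ) • φ.symm ((γ.erase a).map x).prod with hg
    have h₁ : φ (W a (φ.symm (γ.map x).prod) - g) ∈ RingHom.ker ev ^ γ.card := by
      rw [map_sub, hW, LinearEquiv.apply_symm_apply, hg, map_smul, LinearEquiv.apply_symm_apply]
      have h := add_mem (derivation_prod_sub_mem hx hDx a γ)
        (Ideal.mul_mem_left _ (algebraMap ℂ R (c a)) (prod_map_mem_ker_pow hx γ))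
      rw [Nat.cast_smul_eq_nsmul, nsmul_eq_mul, ← algebraMap_smul R (c a), smul_eq_mul]
      convert h using 1
      ring
    have h₂ := ev_wordProd_eq_zero hW l (by omega) h₁
    rw [map_sub, map_sub, map_sub, sub_eq_zero] at h₂
    rw [e, h₂, hg, map_smul, map_smul, map_smul, smul_eq_mul, mul_ne_zero_iff]
    by_cases ha : a ∈ γ
    · have hcard : (γ.erase a).card = γ.card - 1 := by
        rw [Multiset.card_erase_of_mem ha, Nat.pred_eq_sub_one]
      rw [ih (γ.erase a) (by omega)]
      have hc : (γ.count a : ℂ) ≠ 0 := by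
        exact_mod_cast (Multiset.count_pos.2 ha).ne'
      refine ⟨fun h => ?_, fun h => ⟨hc, ?_⟩⟩
      · rw [← Multiset.cons_erase ha, ← h.2, ← Multiset.coe_add, add_comm]
        rfl
      · rw [← h, ← Multiset.coe_add, add_comm]
        exact (Multiset.erase_cons_head a (l : Multiset ι)).symm
    · rw [Multiset.count_eq_zero_of_notMem ha]
      simp only [Nat.cast_zero, ne_eq, not_true_eq_false, false_and, false_iff]
      rintro rfl
      exact ha (by simp)

end Separation

/-! ### Separation of words in left invariant fields. -/

variable {E : Type*} [NormedAddCommGroup E] [NormedSpace ℝ E]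
  {G : Type*} [TopologicalSpace G] [ChartedSpace E G] [Group G] [LieGroup 𝓘(ℝ, E) ∞ G]

variable (E G) in
/-- The algebra of smooth functions. -/
def smoothAlg : Subalgebra ℂ (G → ℂ) where
  carrier := {f | f ∈ SmoothFun E G}
  mul_mem' {f g} hf hg := (smoothMul (⟨f, hf⟩ : SmoothFun E G) ⟨g, hg⟩).2
  add_mem' hf hg := (SmoothFun E G).add_mem hf hg
  algebraMap_mem' _ := contMDiff_const

variable (E G) in
-- Supplies a ring structure on smooth functions, so that `Derivation` and ideals make sense.
def smoothAlgEquiv : SmoothFun E G ≃ₗ[ℂ] smoothAlg E G where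
  toFun f := ⟨f.1, f.2⟩
  invFun f := ⟨f.1, f.2⟩
  map_add' _ _ := rfl
  map_smul' _ _ := rfl

/-- A left invariant vector field as a derivation. -/
def leftDerivation (Y : GroupLieAlgebra 𝓘(ℝ, E) G) :
    Derivation ℂ (smoothAlg E G) (smoothAlg E G) :=
  Derivation.mk' ((smoothAlgEquiv E G).toLinearMap ∘ₗ leftVF Y ∘ₗ
    (smoothAlgEquiv E G).symm.toLinearMap) fun f g => by
      have h := leftVF_smoothMul Y ((smoothAlgEquiv E G).symm f) ((smoothAlgEquiv E G).symm g)
      refine (congrArg (smoothAlgEquiv E G) h).trans ?_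
      ext x
      change _ * g.1 x + f.1 x * _ = f.1 x * _ + g.1 x * _
      rw [add_comm, mul_comm _ (g.1 x)]
      rfl

/-- Words in a basis of left invariant vector fields, shifted by constants, are separated. -/
theorem exists_separating_functional [FiniteDimensional ℝ E] [T2Space G] {ι : Type*} [Fintype ι]
    (e : Module.Basis ι ℝ (GroupLieAlgebra 𝓘(ℝ, E) G)) (c : ι → ℂ) (γ : Multiset ι) :
    ∃ p : Op E G →ₗ[ℂ] ℂ, ∀ l : List ι, l.length ≤ γ.card →
      (p (wordProd (fun a => leftVF (e a) + c a • (1 : Op E G)) l) ≠ 0 ↔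
        (l : Multiset ι) = γ) := by
  classical
  -- Functions vanishing at `1` whose differentials there form the dual basis; the functional
  -- evaluates a word at `1` on their monomial.
  choose x hx hYx using fun a => exists_smoothFun_leftVF (E := E) (G := G) (e.coord a)
  set φ := smoothAlgEquiv E G
  set ev : smoothAlg E G →ₐ[ℂ] ℂ :=
    (Pi.evalAlgHom ℂ (fun _ : G => ℂ) 1).comp (smoothAlg E G).val
  set X : ι → smoothAlg E G := fun a => φ (x a)
  refine ⟨ev.toLinearMap ∘ₗ φ.toLinearMap ∘ₗ
    LinearMap.applyₗ (φ.symm (γ.map X).prod), fun l hl => ?_⟩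
  refine ev_wordProd_prod_ne_zero_iff (ev := ev) (x := X) (φ := φ) (c := c)
    (D := fun a => leftDerivation (e a)) (fun a f => rfl) hx (fun a b => ?_) l γ hl
  refine (hYx b (e a)).trans ?_
  rw [Module.Basis.coord_apply, Module.Basis.repr_self, Finsupp.single_apply]
  split_ifs <;> simp

end InvDiffOp

namespace InvDiffOp

/-! ### Lifting generators of the invariants -/

section Generators
variable {A : Type*} [Ring A] [Algebra ℂ A] {r s : ℕ} {W : Fin r ⊕ Fin s → A}
  {Λ : MvPolynomial (Fin r) ℂ →ₗ[ℂ] A} {κ : Type*} {P Q : κ → MvPolynomial (Fin r) ℂ}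

/-- Products of the generators, and their lifts. -/
theorem exists_lift_of_mem_closure
    (hW : ∀ a b, W a * W b - W b * W a ∈ wordFilt W 2) (hΛ : IsQuantization W Λ)
    (hPQ : ∀ i, ∃ d, (P i).IsHomogeneous d ∧ ∀ α ∈ (P i - Q i).support, α.degree < d)
    {p : MvPolynomial (Fin r) ℂ} (hp : p ∈ Submonoid.closure (Set.range P)) :
    ∃ e, p.IsHomogeneous e ∧ ∃ T ∈ Algebra.adjoin ℂ (Set.range fun i => Λ (Q i)),
      T - Λ p ∈ wordFilt W e := by
  induction hp using Submonoid.closure_induction with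
  | mem p hp =>
    obtain ⟨i, rfl⟩ := hp
    obtain ⟨d, hd, hlt⟩ := hPQ i
    refine ⟨d, hd, Λ (Q i), Algebra.subset_adjoin ⟨i, rfl⟩, ?_⟩
    rw [← neg_sub, ← map_sub]
    exact neg_mem (hΛ.mem_of_degree_lt hlt)
  | one =>
    refine ⟨0, MvPolynomial.isHomogeneous_one _ _, 1, one_mem _, ?_⟩
    have h := hΛ 0
    simp only [map_zero, Multiset.toList_zero, List.map_nil, wordProd_nil] at h
    rw [← neg_sub]
    exact neg_mem h
  | mul p p' _ _ hp hp' =>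
    obtain ⟨e, he, T, hT, h⟩ := hp
    obtain ⟨e', he', T', hT', h'⟩ := hp'
    refine ⟨e + e', he.mul he', T * T', mul_mem hT hT', ?_⟩
    have hT1 : T ∈ wordFilt W (e + 1) := by
      simpa using add_mem (wordFilt_mono (Nat.le_succ e) h) (hΛ.mem he)
    have h₁ : T * (T' - Λ p') ∈ wordFilt W (e + e') := wordFilt_mul (by omega) hT1 h'
    have h₂ : (T - Λ p) * Λ p' ∈ wordFilt W (e + e') := wordFilt_mul (by omega) h (hΛ.mem he')
    have := add_mem (add_mem h₁ h₂) (hΛ.mul_sub_mem hW he he')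
    convert this using 1
    noncomm_ring

/-- An expression of `p` through the generators may mix degrees. Taking the component of degree `k`
discards the products of other degrees and leaves `p` unchanged. -/
theorem exists_lift_of_mem_adjoin
    (hW : ∀ a b, W a * W b - W b * W a ∈ wordFilt W 2) (hΛ : IsQuantization W Λ)
    (hPQ : ∀ i, ∃ d, (P i).IsHomogeneous d ∧ ∀ α ∈ (P i - Q i).support, α.degree < d)
    {p : MvPolynomial (Fin r) ℂ} (hp : p ∈ Algebra.adjoin ℂ (Set.range P)) {k : ℕ}
    (hk : p.IsHomogeneous k) :
    ∃ T ∈ Algebra.adjoin ℂ (Set.range fun i => Λ (Q i)), T - Λ p ∈ wordFilt W k := by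
  have key : ∃ T ∈ Algebra.adjoin ℂ (Set.range fun i => Λ (Q i)),
      T - Λ (MvPolynomial.homogeneousComponent k p) ∈ wordFilt W k := by
    have hp' : p ∈ Submodule.span ℂ (Submonoid.closure (Set.range P) :
        Set (MvPolynomial (Fin r) ℂ)) := by
      rw [← Algebra.adjoin_eq_span]; exact hp
    clear hp hk
    induction hp' using Submodule.span_induction with
    | mem q hq =>
      obtain ⟨e, he, T, hT, h⟩ := exists_lift_of_mem_closure hW hΛ hPQ hq
      by_cases hek : k = e
      · subst hek
        refine ⟨T, hT, ?_⟩
        rwa [MvPolynomial.homogeneousComponent_of_mem he, if_pos rfl]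
      · refine ⟨0, zero_mem _, ?_⟩
        rw [MvPolynomial.homogeneousComponent_of_mem he, if_neg (fun h => hek h)]
        simp
    | zero => exact ⟨0, zero_mem _, by simp⟩
    | add q q' _ _ hq hq' =>
      obtain ⟨T, hT, h⟩ := hq
      obtain ⟨T', hT', h'⟩ := hq'
      refine ⟨T + T', add_mem hT hT', ?_⟩
      rw [map_add, map_add, add_sub_add_comm]
      exact add_mem h h'
    | smul c q _ hq =>
      obtain ⟨T, hT, h⟩ := hq
      refine ⟨c • T, Subalgebra.smul_mem _ hT c, ?_⟩
      rw [map_smul, map_smul, ← smul_sub]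
      exact Submodule.smul_mem _ _ h
  rwa [MvPolynomial.homogeneousComponent_of_mem hk, if_pos rfl] at key

/-- If the invariant symbols are generated by homogeneous polynomials that lift to operators
invariant modulo the ideal, then these lifts generate the invariant operators modulo the ideal. -/
theorem adjoin_eq_range_of_symbols
    (hW : ∀ a b, W a * W b - W b * W a ∈ wordFilt W 2)
    (hW' : ∀ i j, W (Sum.inr i) * W (Sum.inr j) -
      W (Sum.inr j) * W (Sum.inr i) ∈ Submodule.span ℂ (Set.range (W ∘ Sum.inr)))
    (hsep : ∀ γ : Multiset (Fin r ⊕ Fin s), ∃ p : A →ₗ[ℂ] ℂ, ∀ l : List (Fin r ⊕ Fin s),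
      l.length ≤ γ.card → (p (wordProd W l) ≠ 0 ↔ (l : Multiset (Fin r ⊕ Fin s)) = γ))
    (hΛ : IsQuantization W Λ)
    (hPQ : ∀ i, ∃ d, (P i).IsHomogeneous d ∧ ∀ α ∈ (P i - Q i).support, α.degree < d)
    {K : Type*} (ad : K → A →ₗ[ℂ] A) (τ : K → MvPolynomial (Fin r) ℂ → MvPolynomial (Fin r) ℂ)
    (hadF : ∀ h k x, x ∈ wordFilt W k → ad h x ∈ wordFilt W k)
    (hadI : ∀ h x, x ∈ wordIdeal W → ad h x ∈ wordIdeal W)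
    (hτ : ∀ h d p, p.IsHomogeneous d → (τ h p).IsHomogeneous d ∧
      ad h (Λ p) - Λ (τ h p) ∈ wordFilt W d ⊔ wordIdeal W)
    (hP : ∀ p, (∀ h, τ h p = p) → p ∈ Algebra.adjoin ℂ (Set.range P))
    (M : Subalgebra ℂ A) (hMF : ∀ x ∈ M, ∃ k, x ∈ wordFilt W k)
    (hM : ∀ x ∈ M, ∀ h, ad h x - x ∈ wordIdeal W) (hQ : ∀ i, Λ (Q i) ∈ M)
    {B : Type*} [Semiring B] [Algebra ℂ B] (ρ : M →ₐ[ℂ] B)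
    (hρ : ∀ x : M, (x : A) ∈ wordIdeal W → ρ x = 0) :
    Algebra.adjoin ℂ (Set.range fun i => ρ ⟨Λ (Q i), hQ i⟩) = ρ.range := by
  set q : κ → M := fun i => ⟨Λ (Q i), hQ i⟩
  have hadj : Algebra.adjoin ℂ (Set.range fun i => ρ (q i)) =
      (Algebra.adjoin ℂ (Set.range q)).map ρ := by
    rw [AlgHom.map_adjoin, ← Set.range_comp]
    rfl
  refine le_antisymm ?_ ?_
  · rw [hadj]
    rintro _ ⟨x, -, rfl⟩
    exact ⟨x, rfl⟩
  have hadF' : ∀ h k x, x ∈ wordFilt W k ⊔ wordIdeal W →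
      ad h x ∈ wordFilt W k ⊔ wordIdeal W := by
    intro h k x hx
    obtain ⟨u, hu, v, hv, rfl⟩ := Submodule.mem_sup.1 hx
    rw [map_add]
    exact add_mem (Submodule.mem_sup_left (hadF h k u hu)) (Submodule.mem_sup_right (hadI h v hv))
  -- Induction on the order modulo the ideal; at `0` only the ideal is left, and `ρ` kills it.
  have key : ∀ (k : ℕ) (x : M), (x : A) ∈ wordFilt W k ⊔ wordIdeal W →
      ρ x ∈ (Algebra.adjoin ℂ (Set.range q)).map ρ := by
    intro k
    induction k with
    | zero =>
      intro x hx
      rw [wordFilt_zero, bot_sup_eq] at hx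
      rw [hρ x hx]
      exact zero_mem _
    | succ k ih =>
      intro x hx
      obtain ⟨u, hu, v, hv, huv⟩ := Submodule.mem_sup.1 hx
      obtain ⟨p, hp, hup⟩ := hΛ.exists_sub_mem hW hu
      have hxp : (x : A) - Λ p ∈ wordFilt W k ⊔ wordIdeal W := by
        have := add_mem hup (Submodule.mem_sup_right (S := wordFilt W k) hv)
        rwa [← huv, add_sub_right_comm]
      -- Since `ad h` fixes `x` modulo the ideal, `Λ (τ h p)` and `Λ p` agree modulo the ideal and
      -- lower order, and symbols are unique.
      have hinv : ∀ h, τ h p = p := by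
        intro h
        obtain ⟨h₁, h₂⟩ := hτ h k p hp
        refine sub_eq_zero.1 (hΛ.eq_zero_of_mem hW hW' hsep (h₁.sub hp) ?_)
        have h₃ := hadF' h k _ hxp
        have h₄ : ad h x - x ∈ wordFilt W k ⊔ wordIdeal W :=
          Submodule.mem_sup_right (hM x x.2 h)
        have h₅ := sub_mem (add_mem (sub_mem h₄ h₃) hxp) h₂
        convert h₅ using 1
        rw [map_sub, map_sub]
        abel
      -- The lift has the same symbol as `x`, so subtracting it lowers the order.
      obtain ⟨T, hT, hTp⟩ := exists_lift_of_mem_adjoin hW hΛ hPQ (hP p hinv) hp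
      have e : Algebra.adjoin ℂ (Set.range fun i => Λ (Q i)) =
          (Algebra.adjoin ℂ (Set.range q)).map M.val := by
        rw [AlgHom.map_adjoin, ← Set.range_comp]
        rfl
      rw [e] at hT
      obtain ⟨t, ht, rfl⟩ := hT
      have hxt : ((x - t : M) : A) ∈ wordFilt W k ⊔ wordIdeal W := by
        have := sub_mem hxp (Submodule.mem_sup_left (T := wordIdeal W) hTp)
        convert this using 1
        change (x : A) - t = x - Λ p - (t - Λ p)
        abel
      have h₁ := add_mem (ih (x - t) hxt) (⟨t, ht, rfl⟩ :
        ρ t ∈ (Algebra.adjoin ℂ (Set.range q)).map ρ)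
      rwa [← map_add, sub_add_cancel] at h₁
  rw [hadj]
  rintro _ ⟨x, rfl⟩
  obtain ⟨k, hk⟩ := hMF x x.2
  exact key k x (Submodule.mem_sup_left hk)

end Generators
end InvDiffOp

namespace InvDiffOp
variable {E : Type*} [NormedAddCommGroup E] [NormedSpace ℝ E]
  {G : Type*} [TopologicalSpace G] [ChartedSpace E G] [Group G] [LieGroup 𝓘(ℝ, E) ∞ G]
  [FiniteDimensional ℝ E] [T2Space G] {H : Subgroup G} (χ : H →ₜ* ℂˣ)

/-! ### The Lie algebra of the subgroup and the differential of the character -/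

variable (E) in
/-- The differential of the character, extended linearly to the whole Lie algebra. -/
def charDeriv : GroupLieAlgebra 𝓘(ℝ, E) G →ₗ[ℝ] ℂ := (exists_charDeriv (E := E) χ).choose

variable {χ} in
theorem IsExpCurve.character_eq {γ : ℝ → G} {X : GroupLieAlgebra 𝓘(ℝ, E) G}
    (hγ : IsExpCurve γ X) (hH : ∀ t, γ t ∈ H) (t : ℝ) :
    ((χ ⟨γ t, hH t⟩ : ℂˣ) : ℂ) = Complex.exp (t * charDeriv E χ X) :=
  (exists_charDeriv (E := E) χ).choose_spec X γ hγ hH t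

theorem hasDerivAt_exp_mul (a : ℂ) : HasDerivAt (fun t : ℝ => Complex.exp (t * a)) a 0 := by
  have h := ((Complex.ofRealCLM.hasDerivAt (x := (0 : ℝ))).mul_const a).cexp
  simpa using h

theorem IsExpCurve.deriv_character {γ : ℝ → G} {X : GroupLieAlgebra 𝓘(ℝ, E) G}
    (hγ : IsExpCurve γ X) (hH : ∀ t, γ t ∈ H) :
    deriv (fun t : ℝ => ((χ ⟨γ t, hH t⟩ : ℂˣ) : ℂ)) 0 = charDeriv E χ X := by
  rw [funext (hγ.character_eq hH)]
  exact (hasDerivAt_exp_mul _).deriv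

theorem Ad_mem_expSet {h : G} (hh : h ∈ H) {X : GroupLieAlgebra 𝓘(ℝ, E) G}
    (hX : X ∈ expSet E H) : Ad h X ∈ expSet E H := by
  obtain ⟨γ, hγ, hH⟩ := hX
  exact ⟨_, hγ.conj h, fun t => H.mul_mem (H.mul_mem hh (hH t)) (H.inv_mem hh)⟩

theorem Ad_mem_lieSub {h : G} (hh : h ∈ H) {X : GroupLieAlgebra 𝓘(ℝ, E) G}
    (hX : X ∈ lieSub E H) : Ad h X ∈ lieSub E H := by
  rw [lieSub_eq] at hX ⊢
  induction hX using Submodule.span_induction with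
  | mem X hX => exact Submodule.subset_span (Ad_mem_expSet hh hX)
  | zero => rw [map_zero]; exact zero_mem _
  | add X Y _ _ hX hY => rw [map_add]; exact add_mem hX hY
  | smul c X _ hX => rw [map_smul]; exact Submodule.smul_mem _ _ hX

/-- The values of `χ` commute, so conjugation by `h` does not change `χ` along a one-parameter
subgroup; linearity extends this to the span. -/
theorem charDeriv_Ad {h : G} (hh : h ∈ H) {X : GroupLieAlgebra 𝓘(ℝ, E) G}
    (hX : X ∈ lieSub E H) : charDeriv E χ (Ad h X) = charDeriv E χ X := by
  rw [lieSub_eq] at hX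
  induction hX using Submodule.span_induction with
  | mem X hX =>
    obtain ⟨γ, hγ, hH⟩ := hX
    have hH' : ∀ t, h * γ t * h⁻¹ ∈ H :=
      fun t => H.mul_mem (H.mul_mem hh (hH t)) (H.inv_mem hh)
    have e : (fun t : ℝ => ((χ ⟨h * γ t * h⁻¹, hH' t⟩ : ℂˣ) : ℂ)) =
        fun t : ℝ => ((χ ⟨γ t, hH t⟩ : ℂˣ) : ℂ) := by
      funext t
      have : (⟨h * γ t * h⁻¹, hH' t⟩ : H) = ⟨h, hh⟩ * ⟨γ t, hH t⟩ * ⟨h, hh⟩⁻¹ := rfl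
      rw [this, map_mul, map_mul, map_inv, mul_right_comm, mul_inv_cancel, one_mul]
    rw [← (hγ.conj h).deriv_character χ hH', e, hγ.deriv_character χ hH]
  | zero => rw [map_zero]
  | add X Y _ _ hX hY => rw [map_add, map_add, map_add, hX, hY]
  | smul c X _ hX => rw [map_smul, map_smul, map_smul, hX]

variable (E) in
/-- The operator `X̃ + dχ(X)`. -/
def shiftVF (X : GroupLieAlgebra 𝓘(ℝ, E) G) : Op E G :=
  leftVF X + charDeriv E χ X • (1 : Op E G)

theorem shiftVF_add (X Y : GroupLieAlgebra 𝓘(ℝ, E) G) :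
    shiftVF E χ (X + Y) = shiftVF E χ X + shiftVF E χ Y := by
  rw [shiftVF, leftVF_add, map_add, add_smul, add_add_add_comm]; rfl

theorem shiftVF_smul (c : ℝ) (X : GroupLieAlgebra 𝓘(ℝ, E) G) :
    shiftVF E χ (c • X) = (c : ℂ) • shiftVF E χ X := by
  rw [shiftVF, leftVF_smul, map_smul, shiftVF, smul_add, smul_smul]; rfl

theorem shiftVF_zero : shiftVF E χ (0 : GroupLieAlgebra 𝓘(ℝ, E) G) = 0 := by
  rw [shiftVF, leftVF_zero, map_zero, zero_smul, add_zero]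

theorem shiftVF_sum {ι : Type*} (s : Finset ι) (Y : ι → GroupLieAlgebra 𝓘(ℝ, E) G) :
    shiftVF E χ (∑ i ∈ s, Y i) = ∑ i ∈ s, shiftVF E χ (Y i) := by
  classical
  induction s using Finset.induction_on with
  | empty => simp [shiftVF_zero]
  | insert a s ha ih => rw [Finset.sum_insert ha, Finset.sum_insert ha, shiftVF_add, ih]

theorem hChi_eq_span : hChi E H χ = Submodule.span ℂ (shiftVF E χ '' (expSet E H)) := by
  unfold hChi
  congr 1
  ext D
  constructor
  · rintro ⟨X, γ, hγ, hX, rfl⟩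
    refine ⟨X, ⟨γ, hX, hγ⟩, ?_⟩
    rw [hX.deriv_character χ hγ, shiftVF]
  · rintro ⟨X, ⟨γ, hX, hγ⟩, rfl⟩
    refine ⟨X, γ, hγ, hX, ?_⟩
    rw [hX.deriv_character χ hγ, shiftVF]

theorem shiftVF_mem_hChi {X : GroupLieAlgebra 𝓘(ℝ, E) G} (hX : X ∈ lieSub E H) :
    shiftVF E χ X ∈ hChi E H χ := by
  rw [lieSub_eq] at hX
  induction hX using Submodule.span_induction with
  | mem X hX => rw [hChi_eq_span]; exact Submodule.subset_span ⟨X, hX, rfl⟩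
  | zero => rw [shiftVF_zero]; exact zero_mem _
  | add X Y _ _ hX hY => rw [shiftVF_add]; exact add_mem hX hY
  | smul c X _ hX => rw [shiftVF_smul]; exact Submodule.smul_mem _ _ hX

theorem subset_lieSub : expSet E H ⊆ lieSub E H := Submodule.subset_span

theorem hChi_eq_span_range {s : ℕ} (c : Module.Basis (Fin s) ℝ (lieSub E H)) :
    hChi E H χ = Submodule.span ℂ (Set.range fun j =>
      shiftVF E χ (c j : GroupLieAlgebra 𝓘(ℝ, E) G)) := by
  refine le_antisymm ?_ (Submodule.span_le.2 ?_)
  · rw [hChi_eq_span]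
    refine Submodule.span_le.2 ?_
    rintro _ ⟨X, hX, rfl⟩
    have h := congrArg (Submodule.subtype _) (c.sum_repr ⟨X, subset_lieSub hX⟩)
    rw [map_sum] at h
    have h' : X = ∑ j, c.repr ⟨X, subset_lieSub hX⟩ j • (c j : GroupLieAlgebra 𝓘(ℝ, E) G) :=
      h.symm
    rw [h', shiftVF_sum]
    refine sum_mem fun j _ => ?_
    rw [shiftVF_smul]
    exact Submodule.smul_mem _ _ (Submodule.subset_span ⟨j, rfl⟩)
  · rintro _ ⟨j, rfl⟩
    exact shiftVF_mem_hChi χ (c j).2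

/-- A subspace invariant under `Ad(γ(t))` contains the derivative. -/
theorem mem_of_hasDerivAt_Ad (p : Submodule ℝ (GroupLieAlgebra 𝓘(ℝ, E) G)) {γ : ℝ → G}
    {Y Z : GroupLieAlgebra 𝓘(ℝ, E) G} (hp : ∀ t, Ad (γ t) Y ∈ p)
    (h : ∀ L : GroupLieAlgebra 𝓘(ℝ, E) G →ₗ[ℝ] ℝ,
      HasDerivAt (fun t => L (Ad (γ t) Y)) (L Z) 0) : Z ∈ p := by
  by_contra hZ
  obtain ⟨L, hL, hLp⟩ := Submodule.exists_le_ker_of_notMem hZ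
  have h₁ := h L
  have e : (fun t => L (Ad (γ t) Y)) = fun _ => 0 := funext fun t => hLp (hp t)
  rw [e] at h₁
  exact hL (h₁.unique (hasDerivAt_const _ _))

/-- By `charDeriv_Ad` the differential of `χ` is constant along `Ad(γ(t)) Y`; its real and imaginary
parts are real forms to which the hypothesis applies. For `Z` a bracket this is the vanishing on
brackets. -/
theorem charDeriv_eq_zero_of_hasDerivAt_Ad {γ : ℝ → G} (hγ : ∀ t, γ t ∈ H)
    {Y Z : GroupLieAlgebra 𝓘(ℝ, E) G} (hY : Y ∈ lieSub E H)
    (h : ∀ L : GroupLieAlgebra 𝓘(ℝ, E) G →ₗ[ℝ] ℝ,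
      HasDerivAt (fun t => L (Ad (γ t) Y)) (L Z) 0) : charDeriv E χ Z = 0 := by
  refine Complex.ext ?_ ?_
  · have h₁ := h (Complex.reLm ∘ₗ charDeriv E χ)
    have e : (fun t => (Complex.reLm ∘ₗ charDeriv E χ) (Ad (γ t) Y)) =
        fun _ => (charDeriv E χ Y).re :=
      funext fun t => congrArg Complex.re (charDeriv_Ad χ (hγ t) hY)
    rw [e] at h₁
    exact h₁.unique (hasDerivAt_const _ _)
  · have h₁ := h (Complex.imLm ∘ₗ charDeriv E χ)
    have e : (fun t => (Complex.imLm ∘ₗ charDeriv E χ) (Ad (γ t) Y)) =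
        fun _ => (charDeriv E χ Y).im :=
      funext fun t => congrArg Complex.im (charDeriv_Ad χ (hγ t) hY)
    rw [e] at h₁
    exact h₁.unique (hasDerivAt_const _ _)

/-- The commutator of elements of `𝔥^χ` is in `𝔥^χ`. -/
theorem exists_commutator_shiftVF {X Y : GroupLieAlgebra 𝓘(ℝ, E) G} (hX : X ∈ lieSub E H)
    (hY : Y ∈ lieSub E H) : ∃ D ∈ hChi E H χ,
      shiftVF E χ X * shiftVF E χ Y = shiftVF E χ Y * shiftVF E χ X + D := by
  rw [lieSub_eq] at hX
  induction hX using Submodule.span_induction with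
  | mem X hX =>
    obtain ⟨γ, hγ, hH⟩ := hX
    obtain ⟨Z, hZ, hd⟩ := exists_bracket X Y
    have hZ1 : Z ∈ lieSub E H :=
      mem_of_hasDerivAt_Ad _ (fun t => Ad_mem_lieSub (hH t) hY) (hd γ hγ)
    -- The constants drop out of the commutator, leaving `Z̃` without shift; it belongs to `𝔥^χ`
    -- because its shift would be zero.
    have hZ2 : charDeriv E χ Z = 0 := charDeriv_eq_zero_of_hasDerivAt_Ad χ hH hY (hd γ hγ)
    refine ⟨shiftVF E χ Z, shiftVF_mem_hChi χ hZ1, ?_⟩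
    simp only [shiftVF, hZ2, zero_smul, add_zero, add_mul, mul_add, hZ, smul_mul_assoc,
      mul_smul_comm, one_mul, mul_one, smul_add, smul_smul,
      mul_comm (charDeriv E χ Y) (charDeriv E χ X)]
    abel
  | zero => exact ⟨0, zero_mem _, by simp [shiftVF_zero]⟩
  | add X X' _ _ hX hX' =>
    obtain ⟨D, hD, e⟩ := hX
    obtain ⟨D', hD', e'⟩ := hX'
    refine ⟨D + D', add_mem hD hD', ?_⟩
    rw [shiftVF_add, add_mul, mul_add, e, e', add_add_add_comm]
  | smul a X _ hX =>
    obtain ⟨D, hD, e⟩ := hX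
    refine ⟨(a : ℂ) • D, Submodule.smul_mem _ _ hD, ?_⟩
    rw [shiftVF_smul, smul_mul_assoc, mul_smul_comm, e, smul_add]

end InvDiffOp

namespace InvDiffOp
variable {E : Type*} [NormedAddCommGroup E] [NormedSpace ℝ E]
  {G : Type*} [TopologicalSpace G] [ChartedSpace E G] [Group G] [LieGroup 𝓘(ℝ, E) ∞ G]
  [FiniteDimensional ℝ E] [T2Space G] {H : Subgroup G} (χ : H →ₜ* ℂˣ)
  {𝔪 : Submodule ℝ (GroupLieAlgebra 𝓘(ℝ, E) G)} (hc : IsCompl 𝔪 (lieSub E H))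
  {r s : ℕ} (b : Module.Basis (Fin r) ℝ 𝔪) (c : Module.Basis (Fin s) ℝ (lieSub E H))

section Generic
variable {A : Type*} [Ring A] [Algebra ℂ A]

theorem sub_mem_of_eq_add {p : Submodule ℂ A} {x y z : A} (h : x = y + z) (hz : z ∈ p) :
    x - y ∈ p := by
  rwa [h, add_sub_cancel_left]

theorem inv_smul_sum_sub {κ : Type*} [Fintype κ] (f : κ → A) (w : A) {z : ℂ} (hz : z ≠ 0)
    (hκ : (Fintype.card κ : ℂ) = z) : z⁻¹ • ∑ i, f i - w = z⁻¹ • ∑ i, (f i - w) := by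
  rw [Finset.sum_sub_distrib, smul_sub, Finset.sum_const, Finset.card_univ,
    ← Nat.cast_smul_eq_nsmul ℂ, hκ, inv_smul_smul₀ hz]

end Generic

/-! ### A basis adapted to the decomposition of the Lie algebra -/

/-- The union of the bases of `𝔪` and `𝔥`. -/
def adaptedBasis : Module.Basis (Fin r ⊕ Fin s) ℝ (GroupLieAlgebra 𝓘(ℝ, E) G) :=
  (b.prod c).map (Submodule.prodEquivOfIsCompl 𝔪 (lieSub E H) hc)

theorem adaptedBasis_inl (i : Fin r) : adaptedBasis hc b c (Sum.inl i) = b i := by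
  simp [adaptedBasis]

theorem adaptedBasis_inr (j : Fin s) : adaptedBasis hc b c (Sum.inr j) = c j := by
  simp [adaptedBasis]

theorem adaptedBasis_repr_inl (Y : GroupLieAlgebra 𝓘(ℝ, E) G) (i : Fin r) :
    (adaptedBasis hc b c).repr Y (Sum.inl i) =
      b.repr (𝔪.projectionOnto (lieSub E H) hc Y) i := by
  obtain ⟨p, rfl⟩ := (Submodule.prodEquivOfIsCompl 𝔪 (lieSub E H) hc).surjective Y
  simp [adaptedBasis]

/-- The operators `X̃` for `X` in the basis of `𝔪` and `X̃ + dχ(X)` for `X` in the basis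
of `𝔥`. -/
def letter : Fin r ⊕ Fin s → Op E G :=
  fun a => leftVF (adaptedBasis hc b c a) +
    (Sum.elim (fun _ => 0) (fun j => charDeriv E χ (c j : GroupLieAlgebra 𝓘(ℝ, E) G)) a : ℂ) •
      (1 : Op E G)

theorem letter_inl (i : Fin r) :
    letter χ hc b c (Sum.inl i) = leftVF (b i : GroupLieAlgebra 𝓘(ℝ, E) G) := by
  rw [letter, adaptedBasis_inl, Sum.elim_inl, zero_smul, add_zero]

theorem letter_inr (j : Fin s) :
    letter χ hc b c (Sum.inr j) = shiftVF E χ (c j : GroupLieAlgebra 𝓘(ℝ, E) G) := by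
  rw [letter, adaptedBasis_inr, Sum.elim_inr, shiftVF]

/-- Expansion in the adapted basis, where passing to shifted letters costs only a constant. Applied
to `Ad(h)` of a basis vector of `𝔪`, the explicit coefficients are the matrix entries of `sigmaAd`.
-/
theorem exists_leftVF_eq_sum_letter (Y : GroupLieAlgebra 𝓘(ℝ, E) G) :
    ∃ (β : Fin s → ℂ) (κ : ℂ), leftVF Y =
      ∑ i, ((b.repr (𝔪.projectionOnto (lieSub E H) hc Y) i : ℝ) : ℂ) •
        letter χ hc b c (Sum.inl i) +
      ∑ j, β j • letter χ hc b c (Sum.inr j) + κ • (1 : Op E G) := by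
  set e := adaptedBasis hc b c
  refine ⟨fun j => ((e.repr Y (Sum.inr j) : ℝ) : ℂ), -∑ j, ((e.repr Y (Sum.inr j) : ℝ) : ℂ) *
    charDeriv E χ (c j : GroupLieAlgebra 𝓘(ℝ, E) G), ?_⟩
  have h := congrArg leftVF (e.sum_repr Y)
  rw [leftVF_sum, Fintype.sum_sum_type] at h
  rw [← h]
  simp only [letter_inl, letter_inr, shiftVF, leftVF_smul, smul_add, Finset.sum_add_distrib,
    smul_smul, e, adaptedBasis_inl, adaptedBasis_inr, adaptedBasis_repr_inl, ← Finset.sum_smul]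
  rw [add_assoc, add_assoc, ← add_smul, add_neg_cancel, zero_smul, add_zero]

theorem leftVF_mem_wordFilt (Y : GroupLieAlgebra 𝓘(ℝ, E) G) :
    leftVF Y ∈ wordFilt (letter χ hc b c) 2 := by
  obtain ⟨β, κ, h⟩ := exists_leftVF_eq_sum_letter χ hc b c Y
  rw [h]
  exact add_mem (add_mem (sum_mem fun j _ => Submodule.smul_mem _ _ (letter_mem_wordFilt _))
    (sum_mem fun j _ => Submodule.smul_mem _ _ (letter_mem_wordFilt _)))
    (Submodule.smul_mem _ _ (one_mem_wordFilt (by omega)))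

theorem letter_commutator_mem_wordFilt (a a' : Fin r ⊕ Fin s) :
    letter χ hc b c a * letter χ hc b c a' - letter χ hc b c a' * letter χ hc b c a ∈
      wordFilt (letter χ hc b c) 2 := by
  obtain ⟨Z, hZ, -⟩ := exists_bracket (adaptedBasis hc b c a) (adaptedBasis hc b c a')
  have e : letter χ hc b c a * letter χ hc b c a' =
      letter χ hc b c a' * letter χ hc b c a + leftVF Z := by
    simp only [letter, add_mul, mul_add, hZ, smul_mul_assoc, mul_smul_comm, one_mul, mul_one,
      smul_add, smul_smul]
    rw [mul_comm (Sum.elim _ _ a' : ℂ)]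
    abel
  exact sub_mem_of_eq_add (A := Op E G) e (leftVF_mem_wordFilt χ hc b c Z)

theorem letter_inr_commutator_mem (i j : Fin s) :
    letter χ hc b c (Sum.inr i) * letter χ hc b c (Sum.inr j) -
      letter χ hc b c (Sum.inr j) * letter χ hc b c (Sum.inr i) ∈
      Submodule.span ℂ (Set.range (letter χ hc b c ∘ Sum.inr)) := by
  obtain ⟨D, hD, e⟩ := exists_commutator_shiftVF χ (c i).2 (c j).2
  rw [hChi_eq_span_range χ c, ← funext (letter_inr χ hc b c)] at hD
  rw [← letter_inr χ hc b c, ← letter_inr χ hc b c] at e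
  exact sub_mem_of_eq_add (A := Op E G) e hD

theorem hChi_eq_span_letter :
    hChi E H χ = Submodule.span ℂ (Set.range (letter χ hc b c ∘ Sum.inr)) := by
  rw [hChi_eq_span_range χ c, ← funext (letter_inr χ hc b c)]
  rfl

theorem letter_mem_envAlg (a : Fin r ⊕ Fin s) : letter χ hc b c a ∈ envAlg E G :=
  add_mem (leftVF_mem_envAlg _) (Subalgebra.smul_mem _ (one_mem _) _)

theorem wordProd_letter_mem_envAlg (l : List (Fin r ⊕ Fin s)) :
    wordProd (letter χ hc b c) l ∈ envAlg E G :=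
  list_prod_mem fun x hx => by
    obtain ⟨a, -, rfl⟩ := List.mem_map.1 hx
    exact letter_mem_envAlg χ hc b c a

theorem exists_mem_wordFilt {D : Op E G} (hD : D ∈ envAlg E G) :
    ∃ k, D ∈ wordFilt (letter χ hc b c) k := by
  induction hD using Algebra.adjoin_induction with
  | mem x hx => obtain ⟨Y, rfl⟩ := hx; exact ⟨2, leftVF_mem_wordFilt χ hc b c Y⟩
  | algebraMap z =>
    refine ⟨1, ?_⟩
    rw [Algebra.algebraMap_eq_smul_one]
    exact Submodule.smul_mem _ _ (one_mem_wordFilt (by omega))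
  | add x y _ _ hx hy =>
    obtain ⟨j, hj⟩ := hx
    obtain ⟨k, hk⟩ := hy
    exact ⟨max j k, add_mem (wordFilt_mono (le_max_left _ _) hj)
      (wordFilt_mono (le_max_right _ _) hk)⟩
  | mul x y _ _ hx hy =>
    obtain ⟨j, hj⟩ := hx
    obtain ⟨k, hk⟩ := hy
    exact ⟨j + k, wordFilt_mul (by omega) hj hk⟩

/-- Elements of `𝔻(G)` are combinations of words, and `𝔥^χ` is the span of the letters of the second
kind. -/
theorem leftIdeal_eq_wordIdeal : leftIdeal E H χ = wordIdeal (letter χ hc b c) := by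
  refine le_antisymm (Submodule.span_le.2 ?_) (Submodule.span_le.2 ?_)
  · rintro _ ⟨v, hv, w, hw, rfl⟩
    obtain ⟨k, hk⟩ := exists_mem_wordFilt χ hc b c (mem_invDiffOps_iff.1 hv)
    rw [hChi_eq_span_letter χ hc b c] at hw
    rw [SetLike.mem_coe]
    induction hw using Submodule.span_induction with
    | mem w hw => obtain ⟨j, rfl⟩ := hw; exact mul_mem_wordIdeal hk j
    | zero => rw [mul_zero]; exact zero_mem _
    | add x y _ _ hx hy => rw [mul_add]; exact add_mem hx hy
    | smul a x _ hx => rw [mul_smul_comm]; exact Submodule.smul_mem _ _ hx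
  · rintro _ ⟨l, j, rfl⟩
    refine Submodule.subset_span ⟨_, mem_invDiffOps_iff.2 (wordProd_letter_mem_envAlg χ hc b c l),
      _, ?_, rfl⟩
    rw [hChi_eq_span_letter χ hc b c]
    exact Submodule.subset_span ⟨j, rfl⟩

/-! ### The symmetrization is a quantization -/

theorem wordProd_inl (l : List (Fin r)) : wordProd (letter χ hc b c) (l.map Sum.inl) =
    (l.map fun i => leftVF (b i : GroupLieAlgebra 𝓘(ℝ, E) G)).prod := by
  rw [wordProd, List.map_map]
  congr 2
  exact funext (letter_inl χ hc b c)

theorem symmetrization_monomial (α : Fin r →₀ ℕ) :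
    symmetrization (fun j => (b j : GroupLieAlgebra 𝓘(ℝ, E) G)) (MvPolynomial.monomial α 1) =
      symProd fun i : Fin α.toMultiset.toList.length =>
        (b (α.toMultiset.toList.get i) : GroupLieAlgebra 𝓘(ℝ, E) G) := by
  have h := (MvPolynomial.basisMonomials (Fin r) ℂ).constr_basis ℂ (fun s : Fin r →₀ ℕ =>
    symProd fun i : Fin s.toMultiset.toList.length =>
      (b (s.toMultiset.toList.get i) : GroupLieAlgebra 𝓘(ℝ, E) G)) α
  rwa [MvPolynomial.coe_basisMonomials] at h

/-- All summands of a symmetrized product are rearrangements of one word, so each differs from it in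
lower order, and so does their average. -/
theorem isQuantization_symmetrization : IsQuantization (letter χ hc b c)
    (symmetrization fun j => (b j : GroupLieAlgebra 𝓘(ℝ, E) G)) := by
  intro α
  rw [symmetrization_monomial]
  set l := α.toMultiset.toList with hl
  have hlen : l.length = α.degree := length_toList_toMultiset α
  rw [← hlen]
  set W := letter χ hc b c
  set m := l.length
  have e : ∀ σ : Equiv.Perm (Fin m), (List.ofFn fun i =>
      leftVF (b (l.get (σ i)) : GroupLieAlgebra 𝓘(ℝ, E) G)).prod =
      wordProd W ((List.ofFn fun i => l.get (σ i)).map Sum.inl) := by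
    intro σ
    rw [wordProd_inl, List.map_ofFn]
    rfl
  have hm : ((m.factorial : ℂ)) ≠ 0 := by exact_mod_cast m.factorial_ne_zero
  have hsum : symProd (fun i : Fin m => (b (l.get i) : GroupLieAlgebra 𝓘(ℝ, E) G)) -
      wordProd W (l.map Sum.inl) = (m.factorial : ℂ)⁻¹ • ∑ σ : Equiv.Perm (Fin m),
        (wordProd W ((List.ofFn fun i => l.get (σ i)).map Sum.inl) -
          wordProd W (l.map Sum.inl)) := by
    rw [symProd, Finset.sum_congr rfl fun σ _ => e σ]
    exact inv_smul_sum_sub (A := Op E G) (κ := Equiv.Perm (Fin m)) _ _ hm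
      (by rw [Fintype.card_perm, Fintype.card_fin])
  rw [hsum]
  refine Submodule.smul_mem _ _ (sum_mem fun σ _ => ?_)
  have hp : ((List.ofFn fun i => l.get (σ i)).map Sum.inl : List (Fin r ⊕ Fin s)).Perm
      (l.map Sum.inl) := by
    refine List.Perm.map _ ?_
    have := Equiv.Perm.ofFn_comp_perm σ l.get
    rwa [List.ofFn_get] at this
  have := wordProd_sub_mem_wordFilt (letter_commutator_mem_wordFilt χ hc b c) hp
  rwa [List.length_map, List.length_ofFn] at this

end InvDiffOp

namespace InvDiffOp

/-! ### Differentiable curves in finite-dimensional subspaces of an algebra -/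

section Curves
variable {A : Type*} [Ring A] [Algebra ℂ A]

/-- The curve `c` runs in a finite-dimensional subspace and has the derivative `c'` at `0`. -/
def HasFinDeriv (c : ℝ → A) (c' : A) : Prop :=
  ∃ (ι : Type) (_ : Fintype ι) (u : ι → ℝ → ℂ) (u' : ι → ℂ) (B : ι → A),
    (∀ t, c t = ∑ i, u i t • B i) ∧ (∀ i, HasDerivAt (u i) (u' i) 0) ∧ c' = ∑ i, u' i • B i

theorem hasFinDeriv_const (x : A) : HasFinDeriv (fun _ => x) 0 :=
  ⟨Unit, inferInstance, fun _ _ => 1, fun _ => 0, fun _ => x, by simp,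
    fun _ => hasDerivAt_const _ _, by simp⟩

theorem HasFinDeriv.add {c d : ℝ → A} {c' d' : A} (hc : HasFinDeriv c c')
    (hd : HasFinDeriv d d') : HasFinDeriv (fun t => c t + d t) (c' + d') := by
  obtain ⟨ι, _, u, u', B, h₁, h₂, h₃⟩ := hc
  obtain ⟨κ, _, v, v', C, k₁, k₂, k₃⟩ := hd
  refine ⟨ι ⊕ κ, inferInstance, Sum.elim u v, Sum.elim u' v', Sum.elim B C, fun t => ?_, ?_, ?_⟩
  · beta_reduce
    rw [Fintype.sum_sum_type, h₁, k₁]; rfl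
  · rintro (i | i)
    · exact h₂ i
    · exact k₂ i
  · rw [Fintype.sum_sum_type, h₃, k₃]; rfl

theorem HasFinDeriv.mul {c d : ℝ → A} {c' d' : A} (hc : HasFinDeriv c c')
    (hd : HasFinDeriv d d') : HasFinDeriv (fun t => c t * d t) (c' * d 0 + c 0 * d') := by
  obtain ⟨ι, _, u, u', B, h₁, h₂, h₃⟩ := hc
  obtain ⟨κ, _, v, v', C, k₁, k₂, k₃⟩ := hd
  refine ⟨ι × κ, inferInstance, fun p t => u p.1 t * v p.2 t,
    fun p => u' p.1 * v p.2 0 + u p.1 0 * v' p.2, fun p => B p.1 * C p.2, fun t => ?_,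
    fun p => (h₂ p.1).mul (k₂ p.2), ?_⟩
  · beta_reduce
    rw [h₁, k₁, Fintype.sum_prod_type, Finset.sum_mul_sum]
    simp only [smul_mul_smul_comm]
  · rw [h₁, k₁, h₃, k₃, Fintype.sum_prod_type, Finset.sum_mul_sum, Finset.sum_mul_sum,
      ← Finset.sum_add_distrib]
    simp only [smul_mul_smul_comm, add_smul, Finset.sum_add_distrib]

/-- A linear form vanishing on `p` but not at `c'` would be constant along the curve and yet have a
nonzero derivative. As the curve runs in finite dimensions, no topology on `A` is involved. -/
theorem HasFinDeriv.mem {c : ℝ → A} {c' : A} (hc : HasFinDeriv c c') {p : Submodule ℂ A}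
    (h : ∀ t, c t - c 0 ∈ p) : c' ∈ p := by
  obtain ⟨ι, _, u, u', B, h₁, h₂, h₃⟩ := hc
  by_contra hp
  obtain ⟨L, hL, hLp⟩ := Submodule.exists_le_ker_of_notMem hp
  have e : (fun t => ∑ i, u i t * L (B i)) = fun _ => L (c 0) := by
    funext t
    have h₄ : L (c t - c 0) = 0 := hLp (h t)
    rw [map_sub, sub_eq_zero] at h₄
    rw [← h₄, h₁, map_sum]
    simp only [map_smul, smul_eq_mul]
  have hd : HasDerivAt (fun t => ∑ i, u i t * L (B i)) (∑ i, u' i * L (B i)) 0 :=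
    HasDerivAt.fun_sum fun i _ => (h₂ i).mul_const _
  rw [e] at hd
  have h₅ := hd.unique (hasDerivAt_const _ _)
  refine hL ?_
  rw [h₃, map_sum, ← h₅]
  simp only [map_smul, smul_eq_mul]

theorem list_prod_mem_wordFilt {ι : Type*} {W : ι → A} (l : List A)
    (h : ∀ y ∈ l, y ∈ wordFilt W 2) : l.prod ∈ wordFilt W (l.length + 1) := by
  induction l with
  | nil => exact one_mem_wordFilt (by simp)
  | cons y l ih =>
    rw [List.prod_cons, List.length_cons]
    exact wordFilt_mul (by omega) (h y (by simp)) (ih fun z hz => h z (by simp [hz]))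

theorem mul_mem_wordIdeal_of_mem_span {r s : ℕ} {W : Fin r ⊕ Fin s → A} {k : ℕ} {x w : A}
    (hx : x ∈ wordFilt W k) (hw : w ∈ Submodule.span ℂ (Set.range (W ∘ Sum.inr))) :
    x * w ∈ wordIdeal W := by
  induction hw using Submodule.span_induction with
  | mem w hw => obtain ⟨j, rfl⟩ := hw; exact mul_mem_wordIdeal hx j
  | zero => rw [mul_zero]; exact zero_mem _
  | add x y _ _ hx hy => rw [mul_add]; exact add_mem hx hy
  | smul a x _ hx => rw [mul_smul_comm]; exact Submodule.smul_mem _ _ hx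

end Curves

variable {E : Type*} [NormedAddCommGroup E] [NormedSpace ℝ E]
  {G : Type*} [TopologicalSpace G] [ChartedSpace E G] [Group G] [LieGroup 𝓘(ℝ, E) ∞ G]

/-! ### The adjoint action on operators -/

theorem rightTranslate_inv_mul (g : G) :
    rightTranslate (E := E) g⁻¹ * rightTranslate g = 1 := by
  ext f x
  simp [rightTranslate]

theorem rightTranslate_mul_inv (g : G) :
    rightTranslate (E := E) g * rightTranslate g⁻¹ = 1 := by
  ext f x
  simp [rightTranslate]

variable (E) in
/-- `Ad(g)` as an algebra endomorphism. -/
def opAdHom (g : G) : Op E G →ₐ[ℂ] Op E G :=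
  AlgHom.ofLinearMap
    ((LinearMap.mulLeft ℂ (rightTranslate g)).comp (LinearMap.mulRight ℂ (rightTranslate g⁻¹)))
    (by
      change rightTranslate g * (1 * rightTranslate g⁻¹) = 1
      rw [one_mul, rightTranslate_mul_inv])
    (fun D D' => by
      change rightTranslate g * (D * D' * rightTranslate g⁻¹) =
        rightTranslate g * (D * rightTranslate g⁻¹) * (rightTranslate g * (D' * rightTranslate g⁻¹))
      have h := rightTranslate_inv_mul (E := E) g
      calc rightTranslate g * (D * D' * rightTranslate g⁻¹)
          = rightTranslate g * D * 1 * D' * rightTranslate g⁻¹ := by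
            simp only [mul_assoc, one_mul]
        _ = _ := by rw [← h]; simp only [mul_assoc])

theorem opAdHom_apply (g : G) (D : Op E G) : opAdHom E g D = opAd g D :=
  (mul_assoc _ _ _).symm

theorem opAdHom_leftVF (g : G) (X : GroupLieAlgebra 𝓘(ℝ, E) G) :
    opAdHom E g (leftVF X) = leftVF (Ad g X) := by
  rw [opAdHom_apply, opAd_leftVF]

theorem opAdHom_one (D : Op E G) : opAdHom E (1 : G) D = D := by
  have h : rightTranslate (E := E) (1 : G) = 1 := by
    ext f x
    simp [rightTranslate]
  rw [opAdHom_apply, opAd, inv_one, h, one_mul, mul_one]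

variable [FiniteDimensional ℝ E] [T2Space G] {H : Subgroup G} (χ : H →ₜ* ℂˣ)

/-- The derivative of `Ad(exp(tX)) D` at `t = 0` is the commutator with `X̃`. -/
theorem exists_hasFinDeriv_opAdHom {γ : ℝ → G} {X : GroupLieAlgebra 𝓘(ℝ, E) G}
    (hγ : IsExpCurve γ X) {D : Op E G} (hD : D ∈ envAlg E G) :
    ∃ D' : Op E G, HasFinDeriv (fun t => opAdHom E (γ t) D) D' ∧
      leftVF X * D = D * leftVF X + D' := by
  induction hD using Algebra.adjoin_induction with
  | mem x hx =>
    obtain ⟨Y, rfl⟩ := hx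
    obtain ⟨Z, hZ, hd⟩ := exists_bracket X Y
    refine ⟨leftVF Z, ⟨Fin (Module.finrank ℝ E), inferInstance,
      fun a t => (((lieBasis E G).coord a (Ad (γ t) Y) : ℝ) : ℂ),
      fun a => (((lieBasis E G).coord a Z : ℝ) : ℂ), fun a => leftVF (lieBasis E G a),
      fun t => ?_, fun a => (hd γ hγ ((lieBasis E G).coord a)).ofReal_comp, ?_⟩, hZ⟩
    · beta_reduce
      rw [opAdHom_leftVF]
      conv_lhs => rw [← (lieBasis E G).sum_repr (Ad (γ t) Y)]
      rw [leftVF_sum]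
      exact Finset.sum_congr rfl fun a _ => leftVF_smul _ _
    · conv_lhs => rw [← (lieBasis E G).sum_repr Z]
      rw [leftVF_sum]
      exact Finset.sum_congr rfl fun a _ => leftVF_smul _ _
  | algebraMap z =>
    refine ⟨0, ?_, ?_⟩
    · have := hasFinDeriv_const (algebraMap ℂ (Op E G) z)
      simpa only [AlgHom.commutes] using this
    · rw [add_zero]
      exact (Algebra.commutes z _).symm
  | add x y _ _ hx hy =>
    obtain ⟨D, hD, e⟩ := hx
    obtain ⟨D', hD', e'⟩ := hy
    refine ⟨D + D', ?_, ?_⟩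
    · simpa only [map_add] using hD.add hD'
    · rw [mul_add, add_mul, e, e', add_add_add_comm]
  | mul x y _ _ hx hy =>
    obtain ⟨D, hD, e⟩ := hx
    obtain ⟨D', hD', e'⟩ := hy
    refine ⟨D * y + x * D', ?_, ?_⟩
    · have := hD.mul hD'
      simpa only [map_mul, hγ.1, opAdHom_one] using this
    · rw [← mul_assoc, e, add_mul, mul_assoc, e', mul_add, mul_assoc, add_assoc,
        add_comm (x * D')]

end InvDiffOp

namespace InvDiffOp
variable {E : Type*} [NormedAddCommGroup E] [NormedSpace ℝ E]
  {G : Type*} [TopologicalSpace G] [ChartedSpace E G] [Group G] [LieGroup 𝓘(ℝ, E) ∞ G]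
  [FiniteDimensional ℝ E] [T2Space G] {H : Subgroup G} (χ : H →ₜ* ℂˣ)

/-! ### The algebra of operators invariant modulo the ideal -/

theorem mul_mem_leftIdeal {D v : Op E G} (hv : v ∈ envAlg E G) (hD : D ∈ leftIdeal E H χ) :
    v * D ∈ leftIdeal E H χ := by
  unfold leftIdeal at hD
  induction hD using Submodule.span_induction with
  | mem x hx =>
    obtain ⟨u, hu, w, hw, rfl⟩ := hx
    exact Submodule.subset_span ⟨v * u, mem_invDiffOps_iff.2
      (mul_mem hv (mem_invDiffOps_iff.1 hu)), w, hw, (mul_assoc _ _ _).symm⟩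
  | zero => rw [mul_zero]; exact zero_mem _
  | add x y _ _ hx hy => rw [mul_add]; exact add_mem hx hy
  | smul a x _ hx => rw [mul_smul_comm]; exact Submodule.smul_mem _ _ hx

theorem hChi_le_leftIdeal {w : Op E G} (hw : w ∈ hChi E H χ) : w ∈ leftIdeal E H χ :=
  Submodule.subset_span ⟨1, mem_invDiffOps_iff.2 (one_mem _), w, hw, (one_mul w).symm⟩

variable {χ} in
-- Along `exp(tX)` in `H` the difference `Ad(exp tX) D - D` stays in the ideal, hence so does its
-- derivative at `0`, which is the commutator.
theorem commutator_mem_leftIdeal {D : Op E G} (hD : D ∈ modOps E H χ)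
    {X : GroupLieAlgebra 𝓘(ℝ, E) G} (hX : X ∈ expSet E H) :
    ∃ D' ∈ leftIdeal E H χ, leftVF X * D = D * leftVF X + D' := by
  obtain ⟨γ, hγ, hH⟩ := hX
  obtain ⟨D', hd, e⟩ := exists_hasFinDeriv_opAdHom hγ (mem_invDiffOps_iff.1 hD.1)
  refine ⟨D', hd.mem fun t => ?_, e⟩
  beta_reduce
  rw [hγ.1, opAdHom_one, opAdHom_apply]
  exact hD.2 (γ t) (hH t)

variable {χ} in
-- Moving `X̃ + dχ(X)` from the left of `D` to its right leaves an element of the ideal plus a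
-- commutator, which also lies there.
theorem leftIdeal_mul_mem {D J : Op E G} (hD : D ∈ modOps E H χ) (hJ : J ∈ leftIdeal E H χ) :
    J * D ∈ leftIdeal E H χ := by
  have key : ∀ w ∈ hChi E H χ, w * D ∈ leftIdeal E H χ := by
    intro w hw
    rw [hChi_eq_span] at hw
    induction hw using Submodule.span_induction with
    | mem w hw =>
      obtain ⟨X, hX, rfl⟩ := hw
      obtain ⟨D', hD', e⟩ := commutator_mem_leftIdeal hD hX
      have e' : shiftVF E χ X * D = D * shiftVF E χ X + D' := by
        rw [shiftVF, add_mul, mul_add, e, smul_mul_assoc, one_mul, mul_smul_comm, mul_one,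
          add_right_comm]
      rw [e']
      exact add_mem (mul_mem_leftIdeal χ (mem_invDiffOps_iff.1 hD.1)
        (hChi_le_leftIdeal χ (shiftVF_mem_hChi χ (subset_lieSub hX)))) hD'
    | zero => rw [zero_mul]; exact zero_mem _
    | add x y _ _ hx hy => rw [add_mul]; exact add_mem hx hy
    | smul a x _ hx => rw [smul_mul_assoc]; exact Submodule.smul_mem _ _ hx
  unfold leftIdeal at hJ
  induction hJ using Submodule.span_induction with
  | mem x hx =>
    obtain ⟨u, hu, w, hw, rfl⟩ := hx
    rw [mul_assoc]
    exact mul_mem_leftIdeal χ (mem_invDiffOps_iff.1 hu) (key w hw)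
  | zero => rw [zero_mul]; exact zero_mem _
  | add x y _ _ hx hy => rw [add_mul]; exact add_mem hx hy
  | smul a x _ hx => rw [smul_mul_assoc]; exact Submodule.smul_mem _ _ hx

theorem leftIdeal_le_envAlg {D : Op E G} (hD : D ∈ leftIdeal E H χ) : D ∈ envAlg E G := by
  have hw : ∀ w ∈ hChi E H χ, w ∈ envAlg E G := by
    intro w hw
    rw [hChi_eq_span] at hw
    refine (Submodule.span_le (p := Subalgebra.toSubmodule (envAlg E G))).2 ?_ hw
    rintro _ ⟨X, -, rfl⟩
    exact add_mem (leftVF_mem_envAlg _) (Subalgebra.smul_mem _ (one_mem _) _)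
  refine (Submodule.span_le (p := Subalgebra.toSubmodule (envAlg E G))).2 ?_ hD
  rintro _ ⟨v, hv, w, hw', rfl⟩
  exact (envAlg E G).mul_mem (mem_invDiffOps_iff.1 hv) (hw w hw')

variable {χ} in
theorem mem_modOps_iff {D : Op E G} : D ∈ modOps E H χ ↔
    D ∈ envAlg E G ∧ ∀ h : H, ∃ J ∈ leftIdeal E H χ, opAdHom E (h : G) D = D + J := by
  refine ⟨fun h => ⟨mem_invDiffOps_iff.1 h.1, fun g => ⟨_, h.2 g g.2, ?_⟩⟩,
    fun h => ⟨mem_invDiffOps_iff.2 h.1, fun g hg => ?_⟩⟩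
  · rw [opAdHom_apply]
    exact (add_sub_cancel D _).symm
  · obtain ⟨J, hJ, e⟩ := h.2 ⟨g, hg⟩
    rw [opAdHom_apply] at e
    exact sub_mem_of_eq_add (A := Op E G) e hJ

/-- Of the error terms in `(x + z) * (y + w)`, those ending in `w` lie in the left ideal at once; `z
* y` needs `leftIdeal_mul_mem`. -/
theorem modOps_mul_mem {x y : Op E G} (hx : x ∈ modOps E H χ) (hy : y ∈ modOps E H χ) :
    x * y ∈ modOps E H χ := by
  have hx' := mem_modOps_iff.1 hx
  have hy' := mem_modOps_iff.1 hy
  refine mem_modOps_iff.2 ⟨mul_mem hx'.1 hy'.1, fun h => ?_⟩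
  obtain ⟨z, hz, hxz⟩ := hx'.2 h
  obtain ⟨w, hw, hyw⟩ := hy'.2 h
  refine ⟨x * w + (z * y + z * w), add_mem (mul_mem_leftIdeal χ hx'.1 hw)
    (add_mem (leftIdeal_mul_mem hy hz) (mul_mem_leftIdeal χ (leftIdeal_le_envAlg χ hz) hw)), ?_⟩
  rw [map_mul, hxz, hyw, add_mul, mul_add, mul_add, add_assoc]

theorem modOps_add_mem {x y : Op E G} (hx : x ∈ modOps E H χ) (hy : y ∈ modOps E H χ) :
    x + y ∈ modOps E H χ := by
  have hx' := mem_modOps_iff.1 hx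
  have hy' := mem_modOps_iff.1 hy
  refine mem_modOps_iff.2 ⟨add_mem hx'.1 hy'.1, fun h => ?_⟩
  obtain ⟨z, hz, hxz⟩ := hx'.2 h
  obtain ⟨w, hw, hyw⟩ := hy'.2 h
  exact ⟨z + w, add_mem hz hw, by rw [map_add, hxz, hyw, add_add_add_comm]⟩

theorem algebraMap_mem_modOps (z : ℂ) : algebraMap ℂ (Op E G) z ∈ modOps E H χ :=
  mem_modOps_iff.2 ⟨Subalgebra.algebraMap_mem _ z, fun h =>
    ⟨0, zero_mem _, by rw [AlgHom.commutes, add_zero]⟩⟩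

variable (E) in
/-- `𝔻_{H,χ,mod}(G)` as an algebra. -/
def modAlg : Subalgebra ℂ (Op E G) where
  carrier := modOps E H χ
  mul_mem' := modOps_mul_mem χ
  add_mem' := modOps_add_mem χ
  algebraMap_mem' := algebraMap_mem_modOps χ

theorem mem_modAlg_iff {D : Op E G} : D ∈ modAlg E χ ↔ D ∈ modOps E H χ :=
  Iff.rfl

variable (E) in
/-- The restriction of `𝔻_{H,χ,mod}(G)` to `C^∞_{H,χ}(G)` as a homomorphism of algebras. -/
def restrictHom : modAlg E χ →ₐ[ℂ] Module.End ℂ (equivariantFun E H χ) where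
  toFun D := restrictOp ⟨D.1, (mem_modAlg_iff χ).1 D.2⟩
  map_one' := rfl
  map_mul' _ _ := rfl
  map_zero' := rfl
  map_add' _ _ := rfl
  commutes' _ := rfl

/-! ### The adjoint action on symbols -/

variable {𝔪 : Submodule ℝ (GroupLieAlgebra 𝓘(ℝ, E) G)} (hc : IsCompl 𝔪 (lieSub E H))
  {r s : ℕ} (b : Module.Basis (Fin r) ℝ 𝔪) (c : Module.Basis (Fin s) ℝ (lieSub E H))

theorem opAdHom_letter_mem_wordFilt (h : G) (a : Fin r ⊕ Fin s) :
    opAdHom E h (letter χ hc b c a) ∈ wordFilt (letter χ hc b c) 2 := by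
  rw [letter, map_add, map_smul, map_one, opAdHom_leftVF]
  exact add_mem (leftVF_mem_wordFilt χ hc b c _)
    (Submodule.smul_mem _ _ (one_mem_wordFilt (by omega)))

theorem opAdHom_mem_wordFilt (h : G) {k : ℕ} {D : Op E G}
    (hD : D ∈ wordFilt (letter χ hc b c) k) : opAdHom E h D ∈ wordFilt (letter χ hc b c) k := by
  unfold wordFilt at hD
  induction hD using Submodule.span_induction with
  | mem x hx =>
    obtain ⟨l, hl, rfl⟩ := hx
    rw [wordProd, map_list_prod]
    refine wordFilt_mono (by simpa using hl) (list_prod_mem_wordFilt _ fun y hy => ?_)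
    simp only [List.map_map, List.mem_map] at hy
    obtain ⟨a, -, rfl⟩ := hy
    exact opAdHom_letter_mem_wordFilt χ hc b c h a
  | zero => rw [map_zero]; exact zero_mem _
  | add x y _ _ hx hy => rw [map_add]; exact add_mem hx hy
  | smul a x _ hx => rw [map_smul]; exact Submodule.smul_mem _ _ hx

/-- Invariance of the differential of `χ` turns `Ad(h)(X̃ + dχ(X))` into the shifted field of `Ad(h)
X`, again an element of `𝔥^χ`. -/
theorem opAdHom_mem_wordIdeal {h : G} (hh : h ∈ H) {D : Op E G}
    (hD : D ∈ wordIdeal (letter χ hc b c)) : opAdHom E h D ∈ wordIdeal (letter χ hc b c) := by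
  unfold wordIdeal at hD
  induction hD using Submodule.span_induction with
  | mem x hx =>
    obtain ⟨l, j, rfl⟩ := hx
    rw [map_mul]
    refine mul_mem_wordIdeal_of_mem_span (opAdHom_mem_wordFilt χ hc b c h
      (wordProd_mem_wordFilt l (Nat.lt_succ_self _))) ?_
    have e : opAdHom E h (letter χ hc b c (Sum.inr j)) =
        shiftVF E χ (Ad h (c j : GroupLieAlgebra 𝓘(ℝ, E) G)) := by
      rw [letter_inr, shiftVF, map_add, opAdHom_leftVF, map_smul, map_one, shiftVF,
        charDeriv_Ad χ hh (c j).2]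
    rw [e, ← hChi_eq_span_letter χ hc b c]
    exact shiftVF_mem_hChi χ (Ad_mem_lieSub hh (c j).2)
  | zero => rw [map_zero]; exact zero_mem _
  | add x y _ _ hx hy => rw [map_add]; exact add_mem hx hy
  | smul a x _ hx => rw [map_smul]; exact Submodule.smul_mem _ _ hx

theorem aeval_monomial_eq_list_prod {B : Type*} [CommRing B] [Algebra ℂ B] (f : Fin r → B)
    (α : Fin r →₀ ℕ) : MvPolynomial.aeval f (MvPolynomial.monomial α (1 : ℂ)) =
      (α.toMultiset.toList.map f).prod := by
  rw [MvPolynomial.aeval_monomial, map_one, one_mul, ← Multiset.prod_coe, ← Multiset.map_coe,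
    Multiset.coe_toList, Finsupp.toMultiset_map, Finsupp.prod_toMultiset,
    Finsupp.prod_mapDomain_index (by simp) (fun _ _ _ => pow_add _ _ _)]

section Symbols
variable {A : Type*} [Ring A] [Algebra ℂ A] {W : Fin r ⊕ Fin s → A}
  {Λ : MvPolynomial (Fin r) ℂ →ₗ[ℂ] A}

/-- An automorphism acting on the letters of the first kind by a substitution, modulo the other
letters and constants, acts on symbols by this substitution. -/
theorem IsQuantization.map_sub_mem
    (hW : ∀ a b, W a * W b - W b * W a ∈ wordFilt W 2) (hΛ : IsQuantization W Λ)
    (ad : A →ₐ[ℂ] A) (had : ∀ k x, x ∈ wordFilt W k → ad x ∈ wordFilt W k)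
    (a : Fin r → Fin r → ℂ) (hy : ∀ k, ∃ (b : Fin s → ℂ) (c : ℂ), ad (W (Sum.inl k)) =
      ∑ j, a k j • W (Sum.inl j) + ∑ j, b j • W (Sum.inr j) + c • (1 : A))
    {d : ℕ} {p : MvPolynomial (Fin r) ℂ} (hp : p.IsHomogeneous d) :
    let τ : MvPolynomial (Fin r) ℂ →ₐ[ℂ] MvPolynomial (Fin r) ℂ :=
      MvPolynomial.aeval fun k => ∑ j, MvPolynomial.C (a k j) * MvPolynomial.X j
    (τ p).IsHomogeneous d ∧ ad (Λ p) - Λ (τ p) ∈ wordFilt W d ⊔ wordIdeal W := by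
  intro τ
  refine isHomogeneous_induction (p := fun p => (τ p).IsHomogeneous d ∧
    ad (Λ p) - Λ (τ p) ∈ wordFilt W d ⊔ wordIdeal W)
    ⟨?_, ?_⟩ (fun P P' h₁ h₂ => ⟨?_, ?_⟩) (fun z P h₁ => ⟨?_, ?_⟩) (fun α hα => ?_) hp
  · rw [map_zero]
    exact MvPolynomial.isHomogeneous_zero _ _ _
  · simp
  · rw [map_add]
    exact h₁.1.add h₂.1
  · rw [map_add, map_add, map_add, map_add, add_sub_add_comm]
    exact add_mem h₁.2 h₂.2
  · rw [map_smul]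
    exact (MvPolynomial.homogeneousSubmodule (Fin r) ℂ d).smul_mem z h₁.1
  · rw [map_smul, map_smul, map_smul, map_smul, ← smul_sub]
    exact Submodule.smul_mem _ _ h₁.2
  · obtain ⟨h₁, h₂⟩ := hΛ.list_prod_sub_mem hW (fun k => ad (W (Sum.inl k))) a hy
      α.toMultiset.toList
    have h₃ := had _ _ (hΛ α)
    rw [length_toList_toMultiset, hα] at h₁ h₂
    rw [hα] at h₃
    rw [← aeval_monomial_eq_list_prod] at h₁ h₂
    refine ⟨h₁, ?_⟩
    have e : ad (wordProd W (α.toMultiset.toList.map Sum.inl)) =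
        (α.toMultiset.toList.map fun k => ad (W (Sum.inl k))).prod := by
      rw [wordProd, map_list_prod, List.map_map, List.map_map]
      rfl
    rw [map_sub, e] at h₃
    have := add_mem (Submodule.mem_sup_left (T := wordIdeal W) h₃) h₂
    rwa [sub_add_sub_cancel] at this

end Symbols

/-- On letters of the first kind, modulo the other letters and constants, `Ad(h)` has the matrix of
`σ ∘ Ad(h)`. -/
theorem opAdHom_symmetrization_sub_mem (h : G) {d : ℕ} {p : MvPolynomial (Fin r) ℂ}
    (hp : p.IsHomogeneous d) : (symMap b (sigmaAd hc h) p).IsHomogeneous d ∧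
      opAdHom E h (symmetrization (fun j => (b j : GroupLieAlgebra 𝓘(ℝ, E) G)) p) -
        symmetrization (fun j => (b j : GroupLieAlgebra 𝓘(ℝ, E) G)) (symMap b (sigmaAd hc h) p) ∈
          wordFilt (letter χ hc b c) d ⊔ wordIdeal (letter χ hc b c) :=
  (isQuantization_symmetrization χ hc b c).map_sub_mem (A := Op E G)
    (letter_commutator_mem_wordFilt χ hc b c) (opAdHom E h)
    (fun _ _ hx => opAdHom_mem_wordFilt χ hc b c h hx)
    (fun i j => ((b.repr (sigmaAd hc h (b i)) j : ℝ) : ℂ)) (fun i => by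
      rw [letter_inl, opAdHom_leftVF]
      exact exists_leftVF_eq_sum_letter χ hc b c _) hp

end InvDiffOp

/-! ### Degrees of polynomials and the final assembly. -/

namespace InvDiffOp

/-- Homogeneity gives `polyDegree P ≤ d`, and this inequality suffices, so `P = 0` needs no separate
treatment. -/
theorem degree_lt_of_polyDegree_lt {r d : ℕ} {P R : MvPolynomial (Fin r) ℂ}
    (hP : P.IsHomogeneous d) (h : polyDegree R < polyDegree P) {α : Fin r →₀ ℕ}
    (hα : α ∈ R.support) : α.degree < d := by
  have h₁ : ((α.degree : ℕ) : WithBot ℕ) ≤ polyDegree R :=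
    Finset.le_sup (f := fun s : Fin r →₀ ℕ => ((s.degree : ℕ) : WithBot ℕ)) hα
  have h₂ : polyDegree P ≤ (d : WithBot ℕ) := Finset.sup_le fun β hβ => by
    rw [isHomogeneous_iff_degree.1 hP β (MvPolynomial.mem_support_iff.1 hβ)]
  exact WithBot.coe_lt_coe.1 ((h₁.trans_lt h).trans_le h₂)

end InvDiffOp
end

open InvDiffOp
theorem lemma4p1
    {E : Type*} [NormedAddCommGroup E] [NormedSpace ℝ E] [FiniteDimensional ℝ E]
    {G : Type*} [TopologicalSpace G] [T2Space G] [ChartedSpace E G] [Group G]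
    [LieGroup 𝓘(ℝ, E) ∞ G]
    (H : Subgroup G) (hH : IsClosed (H : Set G)) (χ : H →ₜ* ℂˣ)
    (𝔪 : Submodule ℝ (GroupLieAlgebra 𝓘(ℝ, E) G)) (hc : IsCompl 𝔪 (lieSub E H))
    {r : ℕ} (b : Module.Basis (Fin r) ℝ 𝔪)
    {l : ℕ} (P Q : Fin l → MvPolynomial (Fin r) ℂ)
    (hhom : ∀ i, ∃ d : ℕ, (P i).IsHomogeneous d)
    (hP : Algebra.adjoin ℂ (Set.range P) = modInvariants hc b)
    (hdeg : ∀ i, polyDegree (P i - Q i) < polyDegree (P i))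
    (hQ : ∀ i, symmetrization (fun j => (b j : GroupLieAlgebra 𝓘(ℝ, E) G)) (Q i) ∈ modOps E H χ) :
    (Algebra.adjoin ℂ (Set.range fun i =>
        restrictOp (⟨symmetrization (fun j => (b j : GroupLieAlgebra 𝓘(ℝ, E) G)) (Q i), hQ i⟩ :
          modOps E H χ)) : Set (Module.End ℂ (equivariantFun E H χ))) =
      Set.range (restrictOp : modOps E H χ → Module.End ℂ (equivariantFun E H χ)) := by
  have hfin : Module.Finite ℝ (GroupLieAlgebra 𝓘(ℝ, E) G) := Module.Finite.of_basis (lieBasis E G)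
  set c := Module.finBasis ℝ (lieSub E H)
  have hI := leftIdeal_eq_wordIdeal χ hc b c
  have key := adjoin_eq_range_of_symbols (A := Op E G) (P := P) (Q := Q) (K := H)
    (B := Module.End ℂ (equivariantFun E H χ))
    (letter_commutator_mem_wordFilt χ hc b c) (letter_inr_commutator_mem χ hc b c)
    (exists_separating_functional (adaptedBasis hc b c) _)
    (isQuantization_symmetrization χ hc b c)
    (fun i => by
      obtain ⟨d, hd⟩ := hhom i
      exact ⟨d, hd, fun α hα => degree_lt_of_polyDegree_lt hd (hdeg i) hα⟩)
    (fun h => (opAdHom E (h : G)).toLinearMap) (fun h p => symMap b (sigmaAd hc (h : G)) p)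
    (fun h k x hx => opAdHom_mem_wordFilt χ hc b c (h : G) hx)
    (fun h x hx => opAdHom_mem_wordIdeal χ hc b c h.2 hx)
    (fun h d p hp => opAdHom_symmetrization_sub_mem χ hc b c (h : G) hp)
    (fun p hp => by
      rw [hP, modInvariants, Algebra.mem_iInf]
      exact fun h => hp h)
    (modAlg E χ) (fun x hx => exists_mem_wordFilt χ hc b c (mem_modOps_iff.1 hx).1)
    (fun x hx h => by
      obtain ⟨J, hJ, e⟩ := (mem_modOps_iff.1 hx).2 h
      rw [hI] at hJ
      exact sub_mem_of_eq_add (A := Op E G) e hJ)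
    hQ (restrictHom E χ)
    -- Elements of the ideal annihilate the equivariant functions; the converse is not required.
    (fun x hx => by
      rw [← hI] at hx
      exact LinearMap.ext fun f => Subtype.ext (leftIdeal_apply hx f.2))
  exact congrArg (fun S : Subalgebra ℂ (Module.End ℂ (equivariantFun E H χ)) =>
    (S : Set (Module.End ℂ (equivariantFun E H χ)))) key
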